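/- Let $M$ be a smooth (Hausdorff, finite-dimensional) manifold, $\pi: TM\setminus 0\to M$ the projection, $\mathcal V TM=\ker d\pi$ the vertical bundle, $i_w:T_{\pi(w)}M\to\mathcal V_wTM$, $i_w(u)=\frac{d}{dt}\big|_{0}(w+tu)$ the vertical lift, $C_w=i_w(w)$, and $\mathcal J(X)=i_w(d\pi(w)X)$ for $X\in T_w(TM\setminus 0)$. Let $S$ be a spray on $M$, i.e. a smooth vector field on $TM\setminus 0$ with $\mathcal J(S)=C$ and $[C,S]=S$, and let $\Phi_t$ be its (local) flow. Put $\Gamma_S=-[S,\mathcal J]$ (Lie derivative); the horizontal bundle $\mathcal HTM$ is the $1$-eigenbundle of $\Gamma_S$, and $\mathcal P_{\mathcal V}=\frac12(\mathbf I-\Gamma_S)$. A linear connection $\nabla$ on $\mathcal VTM\to TM\setminus 0$ satisfies **L** if $\nabla_XC=\mathcal P_{\mathcal V}(X)$ for all $X\in T(TM\setminus 0)$, and **T** if $\nabla_S\mathcal J(X)-\nabla_X\mathcal J(S)-\mathcal J([S,X])=0$ for all vector fields $X$. For such $\nabla$ and $0\ne w\in T_mM$ let $\mathbf R_w(u)=i_w^{-1}\big(\mathcal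 R(w^{\mathfrak h},u^{\mathfrak h})w^{\mathfrak v}\big)$, where $\mathcal R(X,Y)Z=\nabla_{[X,Y]}Z-[\nabla_X,\nabla_Y]Z$ and $\mathfrak h,\mathfrak v$ denote horizontal and vertical lifts at $w$. For a regular curve $\gamma$ and a smooth vector field $V$ along $\gamma$ let $\frac{D^{\dot\gamma}V}{dt}(t_0)=i_{\dot\gamma(t_0)}^{-1}\big(\frac{\nabla V^{\mathfrak v}}{dt}(t_0)\big)$, where $V^{\mathfrak v}$ is the vertical lift of $V$ along the horizontal lift of $\gamma$ through $\dot\gamma(t_0)$ at $t_0$. A curve $\ell(t)$ of $n$-dimensional subspaces of a $2n$-dimensional vector space is fanning if it has local smooth frames $(a_1,\dots,a_n)$ such that $(a_i(t),\dot a_i(t))$ is a basis; then $\mathbf F(t)$ is the endomorphism with $\mathbf F a_i=0$, $\mathbf F\dot a_i=a_i$, and $\mathbf P_\ell=\mathbf I-\frac12(\mathbf I+\dot{\mathbf F})$, $\mathbf K=\frac14\ddot{\mathbf F}^2$ (the Jacobi endomorphism). **Statement.** (a) Let $\gamma:I\to M$ be a geodesic of $S$ on an open interval $I\ni 0$, so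 that $\dot\gamma$ is an integral curve of $S$, let $v=\dot\gamma(0)\neq 0$, and let $\ell_v(t)=d\Phi_{-t}(\Phi_t(v))\,\mathcal V_{\Phi_t(v)}TM\subset T_v(TM)$ be the Jacobi curve. For every $t\in I$ one has $\Phi_t(v)=\dot\gamma(t)$, $\ell_v$ is fanning at $t$, the map $\iota_{v,t}=i_{\dot\gamma(t)}^{-1}\circ d\Phi_t(v):\ell_v(t)\to T_{\gamma(t)}M$ is a linear isomorphism, $\mathbf K_v(t)$ maps $\ell_v(t)$ to itself and $\mathbf P_{\ell_v}(t)$ takes values in $\ell_v(t)$. For every linear connection $\nabla$ satisfying **L** and **T**: (i) $\iota_{v,t}\circ\mathbf K_v(t)|_{\ell_v(t)}=\mathbf R_{\dot\gamma(t)}\circ\iota_{v,t}$; (ii) if $V$ is a smooth vector field along $\gamma$ and $a(t)\in\ell_v(t)$ is given by $\iota_{v,t}(a(t))=V(t)$ for $t\in I$, then $a$ is differentiable and $\frac{D^{\dot\gamma}V}{dt}(t)=\iota_{v,t}\big(\mathbf P_{\ell_v}(t)\dot a(t)\big)$. (b) Consequently $\mathbf R_w$ (for every $w\in TM\setminus 0$)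 and $D^{\dot\gamma}/dt$ (for every regular curve $\gamma$ on an open interval) are the same for all linear connections $\nabla$ satisfying **L** and **T**. -/

import Mathlib

open Set Filter Bundle
open scoped Manifold ContDiff Topology

noncomputable section

namespace SprayGeometry

/-! ### Fanning curves in a half-Grassmannian -/

section Fanning

variable {V : Type*} [NormedAddCommGroup V] [NormedSpace ℝ V]

/-- A smooth frame `A = (a₁, …, aₙ)` of the curve of subspaces `ℓ`, defined near time `t`, such that
`(a₁, …, aₙ, ȧ₁, …, ȧₙ)` is a basis of `V` at time `t`. -/
structure IsFanningFrameAt (ℓ : ℝ → Submodule ℝ V) (t : ℝ) {n : ℕ} (A : Fin n → ℝ → V) :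
    Prop where
  smooth : ∀ i, ContDiffAt ℝ ∞ (A i) t
  span_eq : ∀ᶠ s in 𝓝 t, Submodule.span ℝ (range fun i => A i s) = ℓ s
  linearIndependent :
    LinearIndependent ℝ (Sum.elim (fun i => A i t) (fun i => deriv (A i) t))
  span_eq_top :
    Submodule.span ℝ (range (Sum.elim (fun i => A i t) (fun i => deriv (A i) t))) = ⊤

/-- The curve `ℓ` is smooth and fanning at time `t`. -/
def IsFanningAt (ℓ : ℝ → Submodule ℝ V) (t : ℝ) : Prop :=
  ∃ (n : ℕ) (A : Fin n → ℝ → V), IsFanningFrameAt ℓ t A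

/-- `F` is the endomorphism of `V` with `F aᵢ(t) = 0` and `F ȧᵢ(t) = aᵢ(t)` for a frame of `ℓ`. -/
def IsFundamentalEndomorphism (ℓ : ℝ → Submodule ℝ V) (t : ℝ) (F : V →L[ℝ] V) : Prop :=
  ∃ (n : ℕ) (A : Fin n → ℝ → V), IsFanningFrameAt ℓ t A ∧
    ∀ i, F (A i t) = 0 ∧ F (deriv (A i) t) = A i t

open Classical in
/-- The fundamental endomorphism `𝐅(t)` of a fanning curve (it does not depend on the frame). -/
def fundamentalEndomorphism (ℓ : ℝ → Submodule ℝ V) (t : ℝ) : V →L[ℝ] V :=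
  if h : ∃ F : V →L[ℝ] V, IsFundamentalEndomorphism ℓ t F then h.choose else 0

/-- The projection `𝐏_h(t) = (𝐈 + 𝐅'(t)) / 2` onto the horizontal curve. -/
def projHorizontalCurve (ℓ : ℝ → Submodule ℝ V) (t : ℝ) : V →L[ℝ] V :=
  (1 / 2 : ℝ) • (ContinuousLinearMap.id ℝ V + deriv (fundamentalEndomorphism ℓ) t)

/-- The projection `𝐏_ℓ(t) = 𝐈 - 𝐏_h(t)` onto the curve itself. -/
def projCurve (ℓ : ℝ → Submodule ℝ V) (t : ℝ) : V →L[ℝ] V :=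
  ContinuousLinearMap.id ℝ V - projHorizontalCurve ℓ t

/-- The Jacobi endomorphism `𝐊(t) = 𝐅''(t)² / 4`. -/
def jacobiEndomorphism (ℓ : ℝ → Submodule ℝ V) (t : ℝ) : V →L[ℝ] V :=
  (1 / 4 : ℝ) • ((deriv (deriv (fundamentalEndomorphism ℓ)) t) ∘L
    (deriv (deriv (fundamentalEndomorphism ℓ)) t))

end Fanning

/-! ### The structure of the tangent bundle

Objects on the slit tangent bundle `TM ∖ 0` are given by functions on all of `TM`; only their
values on the open set `slit` of nonzero vectors matter. -/

section Tangent

variable {E : Type*} [NormedAddCommGroup E] [NormedSpace ℝ E]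
  {M : Type*} [TopologicalSpace M] [ChartedSpace E M] [IsManifold 𝓘(ℝ, E) ∞ M]

variable (E M) in
/-- The tangent bundle `TM`. -/
abbrev TM : Type _ := TangentBundle 𝓘(ℝ, E) M

/-- The tangent space `T_m M`. -/
abbrev T (m : M) : Type _ := TangentSpace 𝓘(ℝ, E) m

/-- The tangent space `T_p (TM)` of the manifold `TM`. -/
abbrev TT (p : TM E M) : Type _ := TangentSpace (𝓘(ℝ, E).tangent) p

variable (E M) in
/-- The set `TM ∖ 0` of nonzero tangent vectors. -/
def slit : Set (TM E M) := {p | p.2 ≠ 0}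

/-- The differential `dπ(p)` of the projection `π : TM → M`. -/
def dproj (p : TM E M) : TT p →L[ℝ] T (E := E) p.1 :=
  mfderiv (𝓘(ℝ, E).tangent) 𝓘(ℝ, E) (fun q : TM E M => q.1) p

/-- The vertical tangent space `𝒱_p TM`. -/
def vertical (p : TM E M) : Submodule ℝ (TT p) := LinearMap.ker (dproj p).toLinearMap

/-- The straight line `t ↦ p + t u` in the fibre of `TM` through `p`. -/
def fibreLine (p : TM E M) (u : T (E := E) p.1) (t : ℝ) : TM E M := ⟨p.1, p.2 + t • u⟩

/-- The vertical lift `i_p(u) = (d/dt)|₀ (p + t u)`. -/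
def vlift (p : TM E M) (u : T (E := E) p.1) : TT p :=
  mfderiv 𝓘(ℝ, ℝ) (𝓘(ℝ, E).tangent) (fibreLine p u) 0 (1 : ℝ)

theorem dproj_vlift (p : TM E M) (u : T (E := E) p.1) : dproj p (vlift p u) = 0 := by
  have h0 : fibreLine p u 0 = p := by simp [fibreLine]
  by_cases h : MDifferentiableAt 𝓘(ℝ, ℝ) (𝓘(ℝ, E).tangent) (fibreLine p u) 0
  · have hπ : MDifferentiableAt (𝓘(ℝ, E).tangent) 𝓘(ℝ, E) (fun q : TM E M => q.1)
        (fibreLine p u 0) :=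
      (contMDiff_proj (n := 1) (TangentSpace 𝓘(ℝ, E) : M → Type _)).mdifferentiableAt one_ne_zero
    have hc := mfderiv_comp (0 : ℝ) hπ h
    have hconst : (fun q : TM E M => q.1) ∘ fibreLine p u = fun _ => p.1 := rfl
    rw [hconst, mfderiv_const] at hc
    have := congrArg (fun L => L (1 : ℝ)) hc
    rw [h0] at this
    exact this.symm
  · have : vlift p u = 0 := by
      unfold vlift
      rw [mfderiv_zero_of_not_mdifferentiableAt h]
      rfl
    rw [this, map_zero]

/-- The inverse of `i_p`, from the vertical space at `p` to `T_{π(p)} M`. -/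
def vliftInv (p : TM E M) (ξ : TT p) : T (E := E) p.1 := Function.invFun (vlift p) ξ

/-- The vertical lift as a map into the vertical space. -/
def vliftV (p : TM E M) (u : T (E := E) p.1) : vertical p := ⟨vlift p u, dproj_vlift p u⟩

/-- The canonical vector field `C`. -/
def canonicalField (p : TM E M) : vertical p := vliftV p p.2

/-- The almost-tangent structure `𝒥(ξ) = i_p(dπ(p) ξ)`. -/
def almostTangent (p : TM E M) (ξ : TT p) : vertical p := vliftV p (dproj p ξ)

/-- The vector field `X` on `TM` is smooth on `U`. -/
def SmoothOn (X : ∀ p : TM E M, TT p) (U : Set (TM E M)) : Prop :=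
  ContMDiffOn (𝓘(ℝ, E).tangent) ((𝓘(ℝ, E).tangent).tangent) ∞
    (fun p => (⟨p, X p⟩ : TangentBundle (𝓘(ℝ, E).tangent) (TM E M))) U

/-- The vector field `X` on `TM` is differentiable at `p`. -/
def DiffAt (X : ∀ p : TM E M, TT p) (p : TM E M) : Prop :=
  MDifferentiableAt (𝓘(ℝ, E).tangent) ((𝓘(ℝ, E).tangent).tangent)
    (fun p => (⟨p, X p⟩ : TangentBundle (𝓘(ℝ, E).tangent) (TM E M))) p

/-- The Lie bracket of vector fields on `TM`. -/
def bracket (X Y : ∀ p : TM E M, TT p) (p : TM E M) : TT p :=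
  VectorField.mlieBracket (𝓘(ℝ, E).tangent) X Y p

/-- `S` is a spray: a smooth vector field on `TM ∖ 0` with `𝒥(S) = C` and `[C, S] = S`. -/
structure IsSpray (S : ∀ p : TM E M, TT p) : Prop where
  smooth : SmoothOn S (slit E M)
  almostTangent_eq : ∀ p ∈ slit E M, almostTangent p (S p) = canonicalField p
  homogeneous : ∀ p ∈ slit E M,
    bracket (fun q => (canonicalField q : TT q)) S p = S p

/-- The velocity `γ'(t)` of a curve in `M`, as a point of `TM`. -/
def velocity (γ : ℝ → M) (t : ℝ) : TM E M :=
  ⟨γ t, mfderiv 𝓘(ℝ, ℝ) 𝓘(ℝ, E) γ t (1 : ℝ)⟩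

/-- `γ` is a smooth curve on `J` with nowhere vanishing velocity. -/
def IsRegularOn (γ : ℝ → M) (J : Set ℝ) : Prop :=
  ContMDiffOn 𝓘(ℝ, ℝ) 𝓘(ℝ, E) ∞ γ J ∧ ∀ t ∈ J, velocity γ t ∈ slit E M

/-- `γ` is a geodesic of `S` on `J`: its velocity is an integral curve of `S` in `TM ∖ 0`. -/
def IsGeodesicOn (S : ∀ p : TM E M, TT p) (γ : ℝ → M) (J : Set ℝ) : Prop :=
  IsRegularOn (E := E) γ J ∧ IsMIntegralCurveOn (I := 𝓘(ℝ, E).tangent) (velocity γ) S J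

/-- `V` is a smooth vector field along `γ`. -/
def IsSmoothAlongOn (γ : ℝ → M) (V : ∀ t, T (E := E) (γ t)) (J : Set ℝ) : Prop :=
  ContMDiffOn 𝓘(ℝ, ℝ) (𝓘(ℝ, E).tangent) ∞ (fun t => (⟨γ t, V t⟩ : TM E M)) J

/-! ### The flow of the spray and its Jacobi curves -/

/-- `c` is an integral curve of `S` in `TM ∖ 0`, on an open interval that contains `0` and `t`,
which starts at `p`. -/
def IsTrajectory (S : ∀ p : TM E M, TT p) (p : TM E M) (t : ℝ) (c : ℝ → TM E M) : Prop :=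
  c 0 = p ∧ ∃ a b : ℝ, 0 ∈ Ioo a b ∧ t ∈ Ioo a b ∧ (∀ s ∈ Ioo a b, c s ∈ slit E M) ∧
    IsMIntegralCurveOn (I := 𝓘(ℝ, E).tangent) c S (Ioo a b)

open Classical in
/-- The maximal flow `Φ_t(p)` of `S` on `TM ∖ 0` (with the value `p` where it is not defined). -/
def flow (S : ∀ p : TM E M, TT p) (t : ℝ) (p : TM E M) : TM E M :=
  if h : ∃ c, IsTrajectory S p t c then h.choose t else p

/-- The differential `dΦ_t(p)`. -/
def dflow (S : ∀ p : TM E M, TT p) (t : ℝ) (p : TM E M) : TT p →L[ℝ] TT (flow S t p) :=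
  mfderiv (𝓘(ℝ, E).tangent) (𝓘(ℝ, E).tangent) (flow S t) p

/-- The Jacobi curve `ℓ_v(t) = dΦ_{-t}(Φ_t(v)) 𝒱_{Φ_t(v)} TM` in `T_v TM`, where the tangent space
`T_v TM` is Mathlib's `TangentSpace`, that is, the model vector space `E × E`. -/
def jacobiCurve (S : ∀ p : TM E M, TT p) (v : TM E M) (t : ℝ) : Submodule ℝ (E × E) :=
  Submodule.map (dflow S (-t) (flow S t v)).toLinearMap (vertical (flow S t v))

/-- The map `ι_{v,t} = i⁻¹ ∘ dΦ_t(v)`, where `i` is the vertical lift at `Φ_t(v)`. -/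
def iota (S : ∀ p : TM E M, TT p) (v : TM E M) (t : ℝ) (a : TT v) : T (E := E) (flow S t v).1 :=
  vliftInv (flow S t v) (dflow S t v a)

/-! ### The connection `Γ_S` and the horizontal bundle -/

/-- The canonical connection `Γ_S = -[S, 𝒥]`, that is,
`Γ_S(X) = 𝒥([S, X]) - [S, 𝒥(X)]`, evaluated at a tangent vector `ξ` through an extension of `ξ`
to a vector field. -/
def grifone (S : ∀ p : TM E M, TT p) (p : TM E M) (ξ : TT p) : TT p :=
  (almostTangent p (bracket S (FiberBundle.extend (E × E) ξ) p) : TT p) -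
    bracket S (fun q => (almostTangent q (FiberBundle.extend (E × E) ξ q) : TT q)) p

/-- The vector `ξ` belongs to the horizontal bundle, the 1-eigenbundle of `Γ_S`. -/
def IsHorizontal (S : ∀ p : TM E M, TT p) (p : TM E M) (ξ : TT p) : Prop := grifone S p ξ = ξ

/-- The projection `𝒫_𝒱` onto the vertical bundle along the horizontal bundle. -/
def projVertical (S : ∀ p : TM E M, TT p) (p : TM E M) (ξ : TT p) : TT p :=
  (1 / 2 : ℝ) • (ξ - grifone S p ξ)

/-- The horizontal lift of `u ∈ T_{π(p)} M` to `p`. -/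
def hlift (S : ∀ p : TM E M, TT p) (p : TM E M) (u : T (E := E) p.1) : TT p :=
  Function.invFunOn (dproj p) {ξ | IsHorizontal S p ξ} u

/-! ### Linear connections on the vertical bundle -/

variable (E M) in
/-- An operator `(Y, p, ξ) ↦ ∇_ξ Y (p)` on sections of the vertical bundle. -/
abbrev VConn : Type _ := (∀ p : TM E M, vertical p) → ∀ p : TM E M, TT p →ₗ[ℝ] vertical p

/-- The differential `df(p) ξ` of a real function on `TM`. -/
def dfun (f : TM E M → ℝ) (p : TM E M) (ξ : TT p) : ℝ :=
  mfderiv (𝓘(ℝ, E).tangent) 𝓘(ℝ, ℝ) f p ξ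

/-- `∇` is a smooth linear connection on the vertical bundle over `TM ∖ 0`. -/
structure IsLinearConnection (N : VConn E M) : Prop where
  add : ∀ (Y Z : ∀ p : TM E M, vertical p), ∀ p ∈ slit E M,
    DiffAt (fun q => (Y q : TT q)) p → DiffAt (fun q => (Z q : TT q)) p →
    N (fun q => Y q + Z q) p = N Y p + N Z p
  leibniz : ∀ (f : TM E M → ℝ) (Y : ∀ p : TM E M, vertical p), ∀ p ∈ slit E M,
    MDifferentiableAt (𝓘(ℝ, E).tangent) 𝓘(ℝ, ℝ) f p → DiffAt (fun q => (Y q : TT q)) p →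
    ∀ ξ : TT p, N (fun q => f q • Y q) p ξ =
      f p • N Y p ξ + dfun f p ξ • Y p
  smooth : ∀ (X : ∀ p : TM E M, TT p) (Y : ∀ p : TM E M, vertical p) (U : Set (TM E M)),
    IsOpen U → U ⊆ slit E M → SmoothOn X U → SmoothOn (fun q => (Y q : TT q)) U →
    SmoothOn (fun q => (N Y q (X q) : TT q)) U

/-- Condition **L**: `∇_ξ C = 𝒫_𝒱(ξ)`. -/
def ConditionL (S : ∀ p : TM E M, TT p) (N : VConn E M) : Prop :=
  ∀ p ∈ slit E M, ∀ ξ : TT p, (N canonicalField p ξ : TT p) = projVertical S p ξ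

/-- The torsion `T(X, Y) = ∇_X 𝒥(Y) - ∇_Y 𝒥(X) - 𝒥([X, Y])`. -/
def torsion (N : VConn E M) (X Y : ∀ p : TM E M, TT p) (p : TM E M) : vertical p :=
  N (fun q => almostTangent q (Y q)) p (X p) - N (fun q => almostTangent q (X q)) p (Y p) -
    almostTangent p (bracket X Y p)

/-- Condition **T**: `T(S, X) = 0` for all `X`. -/
def ConditionT (S : ∀ p : TM E M, TT p) (N : VConn E M) : Prop :=
  ∀ (U : Set (TM E M)) (X : ∀ p : TM E M, TT p), IsOpen U → U ⊆ slit E M → SmoothOn X U →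
    ∀ p ∈ U, torsion N S X p = 0

/-- A linear connection on the vertical bundle that satisfies **L** and **T**. -/
structure IsAdapted (S : ∀ p : TM E M, TT p) (N : VConn E M) : Prop where
  isLinearConnection : IsLinearConnection N
  conditionL : ConditionL S N
  conditionT : ConditionT S N

/-! ### The curvature endomorphism -/

/-- The curvature tensor `ℛ(X, Y)Z = ∇_{[X,Y]}Z - (∇_X ∇_Y Z - ∇_Y ∇_X Z)`. -/
def curvature (N : VConn E M) (X Y : ∀ p : TM E M, TT p) (Z : ∀ p : TM E M, vertical p)
    (p : TM E M) : vertical p :=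
  N Z p (bracket X Y p) - (N (fun q => N Z q (Y q)) p (X p) - N (fun q => N Z q (X q)) p (Y p))

/-- `R_w(u, v)z = i_w⁻¹ ℛ(u^𝔥, v^𝔥) z^𝔳`, the lifts at `w` being extended by the lifts of vector
fields on `M` which extend `u`, `v`, `z`. -/
def curvatureTensor (S : ∀ p : TM E M, TT p) (N : VConn E M) (w : TM E M)
    (u v z : T (E := E) w.1) : T (E := E) w.1 :=
  vliftInv w (curvature N
    (fun q => hlift S q (FiberBundle.extend E u q.1))
    (fun q => hlift S q (FiberBundle.extend E v q.1))
    (fun q => vliftV q (FiberBundle.extend E z q.1)) w : TT w)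

/-- The curvature endomorphism `𝐑_w(u) = R_w(w, u)w`. -/
def curvatureEndomorphism (S : ∀ p : TM E M, TT p) (N : VConn E M) (w : TM E M)
    (u : T (E := E) w.1) : T (E := E) w.1 :=
  curvatureTensor S N w w.2 u w.2

/-! ### The covariant derivative along a curve -/

/-- The curve `c` in `TM` is a horizontal lift of `γ` near `t₀`. -/
structure IsHorizontalLiftAt (S : ∀ p : TM E M, TT p) (γ : ℝ → M) (t₀ : ℝ) (c : ℝ → TM E M) :
    Prop where
  smooth : ContMDiffAt 𝓘(ℝ, ℝ) (𝓘(ℝ, E).tangent) ∞ c t₀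
  isLift : ∀ᶠ s in 𝓝 t₀, (c s).1 = γ s
  horizontal : ∀ᶠ s in 𝓝 t₀,
    IsHorizontal S (c s) (mfderiv 𝓘(ℝ, ℝ) (𝓘(ℝ, E).tangent) c s (1 : ℝ))

/-- The vector of `T_x M` with coordinates `e` in the trivialization of `TM` around `x₀`. -/
def ofCoord (x₀ : M) (e : E) (x : M) : T (E := E) x :=
  (trivializationAt E (TangentSpace 𝓘(ℝ, E) : M → Type _) x₀).symm x e

/-- The covariant derivative `∇Z/dt` at `t₀` of a vertical field `Z` along the curve `c` in `TM`:
if `Z = ∑ ζⁱ eᵢ(c)` for the local frame of the vertical bundle given by the vertical lifts `eᵢ` of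
a coordinate frame of `M` around `π(c(t₀))`, then
`∇Z/dt (t₀) = ∑ (ζⁱ)'(t₀) eᵢ + ∇_{c'(t₀)} (∑ ζⁱ(t₀) eᵢ)`. -/
def covDerivAlong (N : VConn E M) (c : ℝ → TM E M) (Z : ∀ t, vertical (c t)) (t₀ : ℝ) :
    vertical (c t₀) :=
  let ζ : ℝ → E := fun t =>
    (trivializationAt E (TangentSpace 𝓘(ℝ, E) : M → Type _) (c t₀).1
      ⟨(c t).1, vliftInv (c t) (Z t : TT (c t))⟩).2
  vliftV (c t₀) (ofCoord (c t₀).1 (deriv ζ t₀) (c t₀).1) +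
    N (fun q => vliftV q (ofCoord (c t₀).1 (ζ t₀) q.1)) (c t₀)
      (mfderiv 𝓘(ℝ, ℝ) (𝓘(ℝ, E).tangent) c t₀ (1 : ℝ))

open Classical in
/-- `D^w V/dt = i_w⁻¹ (∇V^𝔳/dt)(t₀)`, where `V^𝔳` is the vertical lift of `V` along the horizontal
lift of `γ` through `w` at `t₀`. -/
def covDeriv (S : ∀ p : TM E M, TT p) (N : VConn E M) (γ : ℝ → M) (V : ∀ t, T (E := E) (γ t))
    (t₀ : ℝ) (w : T (E := E) (γ t₀)) : T (E := E) (γ t₀) :=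
  if h : ∃ c : ℝ → TM E M, c t₀ = ⟨γ t₀, w⟩ ∧ IsHorizontalLiftAt S γ t₀ c then
    vliftInv (⟨γ t₀, w⟩ : TM E M)
      (covDerivAlong N h.choose (fun t => vliftV (h.choose t) (V t)) t₀ : TT (h.choose t₀))
  else 0

/-- The covariant derivative `D^{γ'} V/dt` along a regular curve `γ`. -/
def covDerivCurve (S : ∀ p : TM E M, TT p) (N : VConn E M) (γ : ℝ → M)
    (V : ∀ t, T (E := E) (γ t)) (t : ℝ) : T (E := E) (γ t) :=
  covDeriv S N γ V t (velocity γ t).2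

end Tangent

end SprayGeometry

end

open SprayGeometry

/-! Everything is reduced to a chart of `TM` centred at the point under study, where both sides of
(i) and (ii) become explicit formulas in the spray alone.

In such a chart write points as `(x, y)`. The condition `𝒥(S) = C` says that `S` has the form `(y,
g(x, y))`, and `[C, S] = S` gives Euler's relation `G y = 2 g` with `G = ∂_y g`. Computing the
brackets in `Γ_S` yields `Γ_S(a, b) = (a, G a - b)`, so the horizontal vectors are the `(a, ½ G a)`,
and `S` itself is horizontal.

Jacobi curve side. The coordinate expression `Ψ(s)` of `dΦ_s(v)` solves the linearized equation `Ψ'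
= B Ψ`, where `B(a, b) = (b, P a + Q b)` and `P = ∂_x g`, `Q = ∂_y g` are evaluated along the
velocity of the geodesic (`exists_linearized_flow`, `IsGeodesicOn.exists_transport`). The Jacobi
curve is `ℓ(s) = Ψ(s)⁻¹(0 × E)`, and the frames `Ψ⁻¹(0, bᵢ)` show that it is fanning. Its
fundamental endomorphism is `Ψ⁻¹ N Ψ` with `N(a, b) = (0, -a)`. Differentiating conjugates by `(Ψ⁻¹
X Ψ)' = Ψ⁻¹ (X' + [X, B]) Ψ` (`hasDerivAt_conj`) turns `𝐊` on `ℓ` into `½ Q' - P - ¼ Q²`, and turns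
the projected derivative of `Ψ⁻¹(0, V)` into `V' - ½ Q V`.

Connection side. In the chart, `∇_ξ Y = dY(ξ) + Γ(ξ) Y`. Condition **L** says `Γ(a, b) y = -½ G a`,
and **T** says `Γ(S) u = -½ G u`. The rest of `Γ` is not determined, but it drops out:
differentiating these two identities and Euler's relation suffices to evaluate the curvature on `w^𝔥
= S(w)`, `u^𝔥`, `w^𝔳`, with the result `½ S(G) - ∂_x g - ¼ G²` (`curvature_of_christoffel`). Along a
curve, a horizontal lift through the velocity has derivative `S` at that instant, so only `Γ(S)`
enters, and `DV/dt = V' - ½ G V` (`IsAdapted.covDerivAlong_eq`).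

Since the velocity of a geodesic is an integral curve of `S`, one has `Q' = S(G)`, and the two sides
agree. Part (b) is immediate, because the formulas on the connection side contain `S` but not `∇`,
at every `w` and along every regular curve. -/

namespace SprayGeometry

/-! ### Vector fields in a chart -/

section Coordinates

variable {G : Type*} [NormedAddCommGroup G] [NormedSpace ℝ G] {H : Type*} [TopologicalSpace H]
  (I : ModelWithCorners ℝ G H) {N : Type*} [TopologicalSpace N] [ChartedSpace H N]

/-- The coordinates of a tangent vector in the preferred chart at `p`. -/
noncomputable def coordVec (p q : N) : TangentSpace I q →L[ℝ] G :=
  mfderiv I 𝓘(ℝ, G) (extChartAt I p) q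

/-- The tangent vector at `q` with given coordinates in the preferred chart at `p`. -/
noncomputable def coordInv (p q : N) : G →L[ℝ] TangentSpace I q :=
  ContinuousLinearMap.inverse (coordVec I p q)

/-- The expression of a vector field in the preferred chart at `p`. -/
noncomputable def coordField (p : N) (X : ∀ q : N, TangentSpace I q) (z : G) : G :=
  coordVec I p ((extChartAt I p).symm z) (X ((extChartAt I p).symm z))

variable {I} [IsManifold I ∞ N] {p q : N}

theorem isInvertible_coordVec (hq : q ∈ (extChartAt I p).source) :
    (coordVec I p q).IsInvertible := isInvertible_mfderiv_extChartAt hq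

theorem coordVec_coordInv (hq : q ∈ (extChartAt I p).source) (z : G) :
    coordVec I p q (coordInv I p q z) = z :=
  (isInvertible_coordVec hq).self_apply_inverse z

theorem coordInv_coordVec (hq : q ∈ (extChartAt I p).source) (ξ : TangentSpace I q) :
    coordInv I p q (coordVec I p q ξ) = ξ :=
  (isInvertible_coordVec hq).inverse_apply_self ξ

theorem two_le_infty : (2 : WithTop ℕ∞) ≤ ∞ :=
  WithTop.coe_le_coe.2 (le_top : (2 : ℕ∞) ≤ ⊤)

theorem coordVec_injective (hq : q ∈ (extChartAt I p).source) :
    Function.Injective (coordVec I p q) :=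
  Function.LeftInverse.injective (coordInv_coordVec hq)

omit [IsManifold I ∞ N] in
theorem coordField_extChartAt (hq : q ∈ (extChartAt I p).source)
    (X : ∀ q : N, TangentSpace I q) :
    coordField I p X (extChartAt I p q) = coordVec I p q (X q) := by
  rw [coordField, (extChartAt I p).left_inv hq]

theorem hasMFDerivAt_coord (hq : q ∈ (extChartAt I p).source) :
    HasMFDerivAt I 𝓘(ℝ, G) (extChartAt I p) q (coordVec I p q) :=
  (mdifferentiableAt_extChartAt (by rwa [extChartAt_source] at hq)).hasMFDerivAt

omit [IsManifold I ∞ N] in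
theorem eventually_mem_source (hq : q ∈ (extChartAt I p).source) :
    ∀ᶠ q' in 𝓝 q, q' ∈ (extChartAt I p).source :=
  (isOpen_extChartAt_source (I := I) p).mem_nhds hq

theorem trivializationAt_snd_eq_coordVec (hq : q ∈ (extChartAt I p).source)
    (ξ : TangentSpace I q) :
    (trivializationAt G (TangentSpace I : N → Type _) p ⟨q, ξ⟩).2 = coordVec I p q ξ := by
  rw [extChartAt_source] at hq
  rw [coordVec, ← TangentBundle.continuousLinearMapAt_trivializationAt hq,
    Trivialization.continuousLinearMapAt_apply, Trivialization.coe_linearMapAt_of_mem]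
  exact hq

/-- `TangentSpace I p` is by definition the model space seen through the preferred chart at `p`.
Centring charts at the point of interest therefore lets final results be read off without a change
of coordinates. -/
theorem coordVec_self : coordVec I p p = ContinuousLinearMap.id ℝ G := by
  ext ξ
  rw [← trivializationAt_snd_eq_coordVec (mem_extChartAt_source p)]
  exact (tangentBundleCore I N).coordChange_self _ p (mem_achart_source H p) ξ

variable [I.Boundaryless]

omit [IsManifold I ∞ N] in
theorem eventually_mem_target (hq : q ∈ (extChartAt I p).source) :
    ∀ᶠ z in 𝓝 (extChartAt I p q), z ∈ (extChartAt I p).target :=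
  (isOpen_extChartAt_target (I := I) p).mem_nhds ((extChartAt I p).map_source hq)

theorem contMDiffAt_chart_symm {z : G} (hz : z ∈ (extChartAt I p).target) :
    ContMDiffAt 𝓘(ℝ, G) I ∞ (extChartAt I p).symm z :=
  (contMDiffOn_extChartAt_symm p).contMDiffAt ((isOpen_extChartAt_target (I := I) p).mem_nhds hz)

theorem hasMFDerivAt_coord_symm {z : G} (hz : z ∈ (extChartAt I p).target) :
    HasMFDerivAt 𝓘(ℝ, G) I (extChartAt I p).symm z
      (coordInv I p ((extChartAt I p).symm z)) := by
  have h := ((contMDiffAt_chart_symm hz).mdifferentiableAt (by simp)).hasMFDerivAt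
  have hq := (extChartAt I p).map_target hz
  have hcomp := HasMFDerivAt.comp z (hasMFDerivAt_coord hq) h
  have hid : HasMFDerivAt 𝓘(ℝ, G) 𝓘(ℝ, G) (extChartAt I p ∘ (extChartAt I p).symm)
      z (ContinuousLinearMap.id ℝ G) :=
    (hasMFDerivAt_id _).congr_of_eventuallyEq (by
      filter_upwards [(isOpen_extChartAt_target (I := I) p).mem_nhds hz] with z hz
      exact (extChartAt I p).right_inv hz)
  have heq := hasMFDerivAt_unique hcomp hid
  refine h.congr_mfderiv ?_
  ext w
  apply coordVec_injective hq
  exact (congrArg (fun T : G →L[ℝ] G => T w) heq).trans (coordVec_coordInv hq w).symm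

theorem contMDiffAt_field_iff (hq : q ∈ (extChartAt I p).source)
    (X : ∀ q : N, TangentSpace I q) :
    ContMDiffAt I I.tangent ∞ (fun x => (⟨x, X x⟩ : TangentBundle I N)) q ↔
      ContDiffAt ℝ ∞ (coordField I p X) (extChartAt I p q) := by
  have hs : q ∈ (trivializationAt G (TangentSpace I : N → Type _) p).baseSet := by
    rwa [extChartAt_source] at hq
  rw [Trivialization.contMDiffAt_section_iff _ hs, ← contMDiffAt_iff_contDiffAt]
  have hev : (fun x => ((trivializationAt G (TangentSpace I : N → Type _) p)
      ⟨x, X x⟩).2) =ᶠ[𝓝 q] fun x => coordVec I p x (X x) := by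
    filter_upwards [eventually_mem_source hq] with x hx
    exact trivializationAt_snd_eq_coordVec hx _
  rw [hev.contMDiffAt_iff]
  constructor
  · intro h
    have h' : ContMDiffAt I 𝓘(ℝ, G) ∞ (fun x => coordVec I p x (X x))
        ((extChartAt I p).symm (extChartAt I p q)) := by rwa [(extChartAt I p).left_inv hq]
    exact h'.comp _ (contMDiffAt_chart_symm ((extChartAt I p).map_source hq))
  · intro h
    refine (h.comp q (contMDiffAt_extChartAt' (by rwa [extChartAt_source] at hq))).congr_of_eventuallyEq ?_
    filter_upwards [eventually_mem_source hq] with x hx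
    exact (coordField_extChartAt hx X).symm

theorem mdifferentiableAt_field_iff (hq : q ∈ (extChartAt I p).source)
    (X : ∀ q : N, TangentSpace I q) :
    MDifferentiableAt I I.tangent (fun x => (⟨x, X x⟩ : TangentBundle I N)) q ↔
      DifferentiableAt ℝ (coordField I p X) (extChartAt I p q) := by
  have hs : q ∈ (trivializationAt G (TangentSpace I : N → Type _) p).baseSet := by
    rwa [extChartAt_source] at hq
  have : ContMDiffVectorBundle 1 G (TangentSpace I : N → Type _) I :=
    ContMDiffVectorBundle.of_le (n := ∞) (by simp)
  rw [Trivialization.mdifferentiableAt_section_iff I _ X hs, ← mdifferentiableAt_iff_differentiableAt]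
  have hev : (fun x => ((trivializationAt G (TangentSpace I : N → Type _) p)
      ⟨x, X x⟩).2) =ᶠ[𝓝 q] fun x => coordVec I p x (X x) := by
    filter_upwards [eventually_mem_source hq] with x hx
    exact trivializationAt_snd_eq_coordVec hx _
  rw [hev.mdifferentiableAt_iff]
  constructor
  · intro h
    have h' : MDifferentiableAt I 𝓘(ℝ, G) (fun x => coordVec I p x (X x))
        ((extChartAt I p).symm (extChartAt I p q)) := by rwa [(extChartAt I p).left_inv hq]
    exact h'.comp _ (hasMFDerivAt_coord_symm
      ((extChartAt I p).map_source hq)).mdifferentiableAt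
  · intro h
    refine (h.comp q (hasMFDerivAt_coord hq).mdifferentiableAt).congr_of_eventuallyEq ?_
    filter_upwards [eventually_mem_source hq] with x hx
    exact (coordField_extChartAt hx X).symm

/-- The Lie bracket in coordinates. -/
theorem coordVec_mlieBracket [CompleteSpace G] (hq : q ∈ (extChartAt I p).source)
    {X Y : ∀ q : N, TangentSpace I q}
    (hX : MDifferentiableAt I I.tangent (fun x => (⟨x, X x⟩ : TangentBundle I N)) q)
    (hY : MDifferentiableAt I I.tangent (fun x => (⟨x, Y x⟩ : TangentBundle I N)) q) :
    coordVec I p q (VectorField.mlieBracket I X Y q) =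
      fderiv ℝ (coordField I p Y) (extChartAt I p q) (coordVec I p q (X q)) -
      fderiv ℝ (coordField I p X) (extChartAt I p q) (coordVec I p q (Y q)) := by
  have hz := (extChartAt I p).map_source hq
  have key : ∀ (W : ∀ q : N, TangentSpace I q) (z : G), z ∈ (extChartAt I p).target →
      VectorField.mpullback 𝓘(ℝ, G) I (extChartAt I p).symm W z = coordField I p W z := by
    intro W z hz
    have hq' := (extChartAt I p).map_target hz
    rw [VectorField.mpullback_apply, (hasMFDerivAt_coord_symm hz).mfderiv]
    exact congrArg (fun T : TangentSpace I ((extChartAt I p).symm z) →L[ℝ] G =>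
      T (W ((extChartAt I p).symm z))) (isInvertible_coordVec hq').inverse_inverse
  have hev : ∀ W : ∀ q : N, TangentSpace I q,
      VectorField.mpullback 𝓘(ℝ, G) I (extChartAt I p).symm W =ᶠ[𝓝 (extChartAt I p q)]
        coordField I p W := fun W => by
    filter_upwards [eventually_mem_target hq] with z hz using key W z hz
  have : IsManifold I (minSmoothness ℝ 2) N := by
    rw [minSmoothness_of_isRCLikeNormedField]
    exact IsManifold.of_le (n := ∞) (by exact two_le_infty)
  have h := VectorField.mpullback_mlieBracket (I := 𝓘(ℝ, G)) (I' := I)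
    (f := (extChartAt I p).symm) (x₀ := extChartAt I p q) (V := X) (W := Y) (n := ∞)
    (by rwa [(extChartAt I p).left_inv hq]) (by rwa [(extChartAt I p).left_inv hq])
    (contMDiffAt_chart_symm hz)
    (by rw [minSmoothness_of_isRCLikeNormedField]; exact two_le_infty)
  have h1 := key (VectorField.mlieBracket I X Y) _ hz
  rw [coordField_extChartAt hq] at h1
  have h2 := Filter.EventuallyEq.mlieBracket_vectorField_eq (I := 𝓘(ℝ, G)) (hev X) (hev Y)
  have h3 : VectorField.mlieBracket 𝓘(ℝ, G) (coordField I p X) (coordField I p Y) =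
      VectorField.lieBracket ℝ (coordField I p X) (coordField I p Y) := by
    refine VectorField.mlieBracketWithin_univ.symm.trans ?_
    exact VectorField.mlieBracketWithin_eq_lieBracketWithin.trans
      VectorField.lieBracketWithin_univ
  refine (h1.symm.trans (h.trans (h2.trans (congrFun h3 _)))).trans ?_
  rw [VectorField.lieBracket, coordField_extChartAt hq, coordField_extChartAt hq]

omit [I.Boundaryless] in
theorem hasDerivAt_coord_comp {c : ℝ → N} {t : ℝ} {ξ : TangentSpace I (c t)}
    (hq : c t ∈ (extChartAt I p).source)
    (h : HasMFDerivAt 𝓘(ℝ, ℝ) I c t ((1 : ℝ →L[ℝ] ℝ).smulRight ξ)) :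
    HasDerivAt (fun s => extChartAt I p (c s)) (coordVec I p (c t) ξ) t := by
  have h1 : HasFDerivAt (fun s => extChartAt I p (c s))
      ((1 : ℝ →L[ℝ] ℝ).smulRight (coordVec I p (c t) ξ)) t := by
    refine ((HasMFDerivAt.comp t (hasMFDerivAt_coord hq) h).congr_mfderiv ?_).hasFDerivAt
    ext
    exact (congrArg (coordVec I p (c t)) (one_smul ℝ ξ)).trans (one_smul ℝ _).symm
  simpa using h1.hasDerivAt

theorem hasMFDerivAt_symm_comp {z : ℝ → G} {t : ℝ} {w : G}
    (hz : z t ∈ (extChartAt I p).target) (h : HasDerivAt z w t) :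
    HasMFDerivAt 𝓘(ℝ, ℝ) I (fun s => (extChartAt I p).symm (z s)) t
      ((1 : ℝ →L[ℝ] ℝ).smulRight (coordInv I p ((extChartAt I p).symm (z t)) w)) := by
  refine (HasMFDerivAt.comp t (hasMFDerivAt_coord_symm hz)
    h.hasFDerivAt.hasMFDerivAt).congr_mfderiv ?_
  ext
  exact (congrArg _ (one_smul ℝ w)).trans (one_smul ℝ _).symm

end Coordinates

/-! ### Differentiability of local flows -/

section ODE

variable {G : Type*} [NormedAddCommGroup G] [NormedSpace ℝ G]

/-- If `α z` solves `α' = f(α)` near a point and `Y` solves the linearized equation along `α z₀`, then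
`Y` bounds the variation of `α` to first order. -/
theorem norm_flow_sub_sub_le {f : G → G} {f' : G → G →L[ℝ] G} {K : ℝ} (hK : 0 < K)
    {s : Set G} (hs : Convex ℝ s) (hf : ∀ z ∈ s, HasFDerivAt f (f' z) z)
    (hf'K : ∀ z ∈ s, ‖f' z‖ ≤ K)
    (hf'L : ∀ z ∈ s, ∀ z' ∈ s, ‖f' z - f' z'‖ ≤ K * ‖z - z'‖)
    {T : ℝ} (hT : 0 ≤ T) {u v : ℝ → G} {Y : ℝ → G}
    (hu : ∀ t ∈ Icc 0 T, HasDerivAt u (f (u t)) t) (hus : ∀ t ∈ Icc 0 T, u t ∈ s)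
    (hv : ∀ t ∈ Icc 0 T, HasDerivAt v (f (v t)) t) (hvs : ∀ t ∈ Icc 0 T, v t ∈ s)
    (hY : ∀ t ∈ Icc 0 T, HasDerivAt Y (f' (u t) (Y t)) t) (h0 : v 0 - u 0 - Y 0 = 0) :
    ‖v T - u T - Y T‖ ≤ (Real.exp (K * T)) ^ 3 * ‖v 0 - u 0‖ ^ 2 := by
  have hmem : ∀ t ∈ Ico (0:ℝ) T, t ∈ Icc (0:ℝ) T := fun t ht => Ico_subset_Icc_self ht
  have hlip : ∀ t ∈ Icc (0:ℝ) T, ‖v t - u t‖ ≤ ‖v 0 - u 0‖ * Real.exp (K * T) := by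
    intro t ht
    have h := norm_le_gronwallBound_of_norm_deriv_right_le (f := fun t => v t - u t)
      (f' := fun t => f (v t) - f (u t)) (δ := ‖v 0 - u 0‖) (K := K) (ε := 0) (a := 0) (b := T)
      (fun t ht => ((hv t ht).sub (hu t ht)).continuousAt.continuousWithinAt)
      (fun t ht => ((hv t (hmem t ht)).sub (hu t (hmem t ht))).hasDerivWithinAt) le_rfl
      (fun t ht => by
        rw [add_zero]
        exact hs.norm_image_sub_le_of_norm_hasFDerivWithin_le
          (fun z hz => (hf z hz).hasFDerivWithinAt) hf'K (hus t (hmem t ht)) (hvs t (hmem t ht)))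
      t ht
    rw [gronwallBound_ε0, sub_zero] at h
    refine h.trans ?_
    gcongr
    exact ht.2
  set D := ‖v 0 - u 0‖ * Real.exp (K * T) with hD
  have hD0 : 0 ≤ D := by positivity
  -- Second Grönwall estimate, now for the remainder. Its source term `f(v) - f(u) - f'(u)(v - u)`
  -- is quadratic in the separation, because `f'` is Lipschitz along the segment from `u` to `v`.
  have h := norm_le_gronwallBound_of_norm_deriv_right_le (f := fun t => v t - u t - Y t)
      (f' := fun t => f (v t) - f (u t) - f' (u t) (Y t)) (δ := 0) (K := K) (ε := K * D * D)
      (a := 0) (b := T)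
      (fun t ht => (((hv t ht).sub (hu t ht)).sub (hY t ht)).continuousAt.continuousWithinAt)
      (fun t ht => (((hv t (hmem t ht)).sub (hu t (hmem t ht))).sub
        (hY t (hmem t ht))).hasDerivWithinAt) (by rw [h0, norm_zero])
      (fun t ht => by
        have ht' := hmem t ht
        have e : f (v t) - f (u t) - f' (u t) (Y t) =
            f' (u t) (v t - u t - Y t) + (f (v t) - f (u t) - f' (u t) (v t - u t)) := by
          simp only [map_sub]; abel
        rw [e]
        refine (norm_add_le _ _).trans (add_le_add ?_ ?_)
        · exact (ContinuousLinearMap.le_opNorm _ _).trans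
            (mul_le_mul_of_nonneg_right (hf'K _ (hus t ht')) (norm_nonneg _))
        · have hseg := hs.segment_subset (hus t ht') (hvs t ht')
          have := (convex_segment (u t) (v t)).norm_image_sub_le_of_norm_hasFDerivWithin_le'
            (f := f) (f' := f') (φ := f' (u t)) (C := K * D)
            (fun z hz => (hf z (hseg hz)).hasFDerivWithinAt)
            (fun z hz => (hf'L z (hseg hz) _ (hus t ht')).trans (by
              gcongr
              exact (norm_sub_le_of_mem_segment hz).trans (hlip t ht')))
            (left_mem_segment ℝ _ _) (right_mem_segment ℝ _ _)
          refine this.trans ?_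
          gcongr
          exact hlip t ht')
      T ⟨hT, le_rfl⟩
  rw [gronwallBound_of_K_ne_0 hK.ne'] at h
  simp only [zero_mul, zero_add, sub_zero] at h
  refine h.trans ?_
  have e : K * D * D / K = D * D := by field_simp
  rw [e, hD]
  have : Real.exp (K * T) - 1 ≤ Real.exp (K * T) := by linarith
  -- Two exponentials come from the square of the separation `D`, the third from the second Grönwall
  -- estimate.
  calc _ ≤ ‖v 0 - u 0‖ * Real.exp (K * T) * (‖v 0 - u 0‖ * Real.exp (K * T)) * Real.exp (K * T) := by
        gcongr
    _ = _ := by ring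

/-- A version of `norm_flow_sub_sub_le` for times of both signs. -/
theorem norm_flow_sub_sub_le_abs {f : G → G} {f' : G → G →L[ℝ] G} {K : ℝ} (hK : 0 < K)
    {s : Set G} (hs : Convex ℝ s) (hf : ∀ z ∈ s, HasFDerivAt f (f' z) z)
    (hf'K : ∀ z ∈ s, ‖f' z‖ ≤ K)
    (hf'L : ∀ z ∈ s, ∀ z' ∈ s, ‖f' z - f' z'‖ ≤ K * ‖z - z'‖)
    {ε T : ℝ} (hT : T ∈ Ioo (-ε) ε) {u v : ℝ → G} {Y : ℝ → G}
    (hu : ∀ t ∈ Ioo (-ε) ε, HasDerivAt u (f (u t)) t) (hus : ∀ t ∈ Ioo (-ε) ε, u t ∈ s)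
    (hv : ∀ t ∈ Ioo (-ε) ε, HasDerivAt v (f (v t)) t) (hvs : ∀ t ∈ Ioo (-ε) ε, v t ∈ s)
    (hY : ∀ t ∈ Ioo (-ε) ε, HasDerivAt Y (f' (u t) (Y t)) t) (h0 : v 0 - u 0 - Y 0 = 0) :
    ‖v T - u T - Y T‖ ≤ (Real.exp (K * |T|)) ^ 3 * ‖v 0 - u 0‖ ^ 2 := by
  rcases le_or_gt 0 T with h | h
  · have hm : ∀ t ∈ Icc 0 T, t ∈ Ioo (-ε) ε := fun t ht =>
      ⟨by linarith [ht.1, hT.1, hT.2], by linarith [ht.2, hT.2]⟩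
    rw [abs_of_nonneg h]
    exact norm_flow_sub_sub_le hK hs hf hf'K hf'L h (fun t ht => hu t (hm t ht))
      (fun t ht => hus t (hm t ht)) (fun t ht => hv t (hm t ht)) (fun t ht => hvs t (hm t ht))
      (fun t ht => hY t (hm t ht)) h0
  · have hm : ∀ t ∈ Icc 0 (-T), -t ∈ Ioo (-ε) ε := fun t ht =>
      ⟨by linarith [ht.2, hT.1], by linarith [ht.1, hT.1, hT.2]⟩
    have hneg : ∀ {w : ℝ → G} {w' : G} {t : ℝ}, HasDerivAt w w' (-t) →
        HasDerivAt (fun s => w (-s)) (-w') t := fun {w w' t} hw => by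
      simpa [Function.comp_def] using hw.scomp t (hasDerivAt_neg t)
    have := norm_flow_sub_sub_le (f := fun z => -f z) (f' := fun z => -f' z) hK hs
      (fun z hz => (hf z hz).neg) (fun z hz => by rw [norm_neg]; exact hf'K z hz)
      (fun z hz z' hz' => by
        rw [neg_sub_neg, norm_sub_rev]; exact hf'L z hz z' hz') (T := -T) (by linarith)
      (u := fun t => u (-t)) (v := fun t => v (-t)) (Y := fun t => Y (-t))
      (fun t ht => hneg (hu _ (hm t ht))) (fun t ht => hus _ (hm t ht))
      (fun t ht => hneg (hv _ (hm t ht))) (fun t ht => hvs _ (hm t ht))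
      (fun t ht => hneg (hY _ (hm t ht))) (by simpa using h0)
    simpa [abs_of_neg h] using this

/-- A smooth vector field has a local flow, whose differential solves the linearized equation. -/
theorem exists_local_flow [CompleteSpace G] {f : G → G} {z₀ : G} (hf : ContDiffAt ℝ ∞ f z₀)
    {W : Set G} (hW : W ∈ 𝓝 z₀) :
    ∃ ε > 0, ∃ U : Set G, IsOpen U ∧ z₀ ∈ U ∧ ∃ (α : G → ℝ → G) (Y : G → ℝ → G →L[ℝ] G),
      ∀ z ∈ U, α z 0 = z ∧ Y z 0 = ContinuousLinearMap.id ℝ G ∧ ∀ t ∈ Ioo (-ε) ε,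
        α z t ∈ W ∧ HasDerivAt (α z) (f (α z t)) t ∧
        HasDerivAt (Y z) (fderiv ℝ f (α z t) ∘L Y z t) t ∧
        HasFDerivAt (fun z => α z t) (Y z t) z := by
  have hf1 : ContDiffAt ℝ 1 (fderiv ℝ f) z₀ :=
    ContDiffAt.fderiv_right (m := 1) hf (by rw [one_add_one_eq_two]; exact two_le_infty)
  obtain ⟨K₁, s₁, hs₁, hL⟩ := hf1.exists_lipschitzOnWith
  have hb : ∀ᶠ z in 𝓝 z₀, ‖fderiv ℝ f z‖ < ‖fderiv ℝ f z₀‖ + 1 :=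
    hf1.continuousAt.norm.eventually_lt continuousAt_const (by linarith)
  have hd : ∀ᶠ z in 𝓝 z₀, DifferentiableAt ℝ f z := by
    have h1 : ContDiffAt ℝ 1 f z₀ := hf.of_le (by simp)
    filter_upwards [h1.eventually (by simp)] with z hz using hz.differentiableAt (by simp)
  obtain ⟨ρ, hρ, hball⟩ := Metric.mem_nhds_iff.1 (inter_mem (inter_mem hs₁ hW) (hb.and hd))
  set s := Metric.ball z₀ ρ with hs
  -- One constant serves both as a bound and as a Lipschitz constant for the derivative; the second
  -- entry makes it positive.
  set K : ℝ := max K₁ (‖fderiv ℝ f z₀‖ + 1) with hK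
  have hK0 : 0 < K := lt_of_lt_of_le (by positivity) (le_max_right _ _)
  -- The equation is solved together with its linearization. A single use of Picard–Lindelöf from
  -- `(z, id)` gives the flow and the candidate for its derivative on a common time interval.
  let F : G × (G →L[ℝ] G) → G × (G →L[ℝ] G) := fun p => (f p.1, fderiv ℝ f p.1 ∘L p.2)
  have hF : ContDiffAt ℝ 1 F (z₀, ContinuousLinearMap.id ℝ G) := by
    have h1 : ContDiffAt ℝ 1 f z₀ := hf.of_le (by simp)
    exact (h1.comp (z₀, ContinuousLinearMap.id ℝ G) contDiffAt_fst).prodMk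
      ((hf1.comp (z₀, ContinuousLinearMap.id ℝ G) contDiffAt_fst).clm_comp contDiffAt_snd)
  obtain ⟨ε, hε, a, r, _, _, hr, hpl⟩ := IsPicardLindelof.of_contDiffAt_one hF
  obtain ⟨φ, hφ, hφc⟩ := (hpl 0).exists_forall_mem_closedBall_eq_hasDerivWithinAt_continuousOn
  have hcont : ContinuousAt φ ((z₀, ContinuousLinearMap.id ℝ G), 0) := by
    refine hφc.continuousAt (prod_mem_nhds (Metric.closedBall_mem_nhds _ hr) ?_)
    exact Icc_mem_nhds (by simpa using hε) (by simpa using hε)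
  have hφ0 : φ ((z₀, ContinuousLinearMap.id ℝ G), 0) = (z₀, ContinuousLinearMap.id ℝ G) :=
    (hφ _ (Metric.mem_closedBall_self hr.le)).1
  have hev : ∀ᶠ p in 𝓝 ((z₀, ContinuousLinearMap.id ℝ G), (0 : ℝ)), (φ p).1 ∈ s := by
    have h1 : ContinuousAt (fun p => (φ p).1) ((z₀, ContinuousLinearMap.id ℝ G), (0 : ℝ)) :=
      continuousAt_fst.comp hcont
    refine h1.eventually_mem ?_
    rw [hφ0]
    exact Metric.ball_mem_nhds _ hρ
  rw [nhds_prod_eq, nhds_prod_eq] at hev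
  obtain ⟨pa, hpa, pb, hpb, hab⟩ := eventually_prod_iff.1 hev
  obtain ⟨pc, hpc, pd, hpd, hcd⟩ := eventually_prod_iff.1 hpa
  obtain ⟨δ, hδ, hδb⟩ := Metric.eventually_nhds_iff.1 hpb
  obtain ⟨U, hUc, hUo, hzU⟩ := eventually_nhds_iff.1
    (hpc.and (Metric.ball_mem_nhds z₀ hr))
  have hcl : ∀ z ∈ U, (z, ContinuousLinearMap.id ℝ G) ∈
      Metric.closedBall (z₀, ContinuousLinearMap.id ℝ G) r := fun z hz => by
    have := (hUc z hz).2
    rw [Metric.mem_closedBall, Prod.dist_eq, dist_self]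
    exact max_le this.le r.2
  have hder : ∀ z ∈ U, ∀ t ∈ Ioo (-(min δ ε)) (min δ ε),
      HasDerivAt (fun t => φ ((z, ContinuousLinearMap.id ℝ G), t))
        (F (φ ((z, ContinuousLinearMap.id ℝ G), t))) t := fun z hz t ht => by
    have h1 : t < ε := ht.2.trans_le (min_le_right _ _)
    have h2 : -ε < t := (neg_le_neg (min_le_right _ _)).trans_lt ht.1
    refine ((hφ _ (hcl z hz)).2 t ⟨?_, ?_⟩).hasDerivAt (Icc_mem_nhds ?_ ?_) <;> simp <;> linarith
  have hmem : ∀ z ∈ U, ∀ t ∈ Ioo (-(min δ ε)) (min δ ε),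
      (φ ((z, ContinuousLinearMap.id ℝ G), t)).1 ∈ s := fun z hz t ht => by
    refine hab (hcd (hUc z hz).1 hpd.self_of_nhds) (hδb ?_)
    rw [Real.dist_0_eq_abs, abs_lt]
    exact ⟨(neg_le_neg (min_le_left _ _)).trans_lt ht.1, ht.2.trans_le (min_le_left _ _)⟩
  refine ⟨min δ ε, lt_min hδ hε, U, hUo, hzU,
    fun z t => (φ ((z, ContinuousLinearMap.id ℝ G), t)).1,
    fun z t => (φ ((z, ContinuousLinearMap.id ℝ G), t)).2, fun z hz => ⟨?_, ?_, fun t ht => ?_⟩⟩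
  · exact congrArg Prod.fst (hφ _ (hcl z hz)).1
  · exact congrArg Prod.snd (hφ _ (hcl z hz)).1
  have hsnd : ∀ z ∈ U, ∀ t ∈ Ioo (-(min δ ε)) (min δ ε),
      HasDerivAt (fun t => (φ ((z, ContinuousLinearMap.id ℝ G), t)).2)
        (fderiv ℝ f (φ ((z, ContinuousLinearMap.id ℝ G), t)).1 ∘L
          (φ ((z, ContinuousLinearMap.id ℝ G), t)).2) t := fun z hz t ht => (hder z hz t ht).snd
  refine ⟨(hball (hmem z hz t ht)).1.2, (hder z hz t ht).fst, hsnd z hz t ht, ?_⟩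
  rw [hasFDerivAt_iff_isLittleO]
  -- The error of the linear approximation is bounded by a multiple of `‖z' - z‖²`.
  refine Asymptotics.IsBigO.trans_isLittleO ?_ (Asymptotics.isLittleO_pow_sub_sub z one_lt_two)
  refine Asymptotics.IsBigO.of_bound (Real.exp (K * |t|) ^ 3) ?_
  filter_upwards [hUo.mem_nhds hz] with z' hz'
  have h0 : ∀ z ∈ U, φ ((z, ContinuousLinearMap.id ℝ G), 0) = (z, ContinuousLinearMap.id ℝ G) :=
    fun z hz => (hφ _ (hcl z hz)).1
  have := norm_flow_sub_sub_le_abs (f := f) (f' := fderiv ℝ f) (K := K) hK0 (s := s)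
    (convex_ball _ _) (fun z hz => (hball hz).2.2.hasFDerivAt)
    (fun z hz => (hball hz).2.1.le.trans (le_max_right _ _))
    (fun z hz z' hz' => by
      refine (hL.norm_sub_le (hball hz).1.1 (hball hz').1.1).trans ?_
      gcongr
      exact le_max_left _ _) ht
    (u := fun t => (φ ((z, ContinuousLinearMap.id ℝ G), t)).1)
    (v := fun t => (φ ((z', ContinuousLinearMap.id ℝ G), t)).1)
    (Y := fun t => (φ ((z, ContinuousLinearMap.id ℝ G), t)).2 (z' - z))
    (fun t ht => (hder z hz t ht).fst) (hmem z hz)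
    (fun t ht => (hder z' hz' t ht).fst) (hmem z' hz')
    (fun t ht => by
      simpa using (hsnd z hz t ht).clm_apply (hasDerivAt_const t (z' - z)))
    (by simp [h0 z hz, h0 z' hz'])
  rw [h0 z hz, h0 z' hz'] at this
  simpa using this

end ODE

/-! ### The flow of a vector field on the slit tangent bundle -/

section Flow

variable {E : Type*} [NormedAddCommGroup E] [NormedSpace ℝ E]
  {M : Type*} [TopologicalSpace M] [ChartedSpace E M] [IsManifold 𝓘(ℝ, E) ∞ M]

/-- Vectors over one point are separated in a trivialization, vectors over distinct points by
neighbourhoods in the base. This is needed for the uniqueness of trajectories in `TM`. -/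
instance t2Space_tangentBundle [T2Space M] : T2Space (TM E M) := by
  refine ⟨fun p q hpq => ?_⟩
  by_cases h : p.1 = q.1
  · let e := trivializationAt E (TangentSpace 𝓘(ℝ, E) : M → Type _) p.1
    have hp : p ∈ e.source := by simp [e]
    have hq : q ∈ e.source := by simp [e, ← h]
    have hne : e p ≠ e q := fun h' => hpq (e.injOn hp hq h')
    obtain ⟨u, v, hu, hv, hpu, hqv, huv⟩ := t2_separation hne
    refine ⟨e.source ∩ e ⁻¹' u, e.source ∩ e ⁻¹' v, e.continuousOn.isOpen_inter_preimage
      e.open_source hu, e.continuousOn.isOpen_inter_preimage e.open_source hv, ⟨hp, hpu⟩,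
      ⟨hq, hqv⟩, ?_⟩
    exact (huv.preimage e).mono inter_subset_right inter_subset_right
  · obtain ⟨u, v, hu, hv, hpu, hqv, huv⟩ := t2_separation h
    have hc : Continuous (fun p : TM E M => p.1) :=
      FiberBundle.continuous_proj E (TangentSpace 𝓘(ℝ, E) : M → Type _)
    exact ⟨_, _, hu.preimage hc, hv.preimage hc, hpu, hqv, huv.preimage _⟩

theorem coord_snd_ne_zero_iff {x : M} {q : TM E M}
    (hq : q.1 ∈ (extChartAt 𝓘(ℝ, E) x).source) :
    (trivializationAt E (TangentSpace 𝓘(ℝ, E) : M → Type _) x q).2 ≠ 0 ↔ q ∈ slit E M := by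
  have h : (trivializationAt E (TangentSpace 𝓘(ℝ, E) : M → Type _) x q).2 =
      coordVec 𝓘(ℝ, E) x q.1 q.2 := trivializationAt_snd_eq_coordVec hq q.2
  rw [h]
  exact not_congr ((coordVec_injective hq).eq_iff' (map_zero _))

theorem isOpen_slit : IsOpen (slit E M) := by
  rw [isOpen_iff_mem_nhds]
  intro p hp
  let e := trivializationAt E (TangentSpace 𝓘(ℝ, E) : M → Type _) p.1
  have hs : ∀ q : TM E M, q ∈ e.source → q.1 ∈ (extChartAt 𝓘(ℝ, E) p.1).source := fun q hq => by
    rw [extChartAt_source]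
    exact e.mem_source.1 hq
  have hpe : p ∈ e.source := by simp [e]
  have h1 : ContinuousAt (fun q => (e q).2) p :=
    continuousAt_snd.comp (e.continuousOn.continuousAt (e.open_source.mem_nhds hpe))
  have h2 := h1.eventually_ne ((coord_snd_ne_zero_iff (hs p hpe)).2 hp)
  filter_upwards [h2, e.open_source.mem_nhds hpe] with q hq hqe
  exact (coord_snd_ne_zero_iff (hs q hqe)).1 hq

variable {S : ∀ p : TM E M, TT p}

theorem contMDiffAt_of_smoothOn {X : ∀ p : TM E M, TT p} {U : Set (TM E M)} (hX : SmoothOn X U)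
    (hU : IsOpen U) {p : TM E M} (hp : p ∈ U) :
    ContMDiffAt (𝓘(ℝ, E).tangent) ((𝓘(ℝ, E).tangent).tangent) ∞
      (fun p => (⟨p, X p⟩ : TangentBundle (𝓘(ℝ, E).tangent) (TM E M))) p :=
  (hX p hp).contMDiffAt (hU.mem_nhds hp)

/-- Trajectories of a smooth vector field on the slit tangent bundle are unique. -/
theorem eqOn_of_isMIntegralCurveOn [T2Space M] [CompleteSpace E] (hS : SmoothOn S (slit E M))
    {c d : ℝ → TM E M} {J : Set ℝ} (hJ : IsOpen J) (hJc : IsPreconnected J)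
    (hc : IsMIntegralCurveOn (I := 𝓘(ℝ, E).tangent) c S J)
    (hd : IsMIntegralCurveOn (I := 𝓘(ℝ, E).tangent) d S J) (hcs : ∀ s ∈ J, c s ∈ slit E M)
    {t₀ : ℝ} (ht₀ : t₀ ∈ J) (h : c t₀ = d t₀) : EqOn c d J := by
  -- The times of agreement form an open set by local uniqueness, and a relatively closed one
  -- because `TM` is Hausdorff.
  have key : J ⊆ {t | c t = d t} ∩ J := by
    refine hJc.subset_of_closure_inter_subset (u := {t | c t = d t} ∩ J) ?_
      ⟨t₀, ht₀, h, ht₀⟩ ?_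
    · rw [isOpen_iff_mem_nhds]
      intro t ht
      have hm := hJ.mem_nhds ht.2
      have := isMIntegralCurveAt_eventuallyEq_of_contMDiffAt_boundaryless
        ((contMDiffAt_of_smoothOn hS isOpen_slit (hcs t ht.2)).of_le (by simp))
        (hc.isMIntegralCurveAt hm) (hd.isMIntegralCurveAt hm) ht.1
      exact this.and hm
    · rintro t ⟨htc, htJ⟩
      refine ⟨?_, htJ⟩
      have hm := hJ.mem_nhds htJ
      have h1 : ContinuousAt c t := (hc.continuousOn t htJ).continuousAt hm
      have h2 : ContinuousAt d t := (hd.continuousOn t htJ).continuousAt hm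
      by_contra hne
      have hev : ∀ᶠ s in 𝓝 t, c s ≠ d s :=
        (h1.prodMk h2).eventually_mem (isClosed_diagonal.isOpen_compl.mem_nhds hne)
      obtain ⟨s, hs, hs'⟩ := mem_closure_iff_nhds.1 htc _ hev
      exact hs hs'.1
  exact fun t ht => (key ht).1

/-- The flow is defined by choosing a trajectory. Two trajectories agree on the intersection of
their intervals, which is an interval containing both `0` and `t`. -/
theorem flow_eq [T2Space M] [CompleteSpace E] (hS : SmoothOn S (slit E M)) {p : TM E M} {t : ℝ}
    {c : ℝ → TM E M} (hc : IsTrajectory S p t c) : flow S t p = c t := by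
  have h : ∃ c, IsTrajectory S p t c := ⟨c, hc⟩
  rw [flow, dif_pos h]
  obtain ⟨hc0, a, b, h0, ht, hs, hi⟩ := hc
  obtain ⟨hd0, a', b', h0', ht', hs', hi'⟩ := h.choose_spec
  have hsub : Ioo a b ∩ Ioo a' b' = Ioo (max a a') (min b b') := Ioo_inter_Ioo
  refine eqOn_of_isMIntegralCurveOn hS (J := Ioo a b ∩ Ioo a' b') (isOpen_Ioo.inter isOpen_Ioo)
    (by rw [hsub]; exact isPreconnected_Ioo) (hi'.mono inter_subset_right)
    (hi.mono inter_subset_left) (fun s hs => hs' s hs.2) ⟨h0, h0'⟩ (hd0.trans hc0.symm) ⟨ht, ht'⟩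

theorem isMIntegralCurveOn_iff_of_isOpen {c : ℝ → TM E M} {J : Set ℝ} (hJ : IsOpen J) :
    IsMIntegralCurveOn (I := 𝓘(ℝ, E).tangent) c S J ↔ ∀ t ∈ J,
      HasMFDerivAt 𝓘(ℝ, ℝ) 𝓘(ℝ, E).tangent c t ((1 : ℝ →L[ℝ] ℝ).smulRight (S (c t))) :=
  ⟨fun h t ht => (h t ht).hasMFDerivAt (hJ.mem_nhds ht),
    fun h t ht => (h t ht).hasMFDerivWithinAt⟩

/-- Trajectories can be concatenated. -/
theorem IsTrajectory.concat [T2Space M] [CompleteSpace E] (hS : SmoothOn S (slit E M))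
    {p : TM E M} {s t : ℝ} {c d : ℝ → TM E M} (hc : IsTrajectory S p s c)
    (hd : IsTrajectory S (c s) t d) :
    ∃ e, IsTrajectory S p (s + t) e ∧ e (s + t) = d t := by
  obtain ⟨hc0, a, b, h0, hs, hcs, hi⟩ := hc
  obtain ⟨hd0, a', b', h0', ht', hds, hi'⟩ := hd
  have hi2 : IsMIntegralCurveOn (I := 𝓘(ℝ, E).tangent) (fun r => d (r - s)) S
      (Ioo (a' + s) (b' + s)) := by
    have := hi'.comp_add (-s)
    refine this.mono fun r hr => ?_
    exact ⟨by linarith [hr.1], by linarith [hr.2]⟩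
  have heq : EqOn c (fun r => d (r - s)) (Ioo a b ∩ Ioo (a' + s) (b' + s)) := by
    refine eqOn_of_isMIntegralCurveOn hS (isOpen_Ioo.inter isOpen_Ioo)
      (by rw [Ioo_inter_Ioo]; exact isPreconnected_Ioo) (hi.mono inter_subset_left)
      (hi2.mono inter_subset_right) (fun r hr => hcs r hr.1) (t₀ := s)
      ⟨hs, by linarith [h0'.1], by linarith [h0'.2]⟩ ?_
    simp [hd0]
  classical
  let e : ℝ → TM E M := fun r => if r ∈ Ioo a b then c r else d (r - s)
  have he1 : EqOn e c (Ioo a b) := fun r hr => if_pos hr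
  have he2 : EqOn e (fun r => d (r - s)) (Ioo (a' + s) (b' + s)) := fun r hr => by
    by_cases h : r ∈ Ioo a b
    · exact (he1 h).trans (heq ⟨h, hr⟩)
    · exact if_neg h
  have hder : ∀ r ∈ Ioo a b ∪ Ioo (a' + s) (b' + s), e r ∈ slit E M ∧
      HasMFDerivAt 𝓘(ℝ, ℝ) 𝓘(ℝ, E).tangent e r ((1 : ℝ →L[ℝ] ℝ).smulRight (S (e r))) := by
    rintro r (hr | hr)
    · have hev := he1.eventuallyEq_of_mem (isOpen_Ioo.mem_nhds hr)
      have := (isMIntegralCurveOn_iff_of_isOpen isOpen_Ioo).1 hi r hr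
      rw [he1 hr]
      exact ⟨hcs r hr, this.congr_of_eventuallyEq hev⟩
    · have hev := he2.eventuallyEq_of_mem (isOpen_Ioo.mem_nhds hr)
      have := (isMIntegralCurveOn_iff_of_isOpen isOpen_Ioo).1 hi2 r hr
      rw [he2 hr]
      exact ⟨hds _ ⟨by linarith [hr.1], by linarith [hr.2]⟩, this.congr_of_eventuallyEq hev⟩
  -- Both intervals contain `s`, so there is no gap between them.
  have hsub : Ioo (min a (a' + s)) (max b (b' + s)) ⊆ Ioo a b ∪ Ioo (a' + s) (b' + s) := by
    rintro r ⟨hr1, hr2⟩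
    rcases min_lt_iff.1 hr1 with h1 | h1 <;> rcases lt_max_iff.1 hr2 with h2 | h2
    · exact Or.inl ⟨h1, h2⟩
    · rcases lt_or_ge r b with h | h
      · exact Or.inl ⟨h1, h⟩
      · exact Or.inr ⟨by linarith [hs.2, h0'.1], h2⟩
    · rcases lt_or_ge a r with h | h
      · exact Or.inl ⟨h, h2⟩
      · exact Or.inr ⟨h1, by linarith [hs.1, h0'.2]⟩
    · exact Or.inr ⟨h1, h2⟩
  refine ⟨e, ⟨(he1 h0).trans hc0, min a (a' + s), max b (b' + s), ?_, ?_, fun r hr =>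
    (hder r (hsub hr)).1, ?_⟩, ?_⟩
  · exact ⟨min_lt_iff.2 (Or.inl h0.1), lt_max_iff.2 (Or.inl h0.2)⟩
  · exact ⟨min_lt_iff.2 (Or.inr (by linarith [ht'.1])),
      lt_max_iff.2 (Or.inr (by linarith [ht'.2]))⟩
  · exact (isMIntegralCurveOn_iff_of_isOpen isOpen_Ioo).2 fun r hr => (hder r (hsub hr)).2
  · have : s + t ∈ Ioo (a' + s) (b' + s) := ⟨by linarith [ht'.1], by linarith [ht'.2]⟩
    rw [he2 this]
    simp

/-- The reversed trajectory. -/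
theorem IsTrajectory.reverse {p : TM E M} {s : ℝ} {c : ℝ → TM E M} (hc : IsTrajectory S p s c) :
    IsTrajectory S (c s) (-s) (fun r => c (r + s)) := by
  obtain ⟨hc0, a, b, h0, hs, hcs, hi⟩ := hc
  refine ⟨by simp, a - s, b - s, ⟨by linarith [hs.1], by linarith [hs.2]⟩,
    ⟨by linarith [h0.1], by linarith [h0.2]⟩, fun r hr =>
    hcs _ ⟨by linarith [hr.1], by linarith [hr.2]⟩, ?_⟩
  refine (hi.comp_add s).mono fun r hr => ?_
  exact ⟨by linarith [hr.1], by linarith [hr.2]⟩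

/-- The local flow of a smooth vector field on the slit tangent bundle, and its differential in
coordinates. -/
theorem exists_flow_chart [T2Space M] [CompleteSpace E] (hS : SmoothOn S (slit E M))
    {p : TM E M} (hp : p ∈ slit E M) :
    ∃ ε > 0, ∃ U : Set (TM E M), IsOpen U ∧ p ∈ U ∧ U ⊆ slit E M ∧
      U ⊆ (extChartAt 𝓘(ℝ, E).tangent p).source ∧ ∃ Y : TM E M → ℝ → (E × E) →L[ℝ] (E × E),
      ∀ q ∈ U, Y q 0 = ContinuousLinearMap.id ℝ _ ∧ ∀ t ∈ Ioo (-ε) ε,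
        (∃ c, IsTrajectory S q t c) ∧
        flow S t q ∈ (extChartAt 𝓘(ℝ, E).tangent p).source ∧
        HasDerivAt (Y q) (fderiv ℝ (coordField 𝓘(ℝ, E).tangent p S)
          (extChartAt 𝓘(ℝ, E).tangent p (flow S t q)) ∘L Y q t) t ∧
        MDifferentiableAt 𝓘(ℝ, E).tangent 𝓘(ℝ, E).tangent (flow S t) q ∧
        ∀ ξ : TT q, coordVec 𝓘(ℝ, E).tangent p (flow S t q) (dflow S t q ξ) =
          Y q t (coordVec 𝓘(ℝ, E).tangent p q ξ) := by
  set φ := extChartAt 𝓘(ℝ, E).tangent p with hφ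
  have hps := mem_extChartAt_source (I := 𝓘(ℝ, E).tangent) p
  have hpt := mem_extChartAt_target (I := 𝓘(ℝ, E).tangent) p
  have hf := (contMDiffAt_field_iff hps S).1 (contMDiffAt_of_smoothOn hS isOpen_slit hp)
  -- Solutions confined to this neighbourhood stay in the chart and off the zero section, so they
  -- lift to trajectories in `TM ∖ 0`.
  have hW : φ.target ∩ φ.symm ⁻¹' slit E M ∈ 𝓝 (φ p) := by
    have hsymm : ContinuousAt φ.symm (φ p) := continuousAt_extChartAt_symm p
    refine inter_mem ((isOpen_extChartAt_target p).mem_nhds hpt)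
      (hsymm.preimage_mem_nhds (isOpen_slit.mem_nhds ?_))
    rwa [φ.left_inv hps]
  obtain ⟨ε, hε, U, hUo, hpU, α, Y, h⟩ := exists_local_flow hf hW
  have hVo : IsOpen (φ.source ∩ φ ⁻¹' U) :=
    (continuousOn_extChartAt p).isOpen_inter_preimage (isOpen_extChartAt_source p) hUo
  have h0 : (0 : ℝ) ∈ Ioo (-ε) ε := ⟨by linarith, hε⟩
  have htraj : ∀ q ∈ φ.source ∩ φ ⁻¹' U, ∀ t ∈ Ioo (-ε) ε,
      IsTrajectory S q t (fun s => φ.symm (α (φ q) s)) := by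
    intro q hq t ht
    obtain ⟨ha0, hY0, hα⟩ := h _ hq.2
    refine ⟨?_, -ε, ε, h0, ht, fun s hs => (hα s hs).1.2, ?_⟩
    · change φ.symm (α (φ q) 0) = q
      rw [ha0, φ.left_inv hq.1]
    · refine (isMIntegralCurveOn_iff_of_isOpen isOpen_Ioo).2 fun s hs => ?_
      refine (hasMFDerivAt_symm_comp (hα s hs).1.1 (hα s hs).2.1).congr_mfderiv ?_
      congr 1
      exact coordInv_coordVec (φ.map_target (hα s hs).1.1) _
  have hflow : ∀ q ∈ φ.source ∩ φ ⁻¹' U, ∀ t ∈ Ioo (-ε) ε, flow S t q = φ.symm (α (φ q) t) :=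
    fun q hq t ht => flow_eq hS (htraj q hq t ht)
  refine ⟨ε, hε, φ.source ∩ φ ⁻¹' U, hVo, ⟨hps, hpU⟩, ?_, inter_subset_left,
    fun q => Y (φ q), fun q hq => ⟨(h _ hq.2).2.1, fun t ht => ?_⟩⟩
  · intro q hq
    -- A trajectory avoids the zero section at time `0`, where it passes through `q`.
    have := (htraj q hq 0 h0).2.choose_spec.choose_spec.2.2.1 0
      (htraj q hq 0 h0).2.choose_spec.choose_spec.1
    rwa [(htraj q hq 0 h0).1] at this
  obtain ⟨hαW, hα, hY, hαd⟩ := (h _ hq.2).2.2 t ht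
  have hsrc : flow S t q ∈ φ.source := by
    rw [hflow q hq t ht]; exact φ.map_target hαW.1
  have hcoord : φ (flow S t q) = α (φ q) t := by
    rw [hflow q hq t ht, φ.right_inv hαW.1]
  have hd1 : HasMFDerivAt 𝓘(ℝ, E).tangent 𝓘(ℝ, E).tangent (flow S t) q
      ((coordInv 𝓘(ℝ, E).tangent p (φ.symm (α (φ q) t)) ∘L Y (φ q) t) ∘L
        coordVec 𝓘(ℝ, E).tangent p q) := by
    refine HasMFDerivAt.congr_of_eventuallyEq (f := fun q => φ.symm (α (φ q) t)) ?_ ?_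
    · exact HasMFDerivAt.comp q (g := fun z => φ.symm (α z t)) (HasMFDerivAt.comp (φ q) (hasMFDerivAt_coord_symm hαW.1)
        hαd.hasMFDerivAt) (hasMFDerivAt_coord hq.1)
    · filter_upwards [hVo.mem_nhds hq] with q' hq' using hflow q' hq' t ht
  refine ⟨⟨_, htraj q hq t ht⟩, hsrc, ?_, hd1.mdifferentiableAt, fun ξ => ?_⟩
  · rw [hcoord]; exact hY
  · have : dflow S t q ξ = coordInv 𝓘(ℝ, E).tangent p (φ.symm (α (φ q) t))
        (Y (φ q) t (coordVec 𝓘(ℝ, E).tangent p q ξ)) := by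
      rw [dflow, hd1.mfderiv]; rfl
    rw [this, ← hflow q hq t ht]
    exact coordVec_coordInv hsrc _

end Flow

/-! ### Differentiability of the flow along a whole trajectory -/

section FlowAlong

variable {E : Type*} [NormedAddCommGroup E] [NormedSpace ℝ E]
  {M : Type*} [TopologicalSpace M] [ChartedSpace E M] [IsManifold 𝓘(ℝ, E) ∞ M]
  {S : ∀ p : TM E M, TT p}

/-- The flow of `S` at time `t` is defined near `p` and differentiable at `p`. -/
def FlowsAt (S : ∀ p : TM E M, TT p) (p : TM E M) (t : ℝ) : Prop :=
  (∀ᶠ q in 𝓝 p, ∃ c, IsTrajectory S q t c) ∧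
    MDifferentiableAt 𝓘(ℝ, E).tangent 𝓘(ℝ, E).tangent (flow S t) p

theorem FlowsAt.hasMFDerivAt {p : TM E M} {t : ℝ} (h : FlowsAt S p t) :
    HasMFDerivAt 𝓘(ℝ, E).tangent 𝓘(ℝ, E).tangent (flow S t) p (dflow S t p) :=
  h.2.hasMFDerivAt

theorem FlowsAt.flow_add [T2Space M] [CompleteSpace E] (hS : SmoothOn S (slit E M))
    {p : TM E M} {s t : ℝ} (h : FlowsAt S p s) (h' : FlowsAt S (flow S s p) t) :
    ∀ᶠ q in 𝓝 p, (∃ c, IsTrajectory S q (s + t) c) ∧ flow S (s + t) q = flow S t (flow S s q) := by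
  filter_upwards [h.1, h.2.continuousAt.eventually h'.1] with q hq hq'
  obtain ⟨c, hc⟩ := hq
  obtain ⟨d, hd⟩ := hq'
  rw [flow_eq hS hc] at hd
  obtain ⟨e, he, hed⟩ := hc.concat hS hd
  exact ⟨⟨e, he⟩, by rw [flow_eq hS he, hed, flow_eq hS hc, flow_eq hS hd]⟩

theorem FlowsAt.hasMFDerivAt_add [T2Space M] [CompleteSpace E] (hS : SmoothOn S (slit E M))
    {p : TM E M} {s t : ℝ} (h : FlowsAt S p s) (h' : FlowsAt S (flow S s p) t) :
    HasMFDerivAt 𝓘(ℝ, E).tangent 𝓘(ℝ, E).tangent (flow S (s + t)) p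
      (dflow S t (flow S s p) ∘L dflow S s p) :=
  (HasMFDerivAt.comp p h'.hasMFDerivAt h.hasMFDerivAt).congr_of_eventuallyEq
    ((h.flow_add hS h').mono fun _ hq => hq.2)

theorem FlowsAt.add [T2Space M] [CompleteSpace E] (hS : SmoothOn S (slit E M))
    {p : TM E M} {s t : ℝ} (h : FlowsAt S p s) (h' : FlowsAt S (flow S s p) t) :
    FlowsAt S p (s + t) :=
  ⟨(h.flow_add hS h').mono fun _ hq => hq.1, (h.hasMFDerivAt_add hS h').mdifferentiableAt⟩

theorem FlowsAt.dflow_add [T2Space M] [CompleteSpace E] (hS : SmoothOn S (slit E M))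
    {p : TM E M} {s t : ℝ} (h : FlowsAt S p s) (h' : FlowsAt S (flow S s p) t) (ξ : TT p) :
    (dflow S (s + t) p ξ : E × E) = dflow S t (flow S s p) (dflow S s p ξ) := by
  rw [dflow, (h.hasMFDerivAt_add hS h').mfderiv]
  rfl

/-- Reversing trajectories shows that `Φ_{-s} ∘ Φ_s` is the identity near `p`; the chain rule does
the rest. -/
theorem FlowsAt.dflow_neg_dflow [T2Space M] [CompleteSpace E] (hS : SmoothOn S (slit E M))
    {p : TM E M} {s : ℝ} (h : FlowsAt S p s) (h' : FlowsAt S (flow S s p) (-s)) (ξ : TT p) :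
    (dflow S (-s) (flow S s p) (dflow S s p ξ) : E × E) = ξ := by
  have h1 := HasMFDerivAt.comp p h'.hasMFDerivAt h.hasMFDerivAt
  have h2 : HasMFDerivAt 𝓘(ℝ, E).tangent 𝓘(ℝ, E).tangent (flow S (-s) ∘ flow S s) p
      (ContinuousLinearMap.id ℝ (TT p)) := by
    refine (hasMFDerivAt_id p).congr_of_eventuallyEq ?_
    filter_upwards [h.1] with q hq
    obtain ⟨c, hc⟩ := hq
    have := flow_eq hS hc.reverse
    rw [← flow_eq hS hc] at this
    rw [Function.comp_apply, this]
    simpa using hc.1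
  exact congrArg (fun T : (E × E) →L[ℝ] (E × E) => T ξ) (hasMFDerivAt_unique h1 h2)

theorem exists_Ioo_subset_of_ordConnected {J : Set ℝ} (hJ : IsOpen J) (hJc : J.OrdConnected)
    {s t : ℝ} (hs : s ∈ J) (ht : t ∈ J) :
    ∃ a b, s ∈ Ioo a b ∧ t ∈ Ioo a b ∧ Ioo a b ⊆ J := by
  wlog hst : s ≤ t generalizing s t
  · obtain ⟨a, b, h1, h2, h3⟩ := this ht hs (le_of_not_ge hst)
    exact ⟨a, b, h2, h1, h3⟩
  obtain ⟨δ, hδ, h1⟩ := Metric.isOpen_iff.1 hJ s hs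
  obtain ⟨η, hη, h2⟩ := Metric.isOpen_iff.1 hJ t ht
  have ha : s - δ / 2 ∈ J := h1 (by rw [Real.ball_eq_Ioo]; constructor <;> linarith)
  have hb : t + η / 2 ∈ J := h2 (by rw [Real.ball_eq_Ioo]; constructor <;> linarith)
  exact ⟨s - δ / 2, t + η / 2, ⟨by linarith, by linarith⟩, ⟨by linarith, by linarith⟩,
    Ioo_subset_Icc_self.trans (hJc.out ha hb)⟩

variable {c : ℝ → TM E M} {J : Set ℝ}

theorem flow_eq_of_isMIntegralCurveOn [T2Space M] [CompleteSpace E]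
    (hS : SmoothOn S (slit E M)) (hJ : IsOpen J) (hJc : J.OrdConnected) (h0 : 0 ∈ J)
    (hc : IsMIntegralCurveOn (I := 𝓘(ℝ, E).tangent) c S J) (hcs : ∀ s ∈ J, c s ∈ slit E M)
    {t : ℝ} (ht : t ∈ J) : flow S t (c 0) = c t := by
  obtain ⟨a, b, h1, h2, h3⟩ := exists_Ioo_subset_of_ordConnected hJ hJc h0 ht
  exact flow_eq hS ⟨rfl, a, b, h1, h2, fun s hs => hcs s (h3 hs), hc.mono h3⟩

/-- Charts provide the flow for short times only. By the group law the property passes between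
neighbouring times in both directions, and connectedness of `J` carries it from `0` to `t`. -/
theorem flowsAt_of_isMIntegralCurveOn [T2Space M] [CompleteSpace E]
    (hS : SmoothOn S (slit E M)) (hJ : IsOpen J) (hJc : J.OrdConnected) (h0 : 0 ∈ J)
    (hc : IsMIntegralCurveOn (I := 𝓘(ℝ, E).tangent) c S J) (hcs : ∀ s ∈ J, c s ∈ slit E M)
    {t : ℝ} (ht : t ∈ J) : FlowsAt S (c 0) t := by
  have hfl := fun t (ht : t ∈ J) => flow_eq_of_isMIntegralCurveOn hS hJ hJc h0 hc hcs ht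
  have hloc : ∀ x ∈ J, ∀ᶠ y in 𝓝[J] x, (FlowsAt S (c 0) x → FlowsAt S (c 0) y) ∧
      (FlowsAt S (c 0) y → FlowsAt S (c 0) x) := by
    intro x hx
    obtain ⟨ε, hε, U, hU, hxU, -, -, Y, h⟩ := exists_flow_chart hS (hcs x hx)
    have hstep : ∀ r ∈ J, ∀ s ∈ J, c r ∈ U → s - r ∈ Ioo (-ε) ε → FlowsAt S (c 0) r →
        FlowsAt S (c 0) s := by
      intro r hr s hs hrU hsr hF
      have : FlowsAt S (c 0) (r + (s - r)) := by
        refine hF.add hS ?_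
        rw [hfl r hr]
        refine ⟨?_, ((h _ hrU).2 _ hsr).2.2.2.1⟩
        filter_upwards [hU.mem_nhds hrU] with q hq using ((h q hq).2 _ hsr).1
      rwa [add_sub_cancel] at this
    have hcx : ContinuousAt c x := (hc.continuousOn x hx).continuousAt (hJ.mem_nhds hx)
    have hnear : ∀ᶠ y in 𝓝 x, y ∈ J ∧ c y ∈ U ∧ y - x ∈ Ioo (-ε) ε := by
      refine (show ∀ᶠ y in 𝓝 x, y ∈ J from hJ.mem_nhds hx).and ((hcx.eventually_mem (hU.mem_nhds hxU)).and ?_)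
      have : ContinuousAt (fun y => y - x) x := by fun_prop
      exact this.eventually_mem (Ioo_mem_nhds (by simpa using hε) (by simpa using hε))
    refine Filter.Eventually.filter_mono nhdsWithin_le_nhds ?_
    filter_upwards [hnear] with y hy
    exact ⟨hstep x hx y hy.1 hxU hy.2.2, hstep y hy.1 x hx hy.2.1
      ⟨by linarith [hy.2.2.2], by linarith [hy.2.2.1]⟩⟩
  refine hJc.isPreconnected.induction₂'
    (fun x y => FlowsAt S (c 0) x → FlowsAt S (c 0) y) hloc
    (fun x y z _ _ _ h1 h2 h => h2 (h1 h)) h0 ht ?_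
  obtain ⟨ε, hε, U, hU, hxU, -, -, Y, h⟩ := exists_flow_chart hS (hcs 0 h0)
  have h00 : (0 : ℝ) ∈ Ioo (-ε) ε := ⟨by linarith, hε⟩
  refine ⟨?_, ((h _ hxU).2 _ h00).2.2.2.1⟩
  filter_upwards [hU.mem_nhds hxU] with q hq using ((h q hq).2 _ h00).1

/-- The shifted curve `s ↦ c (s + t)` is a trajectory from `c t` that reaches `c 0` at time `-t`, so
the previous result applies to it. -/
theorem flowsAt_neg_of_isMIntegralCurveOn [T2Space M] [CompleteSpace E]
    (hS : SmoothOn S (slit E M)) (hJ : IsOpen J) (hJc : J.OrdConnected) (h0 : 0 ∈ J)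
    (hc : IsMIntegralCurveOn (I := 𝓘(ℝ, E).tangent) c S J) (hcs : ∀ s ∈ J, c s ∈ slit E M)
    {t : ℝ} (ht : t ∈ J) : FlowsAt S (flow S t (c 0)) (-t) := by
  rw [flow_eq_of_isMIntegralCurveOn hS hJ hJc h0 hc hcs ht]
  have hJ' : IsOpen {s | s + t ∈ J} := hJ.preimage (continuous_add_const t)
  have hJc' : {s | s + t ∈ J}.OrdConnected :=
    ⟨fun x hx y hy z hz => hJc.out hx hy ⟨add_le_add_left hz.1 t, add_le_add_left hz.2 t⟩⟩
  have := flowsAt_of_isMIntegralCurveOn (c := fun s => c (s + t)) hS hJ' hJc' (t := -t)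
    (by simpa using ht) (hc.comp_add t) (fun s hs => hcs _ hs) (by simpa using h0)
  simpa using this

/-- The differential of the flow along a trajectory, in coordinates around the point of the
trajectory at time `t₀`, solves the linearized equation. -/
theorem exists_linearized_flow [T2Space M] [FiniteDimensional ℝ E]
    (hS : SmoothOn S (slit E M)) (hJ : IsOpen J) (hJc : J.OrdConnected) (h0 : 0 ∈ J)
    (hc : IsMIntegralCurveOn (I := 𝓘(ℝ, E).tangent) c S J) (hcs : ∀ s ∈ J, c s ∈ slit E M)
    {t₀ : ℝ} (ht₀ : t₀ ∈ J) :
    ∃ Ψ : ℝ → (E × E) →L[ℝ] (E × E), ∀ᶠ s in 𝓝 t₀,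
      s ∈ J ∧ flow S s (c 0) ∈ (extChartAt 𝓘(ℝ, E).tangent (flow S t₀ (c 0))).source ∧
      (∀ ξ : E × E, coordVec 𝓘(ℝ, E).tangent (flow S t₀ (c 0)) (flow S s (c 0))
        (dflow S s (c 0) ξ) = Ψ s ξ) ∧
      HasDerivAt Ψ (fderiv ℝ (coordField 𝓘(ℝ, E).tangent (flow S t₀ (c 0)) S)
        (extChartAt 𝓘(ℝ, E).tangent (flow S t₀ (c 0)) (flow S s (c 0))) ∘L Ψ s) s ∧
      (∀ ξ η : E × E, Ψ s ξ = η ↔ ξ = dflow S (-s) (flow S s (c 0))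
        (coordInv 𝓘(ℝ, E).tangent (flow S t₀ (c 0)) (flow S s (c 0)) η)) := by
  have : CompleteSpace E := FiniteDimensional.complete ℝ E
  have hfl := fun t (ht : t ∈ J) => flow_eq_of_isMIntegralCurveOn hS hJ hJc h0 hc hcs ht
  have hF := fun t (ht : t ∈ J) => flowsAt_of_isMIntegralCurveOn hS hJ hJc h0 hc hcs ht
  have hF' := fun t (ht : t ∈ J) => flowsAt_neg_of_isMIntegralCurveOn hS hJ hJc h0 hc hcs ht
  obtain ⟨ε, hε, U, hU, hxU, -, -, Y, h⟩ := exists_flow_chart (p := flow S t₀ (c 0)) hS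
    (by rw [hfl t₀ ht₀]; exact hcs t₀ ht₀)
  have hU' := h
  obtain ⟨hY0, h⟩ := h _ hxU
  set p := flow S t₀ (c 0) with hp
  let D : (E × E) →L[ℝ] (E × E) := dflow S t₀ (c 0)
  -- By the group law `dΦ_s = dΦ_{s-t₀} ∘ dΦ_{t₀}`. The second factor needs no coordinate change, as
  -- the chart is centred at `Φ_{t₀}(c 0)`.
  refine ⟨fun s => Y p (s - t₀) ∘L D, ?_⟩
  have hcont : ContinuousAt (fun y => y - t₀) t₀ := by fun_prop
  filter_upwards [hcont.eventually_mem (Ioo_mem_nhds (a := -ε) (b := ε) (by simpa using hε)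
    (by simpa using hε)), hJ.mem_nhds ht₀] with s hs hsJ
  obtain ⟨⟨d, hd⟩, hsrc, hY, hMD, hcoord⟩ := h _ hs
  have hFr : FlowsAt S p (s - t₀) := by
    refine ⟨?_, hMD⟩
    filter_upwards [hU.mem_nhds hxU] with q hq using ((hU' q hq).2 _ hs).1
  have hadd := (hF t₀ ht₀).dflow_add hS hFr
  have hflow : flow S s (c 0) = flow S (s - t₀) p := by
    have := ((hF t₀ ht₀).flow_add hS hFr).self_of_nhds.2
    rwa [add_sub_cancel] at this
  have hΨ : ∀ ξ : E × E, coordVec 𝓘(ℝ, E).tangent p (flow S s (c 0))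
        (dflow S s (c 0) ξ) = Y p (s - t₀) (dflow S t₀ (c 0) ξ) := by
    intro ξ
    have e1 : (dflow S s (c 0) ξ : E × E) = dflow S (s - t₀) p (dflow S t₀ (c 0) ξ) := by
      rw [← hadd ξ, add_sub_cancel]
    have e2 := hcoord (dflow S t₀ (c 0) ξ)
    rw [coordVec_self] at e2
    rw [← e1, ← hflow] at e2
    exact e2
  refine ⟨hsJ, by rwa [hflow], hΨ, ?_, ?_⟩
  · rw [hflow]
    have h1 : HasDerivAt (fun s => Y p (s - t₀)) _ s := HasDerivAt.comp_sub_const s t₀ hY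
    have h2 := h1.clm_comp (hasDerivAt_const s D)
    simpa [ContinuousLinearMap.comp_assoc] using h2
  · have hsrc' : flow S s (c 0) ∈ (extChartAt 𝓘(ℝ, E).tangent p).source := by rwa [hflow]
    let L : (E × E) →L[ℝ] (E × E) := (dflow S (-s) (flow S s (c 0))) ∘L
      (coordInv 𝓘(ℝ, E).tangent p (flow S s (c 0)))
    let P : (E × E) →L[ℝ] (E × E) := Y p (s - t₀) ∘L dflow S t₀ (c 0)
    have h1 : ∀ ξ : E × E, L (P ξ) = ξ := fun ξ => by
      change dflow S (-s) (flow S s (c 0)) (coordInv 𝓘(ℝ, E).tangent p (flow S s (c 0))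
        (Y p (s - t₀) (dflow S t₀ (c 0) ξ))) = ξ
      rw [← hΨ ξ, coordInv_coordVec hsrc']
      exact (hF s hsJ).dflow_neg_dflow hS (hF' s hsJ) ξ
    -- In finite dimensions a left inverse is also a right inverse, so the flow from the other end
    -- need not be differentiated again.
    have h2 : ∀ η : E × E, P (L η) = η := by
      have e : (L : (E × E) →ₗ[ℝ] (E × E)) * (P : (E × E) →ₗ[ℝ] (E × E)) = 1 :=
        LinearMap.ext h1
      exact fun η => congrArg (fun T : (E × E) →ₗ[ℝ] (E × E) => T η)
        (mul_eq_one_comm.1 e)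
    intro ξ η
    constructor
    · rintro rfl
      exact (h1 ξ).symm
    · rintro rfl
      exact h2 η

end FlowAlong

/-! ### Fanning curves that come from a second-order linear equation -/

section Transport

/-- A solution of `Ψ' = BΨ` is smooth if `B` is. -/
theorem contDiffAt_of_hasDerivAt_mul {R : Type*} [NormedRing R] [NormedAlgebra ℝ R]
    {Ψ B : ℝ → R} {t : ℝ} (hΨ : ∀ᶠ s in 𝓝 t, HasDerivAt Ψ (B s * Ψ s) s)
    (hB : ContDiffAt ℝ ∞ B t) : ContDiffAt ℝ ∞ Ψ t := by
  rw [contDiffAt_infty]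
  intro n
  -- Bootstrap: if `Ψ` is of class `Cⁿ`, then so is `Ψ' = BΨ`, hence `Ψ` is of class `Cⁿ⁺¹`.
  induction n with
  | zero =>
    rw [Nat.cast_zero, contDiffAt_zero]
    refine ⟨_, hΨ, fun s hs => ?_⟩
    exact (show HasDerivAt Ψ (B s * Ψ s) s from hs).continuousAt.continuousWithinAt
  | succ n ih =>
    refine contDiffAt_succ_iff_hasFDerivAt.2
      ⟨fun s => ContinuousLinearMap.toSpanSingleton ℝ (B s * Ψ s), ⟨_, hΨ, fun s hs => ?_⟩, ?_⟩
    · have : HasDerivAt Ψ (B s * Ψ s) s := hs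
      exact this.hasFDerivAt
    · exact (ContinuousLinearMap.toSpanSingletonCLE (𝕜 := ℝ) (E := R)).contDiff.contDiffAt.comp t
        ((hB.of_le (by exact_mod_cast le_top)).mul ih)

theorem hasDerivAt_inverse_of_hasDerivAt_mul {R : Type*} [NormedRing R] [NormedAlgebra ℝ R]
    [CompleteSpace R] {Ψ : ℝ → R} {B : R} {t : ℝ} (hΨ : HasDerivAt Ψ (B * Ψ t) t)
    (hu : IsUnit (Ψ t)) :
    HasDerivAt (fun s => Ring.inverse (Ψ s)) (-(Ring.inverse (Ψ t) * B)) t := by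
  obtain ⟨u, hu⟩ := hu
  have h := hasFDerivAt_ringInverse (𝕜 := ℝ) u
  rw [hu] at h
  have h1 := h.comp_hasDerivAt t hΨ
  convert! h1 using 1
  rw [neg_apply, ContinuousLinearMap.mulLeftRight_apply, ← hu, Ring.inverse_unit,
    mul_assoc, mul_assoc, u.mul_inv, mul_one]

/-- The derivative of the conjugate of `X` by a solution of `Ψ' = BΨ`. -/
theorem hasDerivAt_conj {R : Type*} [NormedRing R] [NormedAlgebra ℝ R]
    [CompleteSpace R] {Ψ X : ℝ → R} {B X' : R} {t : ℝ} (hΨ : HasDerivAt Ψ (B * Ψ t) t)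
    (hu : IsUnit (Ψ t)) (hX : HasDerivAt X X' t) :
    HasDerivAt (fun s => Ring.inverse (Ψ s) * X s * Ψ s)
      (Ring.inverse (Ψ t) * (X' + X t * B - B * X t) * Ψ t) t := by
  have h : HasDerivAt (fun s => Ring.inverse (Ψ s) * X s)
      (-(Ring.inverse (Ψ t) * B) * X t + Ring.inverse (Ψ t) * X') t :=
    (hasDerivAt_inverse_of_hasDerivAt_mul hΨ hu).mul hX
  have h' : HasDerivAt (fun s => Ring.inverse (Ψ s) * X s * Ψ s)
      ((-(Ring.inverse (Ψ t) * B) * X t + Ring.inverse (Ψ t) * X') * Ψ t +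
        Ring.inverse (Ψ t) * X t * (B * Ψ t)) t := h.mul hΨ
  convert! h' using 1
  noncomm_ring

variable {E : Type*} [NormedAddCommGroup E] [NormedSpace ℝ E]

/-- The operator `(x, y) ↦ (y, P x + Q y)`. -/
noncomputable def secondOrder (P Q : E →L[ℝ] E) : (E × E) →L[ℝ] (E × E) :=
  (ContinuousLinearMap.snd ℝ E E).prod
    (P ∘L ContinuousLinearMap.fst ℝ E E + Q ∘L ContinuousLinearMap.snd ℝ E E)

@[simp] theorem secondOrder_apply (P Q : E →L[ℝ] E) (a : E × E) :
    secondOrder P Q a = (a.2, P a.1 + Q a.2) := rfl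

/-- The operator `(x, y) ↦ (0, -x)`. -/
noncomputable def nilShift (E : Type*) [NormedAddCommGroup E] [NormedSpace ℝ E] :
    (E × E) →L[ℝ] (E × E) :=
  -(ContinuousLinearMap.inr ℝ E E ∘L ContinuousLinearMap.fst ℝ E E)

@[simp] theorem nilShift_apply (a : E × E) : nilShift E a = (0, -a.1) := by
  simp [nilShift]

/-- The operator `(x, y) ↦ (x, Q x - y)`. -/
noncomputable def reflection (Q : E →L[ℝ] E) : (E × E) →L[ℝ] (E × E) :=
  (ContinuousLinearMap.fst ℝ E E).prod
    (Q ∘L ContinuousLinearMap.fst ℝ E E - ContinuousLinearMap.snd ℝ E E)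

@[simp] theorem reflection_apply (Q : E →L[ℝ] E) (a : E × E) :
    reflection Q a = (a.1, Q a.1 - a.2) := rfl

theorem hasDerivAt_reflection {Q : ℝ → E →L[ℝ] E} {t : ℝ} {Q' : E →L[ℝ] E} (hQ : HasDerivAt Q Q' t) :
    HasDerivAt (fun s => reflection (Q s))
      (ContinuousLinearMap.inr ℝ E E ∘L Q' ∘L ContinuousLinearMap.fst ℝ E E) t := by
  have h2 : (fun s => reflection (Q s)) = fun s => reflection (0 : E →L[ℝ] E) +
      ContinuousLinearMap.inr ℝ E E ∘L (Q s ∘L ContinuousLinearMap.fst ℝ E E) := by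
    ext s a <;> simp [sub_eq_neg_add]
  rw [h2]
  have h3 := (hasDerivAt_const t (ContinuousLinearMap.inr ℝ E E)).clm_comp
    (hQ.clm_comp (hasDerivAt_const t (ContinuousLinearMap.fst ℝ E E)))
  simpa using h3.const_add (reflection (0 : E →L[ℝ] E))

/-- Near time `t`, the invertible operators `Ψ s` solve the linear equation with coefficients
`P`, `Q`, and carry `ℓ s` to `0 × E`. -/
def IsTransportAt (ℓ : ℝ → Submodule ℝ (E × E)) (Ψ : ℝ → (E × E) →L[ℝ] (E × E))
    (P Q : ℝ → E →L[ℝ] E) (t : ℝ) : Prop :=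
  ∀ᶠ s in 𝓝 t, HasDerivAt Ψ (secondOrder (P s) (Q s) * Ψ s) s ∧ IsUnit (Ψ s) ∧
    ContDiffAt ℝ ∞ P s ∧ ContDiffAt ℝ ∞ Q s ∧ ∀ a, a ∈ ℓ s ↔ (Ψ s a).1 = 0

namespace IsTransportAt

variable {ℓ : ℝ → Submodule ℝ (E × E)} {Ψ : ℝ → (E × E) →L[ℝ] (E × E)}
    {P Q : ℝ → E →L[ℝ] E} {t : ℝ}

theorem eventually (h : IsTransportAt ℓ Ψ P Q t) : ∀ᶠ s in 𝓝 t, IsTransportAt ℓ Ψ P Q s :=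
  eventually_eventually_nhds.2 h

theorem hasDerivAt (h : IsTransportAt ℓ Ψ P Q t) :
    HasDerivAt Ψ (secondOrder (P t) (Q t) * Ψ t) t := h.self_of_nhds.1

theorem isUnit (h : IsTransportAt ℓ Ψ P Q t) : IsUnit (Ψ t) := h.self_of_nhds.2.1

theorem contDiffAt_coeff (h : IsTransportAt ℓ Ψ P Q t) : ContDiffAt ℝ ∞ Q t :=
  h.self_of_nhds.2.2.2.1

theorem mem_iff (h : IsTransportAt ℓ Ψ P Q t) (a : E × E) : a ∈ ℓ t ↔ (Ψ t a).1 = 0 :=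
  h.self_of_nhds.2.2.2.2 a

theorem apply_inverse (h : IsTransportAt ℓ Ψ P Q t) (a : E × E) :
    Ψ t (Ring.inverse (Ψ t) a) = a := by
  have := Ring.mul_inverse_cancel _ h.isUnit
  exact congrArg (fun T : (E × E) →L[ℝ] (E × E) => T a) this

theorem inverse_apply (h : IsTransportAt ℓ Ψ P Q t) (a : E × E) :
    Ring.inverse (Ψ t) (Ψ t a) = a := by
  have := Ring.inverse_mul_cancel _ h.isUnit
  exact congrArg (fun T : (E × E) →L[ℝ] (E × E) => T a) this

theorem contDiffAt_secondOrder (h : IsTransportAt ℓ Ψ P Q t) :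
    ContDiffAt ℝ ∞ (fun s => secondOrder (P s) (Q s)) t := by
  obtain ⟨-, -, hP, hQ, -⟩ := h.self_of_nhds
  have h1 : ContDiffAt ℝ ∞ (fun s => P s ∘L ContinuousLinearMap.fst ℝ E E +
      Q s ∘L ContinuousLinearMap.snd ℝ E E) t :=
    (hP.clm_comp contDiffAt_const).add (hQ.clm_comp contDiffAt_const)
  have h2 : (fun s => secondOrder (P s) (Q s)) = fun s =>
      ContinuousLinearMap.inl ℝ E E ∘L ContinuousLinearMap.snd ℝ E E +
      ContinuousLinearMap.inr ℝ E E ∘L (P s ∘L ContinuousLinearMap.fst ℝ E E +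
      Q s ∘L ContinuousLinearMap.snd ℝ E E) := by
    ext s a <;> simp
  rw [h2]
  exact contDiffAt_const.add (contDiffAt_const.clm_comp h1)

variable [FiniteDimensional ℝ E]

theorem hasDerivAt_inverse (h : IsTransportAt ℓ Ψ P Q t) :
    HasDerivAt (fun s => Ring.inverse (Ψ s))
      (-(Ring.inverse (Ψ t) * secondOrder (P t) (Q t))) t :=
  have : CompleteSpace (E × E) := FiniteDimensional.complete ℝ _
  hasDerivAt_inverse_of_hasDerivAt_mul h.hasDerivAt h.isUnit

theorem contDiffAt_inverse (h : IsTransportAt ℓ Ψ P Q t) :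
    ContDiffAt ℝ ∞ (fun s => Ring.inverse (Ψ s)) t := by
  have : CompleteSpace (E × E) := FiniteDimensional.complete ℝ _
  have hΨ : ContDiffAt ℝ ∞ Ψ t :=
    contDiffAt_of_hasDerivAt_mul (h.mono fun s hs => hs.1) h.contDiffAt_secondOrder
  obtain ⟨u, hu⟩ := h.isUnit
  have := contDiffAt_ringInverse (n := ∞) ℝ u
  rw [hu] at this
  exact this.comp t hΨ

theorem hasDerivAt_inverse_apply (h : IsTransportAt ℓ Ψ P Q t) {V : ℝ → E} {V' : E}
    (hV : HasDerivAt V V' t) :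
    HasDerivAt (fun s => Ring.inverse (Ψ s) ((0 : E), V s))
      (Ring.inverse (Ψ t) (-V t, V' - Q t (V t))) t := by
  have h1 := h.hasDerivAt_inverse.clm_apply ((hasDerivAt_const t (0 : E)).prodMk hV)
  convert! h1 using 1
  rw [neg_apply, mul_apply_eq_comp, ← map_neg, ← map_add]
  simp [sub_eq_neg_add]

/-- The frame `s ↦ Ψ(s)⁻¹ (0, bᵢ)` of the curve. -/
theorem isFanningFrameAt (h : IsTransportAt ℓ Ψ P Q t) {n : ℕ} (b : Module.Basis (Fin n) ℝ E) :
    IsFanningFrameAt ℓ t (fun i s => Ring.inverse (Ψ s) ((0 : E), b i)) := by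
  have hd : ∀ i, deriv (fun s => Ring.inverse (Ψ s) ((0 : E), b i)) t =
      Ring.inverse (Ψ t) (-b i, - Q t (b i)) := fun i => by
    simpa using (h.hasDerivAt_inverse_apply (hasDerivAt_const t (b i))).deriv
  have hexp : ∀ (L : E →ₗ[ℝ] E × E) (x : E), L x ∈ Submodule.span ℝ (range fun i => L (b i)) := by
    intro L x
    rw [← b.sum_repr x, map_sum]
    exact Submodule.sum_mem _ fun i _ => by
      rw [map_smul]
      exact Submodule.smul_mem _ _ (Submodule.subset_span ⟨i, rfl⟩)
  have htop : Submodule.span ℝ (range (Sum.elim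
      (fun i => Ring.inverse (Ψ t) ((0 : E), b i))
      (fun i => deriv (fun s => Ring.inverse (Ψ s) ((0 : E), b i)) t))) = ⊤ := by
    rw [eq_top_iff]
    rintro a -
    simp_rw [hd]
    rw [Sum.elim_range, Submodule.span_union]
    let L₁ : E →ₗ[ℝ] E × E := ((Ring.inverse (Ψ t) : (E × E) →L[ℝ] (E × E)) : (E × E) →ₗ[ℝ] (E × E)) ∘ₗ LinearMap.inr ℝ E E
    let L₂ : E →ₗ[ℝ] E × E := ((Ring.inverse (Ψ t) : (E × E) →L[ℝ] (E × E)) : (E × E) →ₗ[ℝ] (E × E)) ∘ₗ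
      (-(LinearMap.id.prod (Q t : E →ₗ[ℝ] E)))
    -- Under `Ψ` the frame is `(0, bᵢ)` and its derivative is `(-bᵢ, -Q bᵢ)`. The splitting used is
    -- `(x, y) = (0, y - Q x) + (x, Q x)`.
    have h1 := hexp L₁ ((Ψ t a).2 - Q t (Ψ t a).1)
    have h2 := hexp L₂ (-(Ψ t a).1)
    have e : a = L₁ ((Ψ t a).2 - Q t (Ψ t a).1) + L₂ (-(Ψ t a).1) := by
      rw [← h.inverse_apply a]
      simp only [L₁, L₂, LinearMap.comp_apply, ContinuousLinearMap.coe_coe, ← map_add,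
        h.apply_inverse]
      congr 1
      refine Prod.ext ?_ ?_ <;> simp
    rw [e]
    refine Submodule.add_mem_sup ?_ ?_
    · simpa [L₁] using h1
    · convert! h2 using 4
  refine ⟨fun i => h.contDiffAt_inverse.clm_apply contDiffAt_const, ?_, ?_, htop⟩
  · filter_upwards [h.eventually] with s hs
    apply le_antisymm
    · rw [Submodule.span_le]
      rintro _ ⟨i, rfl⟩
      rw [SetLike.mem_coe, hs.mem_iff, hs.apply_inverse]
    · intro a ha
      rw [hs.mem_iff] at ha
      have h1 := hexp (((Ring.inverse (Ψ s) : (E × E) →L[ℝ] (E × E)) : (E × E) →ₗ[ℝ] (E × E)) ∘ₗ LinearMap.inr ℝ E E)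
        (Ψ s a).2
      have e : ((Ring.inverse (Ψ s) : (E × E) →L[ℝ] (E × E)) : (E × E) →ₗ[ℝ] (E × E)) (LinearMap.inr ℝ E E (Ψ s a).2) = a := by
        have : (LinearMap.inr ℝ E E (Ψ s a).2) = Ψ s a := by
          refine Prod.ext ?_ ?_ <;> simp [ha]
        rw [this]
        exact hs.inverse_apply a
      rw [LinearMap.comp_apply, e] at h1
      simpa using h1
  -- The `2n` vectors span a space of dimension `2n`.
  · refine linearIndependent_of_top_le_span_of_card_eq_finrank htop.ge ?_
    rw [Module.finrank_prod, Fintype.card_sum, Module.finrank_eq_card_basis b]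

theorem isFanningAt (h : IsTransportAt ℓ Ψ P Q t) : IsFanningAt ℓ t :=
  ⟨_, _, h.isFanningFrameAt (Module.finBasis ℝ E)⟩

-- The first component of `Ψ aᵢ` vanishes identically. Differentiating it with `Ψ' = BΨ` gives `(Ψ
-- aᵢ).2 + (Ψ ȧᵢ).1 = 0`, which is the relation `N Ψ ȧᵢ = Ψ aᵢ`. The frame is arbitrary, and this is
-- what makes the fundamental endomorphism independent of it.
omit [FiniteDimensional ℝ E] in
theorem conj_nilShift_frame (h : IsTransportAt ℓ Ψ P Q t) {n : ℕ} {A : Fin n → ℝ → E × E}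
    (hA : IsFanningFrameAt ℓ t A) (i : Fin n) :
    (Ring.inverse (Ψ t) * nilShift E * Ψ t) (A i t) = 0 ∧
      (Ring.inverse (Ψ t) * nilShift E * Ψ t) (deriv (A i) t) = A i t := by
  have hmem : ∀ᶠ s in 𝓝 t, (Ψ s (A i s)).1 = 0 := by
    filter_upwards [h.eventually, hA.span_eq] with s hs hsp
    rw [← hs.mem_iff, ← hsp]
    exact Submodule.subset_span ⟨i, rfl⟩
  have hd : HasDerivAt (A i) (deriv (A i) t) t :=
    ((hA.smooth i).differentiableAt (by simp)).hasDerivAt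
  have h1 : HasDerivAt (fun s => (Ψ s (A i s)).1) _ t := (h.hasDerivAt.clm_apply hd).fst
  have h2 : HasDerivAt (fun s => (Ψ s (A i s)).1) 0 t :=
    (hasDerivAt_const t (0 : E)).congr_of_eventuallyEq hmem
  have h3 := h1.unique h2
  have h4 := hmem.self_of_nhds
  simp only [mul_apply_eq_comp, secondOrder_apply, Prod.fst_add] at h3
  constructor
  · rw [mul_apply_eq_comp, mul_apply_eq_comp, nilShift_apply, h4, neg_zero]
    exact map_zero _
  · rw [mul_apply_eq_comp, mul_apply_eq_comp, nilShift_apply,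
      neg_eq_of_add_eq_zero_left h3]
    convert! h.inverse_apply (A i t) using 2
    ext
    · exact h4.symm
    · rfl

/-- The frame behind the chosen endomorphism is unknown, but the conjugate of `nilShift E` has the
defining values on every fanning frame, and such a frame together with its derivative spans. -/
theorem fundamentalEndomorphism_eq (h : IsTransportAt ℓ Ψ P Q t) :
    fundamentalEndomorphism ℓ t = Ring.inverse (Ψ t) * nilShift E * Ψ t := by
  have hex : ∃ F : (E × E) →L[ℝ] (E × E), IsFundamentalEndomorphism ℓ t F :=
    ⟨_, _, _, h.isFanningFrameAt (Module.finBasis ℝ E), fun i =>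
      h.conj_nilShift_frame (h.isFanningFrameAt (Module.finBasis ℝ E)) i⟩
  rw [fundamentalEndomorphism, dif_pos hex]
  obtain ⟨n, A, hA, hF⟩ := hex.choose_spec
  have hG := h.conj_nilShift_frame hA
  refine ContinuousLinearMap.coe_injective (LinearMap.ext_on hA.span_eq_top ?_)
  rintro _ ⟨i | i, rfl⟩
  · exact (hF i).1.trans (hG i).1.symm
  · exact (hF i).2.trans (hG i).2.symm

/-- The commutator `[N, B]` of the nilpotent shift with the coefficient operator is the reflection
`(x, y) ↦ (x, Q x - y)`. -/
theorem deriv_fundamentalEndomorphism (h : IsTransportAt ℓ Ψ P Q t) :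
    deriv (fundamentalEndomorphism ℓ) t = Ring.inverse (Ψ t) * reflection (Q t) * Ψ t := by
  have : CompleteSpace (E × E) := FiniteDimensional.complete ℝ _
  have h1 := hasDerivAt_conj h.hasDerivAt h.isUnit (hasDerivAt_const t (nilShift E))
  have h2 : fundamentalEndomorphism ℓ =ᶠ[𝓝 t] fun s => Ring.inverse (Ψ s) * nilShift E * Ψ s :=
    h.eventually.mono fun s hs => hs.fundamentalEndomorphism_eq
  rw [(h1.congr_of_eventuallyEq h2).deriv]
  congr 2
  ext a <;> simp

/-- The same rule for conjugates, applied to the reflection. It now also contributes `Q'`, since the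
reflection depends on time. -/
theorem deriv_deriv_fundamentalEndomorphism (h : IsTransportAt ℓ Ψ P Q t) (a : E × E) :
    Ψ t (deriv (deriv (fundamentalEndomorphism ℓ)) t a) =
      ((2 : ℝ) • (Ψ t a).2 - Q t (Ψ t a).1,
        deriv Q t (Ψ t a).1 - (2 : ℝ) • P t (Ψ t a).1 - Q t (Q t (Ψ t a).1) + Q t (Ψ t a).2) := by
  have : CompleteSpace (E × E) := FiniteDimensional.complete ℝ _
  have hQ : HasDerivAt Q (deriv Q t) t :=
    (h.contDiffAt_coeff.differentiableAt (by simp)).hasDerivAt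
  have h1 := hasDerivAt_conj h.hasDerivAt h.isUnit (hasDerivAt_reflection hQ)
  have h2 : deriv (fundamentalEndomorphism ℓ) =ᶠ[𝓝 t]
      fun s => Ring.inverse (Ψ s) * reflection (Q s) * Ψ s :=
    h.eventually.mono fun s hs => hs.deriv_fundamentalEndomorphism
  rw [(h1.congr_of_eventuallyEq h2).deriv, mul_apply_eq_comp,
    mul_apply_eq_comp, h.apply_inverse]
  ext
  · simp [two_smul]; abel
  · simp [two_smul]; abel

/-- On `(0, y)` the second derivative gives `(2y, Q y)`. A second application cancels the first
component, which is why `𝐊` preserves `ℓ`. -/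
theorem jacobiEndomorphism_apply (h : IsTransportAt ℓ Ψ P Q t) {a : E × E} (ha : a ∈ ℓ t) :
    Ψ t (jacobiEndomorphism ℓ t a) = (0, (1 / 2 : ℝ) • deriv Q t (Ψ t a).2 - P t (Ψ t a).2 -
      (1 / 4 : ℝ) • Q t (Q t (Ψ t a).2)) := by
  rw [h.mem_iff] at ha
  simp only [jacobiEndomorphism, smul_apply, ContinuousLinearMap.comp_apply,
    map_smul, h.deriv_deriv_fundamentalEndomorphism, ha, map_zero]
  ext
  · simp
  · simp only [map_add, map_sub, map_smul, map_zero, Prod.smul_snd]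
    module

theorem projCurve_apply (h : IsTransportAt ℓ Ψ P Q t) (a : E × E) :
    Ψ t (projCurve ℓ t a) = (0, (Ψ t a).2 - (1 / 2 : ℝ) • Q t (Ψ t a).1) := by
  simp only [projCurve, projHorizontalCurve, sub_apply,
    smul_apply, add_apply, ContinuousLinearMap.id_apply,
    map_sub, map_smul, map_add, h.deriv_fundamentalEndomorphism, mul_apply_eq_comp,
    h.apply_inverse, reflection_apply]
  ext
  · simp only [Prod.fst_sub, Prod.smul_fst, Prod.fst_add]; module
  · simp only [Prod.snd_sub, Prod.smul_snd, Prod.snd_add]; module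

/-- Differentiating `a = Ψ⁻¹(0, V)` gives `Ψ ȧ = (-V, V' - Q V)`, and the projection `(x, y) ↦ (0, y
- ½ Q x)` restores half of the last term. -/
theorem projCurve_deriv (h : IsTransportAt ℓ Ψ P Q t) {a : ℝ → E × E} {V : ℝ → E}
    (ha : ∀ᶠ s in 𝓝 t, Ψ s (a s) = (0, V s)) (hV : DifferentiableAt ℝ V t) :
    DifferentiableAt ℝ a t ∧
      Ψ t (projCurve ℓ t (deriv a t)) = (0, deriv V t - (1 / 2 : ℝ) • Q t (V t)) := by
  have h1 := (h.hasDerivAt_inverse_apply hV.hasDerivAt).congr_of_eventuallyEq (f₁ := a) (by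
    filter_upwards [ha, h.eventually] with s hs hs'
    rw [← hs, hs'.inverse_apply])
  refine ⟨h1.differentiableAt, ?_⟩
  rw [h.projCurve_apply, h1.deriv, h.apply_inverse]
  ext
  · rfl
  · simp only [map_neg]; module

end IsTransportAt

end Transport

/-! ### The tangent bundle and the spray in coordinates -/

section SprayCoordinates

variable {E : Type*} [NormedAddCommGroup E] [NormedSpace ℝ E]
  {M : Type*} [TopologicalSpace M] [ChartedSpace E M] [IsManifold 𝓘(ℝ, E) ∞ M]
  {p q : TM E M}

theorem mem_source_tangent_iff :
    q ∈ (extChartAt 𝓘(ℝ, E).tangent p).source ↔ q.1 ∈ (extChartAt 𝓘(ℝ, E) p.1).source := by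
  rw [extChartAt_source, extChartAt_source]
  exact TangentBundle.mem_chart_source_iff q p

theorem extChartAt_tangent_fst : (extChartAt 𝓘(ℝ, E).tangent p q).1 =
    extChartAt 𝓘(ℝ, E) p.1 q.1 := rfl

theorem extChartAt_tangent_snd (hq : q ∈ (extChartAt 𝓘(ℝ, E).tangent p).source) :
    (extChartAt 𝓘(ℝ, E).tangent p q).2 = coordVec 𝓘(ℝ, E) p.1 q.1 q.2 := by
  rw [← trivializationAt_snd_eq_coordVec (mem_source_tangent_iff.1 hq)]
  rfl

theorem mem_slit_iff (hq : q ∈ (extChartAt 𝓘(ℝ, E).tangent p).source) :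
    q ∈ slit E M ↔ (extChartAt 𝓘(ℝ, E).tangent p q).2 ≠ 0 :=
  (coord_snd_ne_zero_iff (mem_source_tangent_iff.1 hq)).symm

theorem coordVec_fst (hq : q ∈ (extChartAt 𝓘(ℝ, E).tangent p).source) (ξ : TT q) :
    (coordVec 𝓘(ℝ, E).tangent p q ξ).1 = coordVec 𝓘(ℝ, E) p.1 q.1 (dproj q ξ) := by
  have h1 : HasMFDerivAt 𝓘(ℝ, E).tangent 𝓘(ℝ, E) (fun q : TM E M => q.1) q (dproj q) :=
    ((contMDiff_proj (n := 1) (TangentSpace 𝓘(ℝ, E) : M → Type _)).mdifferentiableAt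
      one_ne_zero).hasMFDerivAt
  have h2 := HasMFDerivAt.comp q (hasMFDerivAt_coord (mem_source_tangent_iff.1 hq)) h1
  have h3 := HasMFDerivAt.comp q ((ContinuousLinearMap.fst ℝ E E).hasFDerivAt.hasMFDerivAt)
    (hasMFDerivAt_coord hq)
  exact congrArg (fun T : (E × E) →L[ℝ] E => T ξ) (hasMFDerivAt_unique h3 h2)

theorem hasMFDerivAt_curve {c : ℝ → TM E M} {t : ℝ}
    (hc : MDifferentiableAt 𝓘(ℝ, ℝ) 𝓘(ℝ, E).tangent c t) :
    HasMFDerivAt 𝓘(ℝ, ℝ) 𝓘(ℝ, E).tangent c t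
      ((1 : ℝ →L[ℝ] ℝ).smulRight (mfderiv 𝓘(ℝ, ℝ) 𝓘(ℝ, E).tangent c t (1 : ℝ))) := by
  refine hc.hasMFDerivAt.congr_mfderiv ?_
  ext
  exact (one_smul ℝ _).symm

/-- The charts of `TM` are linear on the fibres, so the line in the fibre becomes a straight line
with constant base point. -/
theorem coordVec_vlift (hq : q ∈ (extChartAt 𝓘(ℝ, E).tangent p).source) (u : T (E := E) q.1) :
    coordVec 𝓘(ℝ, E).tangent p q (vlift q u) = (0, coordVec 𝓘(ℝ, E) p.1 q.1 u) := by
  have h0 : fibreLine q u 0 = q := by simp [fibreLine]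
  let z : ℝ → E × E := fun t => extChartAt 𝓘(ℝ, E).tangent p q +
    t • ((0 : E), (coordVec 𝓘(ℝ, E) p.1 q.1 u : E))
  have hs : ∀ t, fibreLine q u t ∈ (extChartAt 𝓘(ℝ, E).tangent p).source := fun t =>
    mem_source_tangent_iff.2 (mem_source_tangent_iff.1 hq)
  have hz : ∀ t, extChartAt 𝓘(ℝ, E).tangent p (fibreLine q u t) = z t := by
    intro t
    refine Prod.ext ?_ ?_
    · rw [extChartAt_tangent_fst]
      simp [z, fibreLine]
    · rw [extChartAt_tangent_snd (hs t)]
      simp only [z, Prod.snd_add, Prod.smul_snd]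
      rw [extChartAt_tangent_snd hq]
      exact (map_add _ _ _).trans (congrArg _ (map_smul _ _ _))
  have hz' : HasDerivAt z ((0 : E), (coordVec 𝓘(ℝ, E) p.1 q.1 u : E)) 0 := by
    have := ((hasDerivAt_id (0 : ℝ)).smul_const
      ((0 : E), (coordVec 𝓘(ℝ, E) p.1 q.1 u : E))).const_add (extChartAt 𝓘(ℝ, E).tangent p q)
    simpa [z] using this
  have h1 := hasMFDerivAt_symm_comp (I := 𝓘(ℝ, E).tangent) (p := p)
    (by rw [← hz]; exact (extChartAt _ p).map_source (hs 0)) hz'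
  have h2 : (fun s => (extChartAt 𝓘(ℝ, E).tangent p).symm (z s)) = fibreLine q u := by
    funext s
    rw [← hz, (extChartAt _ p).left_inv (hs s)]
  rw [h2] at h1
  have h3 := (hasDerivAt_coord_comp (hs 0) (hasMFDerivAt_curve h1.mdifferentiableAt)).unique
    (hz'.congr_of_eventuallyEq (.of_forall hz))
  exact (congrArg (fun r => (coordVec 𝓘(ℝ, E).tangent p r : (E × E) →L[ℝ] (E × E))
    (vlift q u : E × E)) h0).symm.trans h3

/-! #### Vertical vectors -/

theorem mem_vertical_iff (hq : q ∈ (extChartAt 𝓘(ℝ, E).tangent p).source) (ξ : TT q) :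
    ξ ∈ vertical q ↔ (coordVec 𝓘(ℝ, E).tangent p q ξ).1 = 0 := by
  rw [coordVec_fst hq]
  exact ((coordVec_injective (mem_source_tangent_iff.1 hq)).eq_iff' (map_zero _)).symm

theorem vlift_injective : Function.Injective (vlift q) := by
  intro u v h
  have hq := mem_extChartAt_source (I := 𝓘(ℝ, E).tangent) q
  have h1 := congrArg (coordVec 𝓘(ℝ, E).tangent q q) h
  rw [coordVec_vlift hq, coordVec_vlift hq] at h1
  exact coordVec_injective (mem_source_tangent_iff.1 hq) (congrArg Prod.snd h1)

theorem vliftInv_vlift (u : T (E := E) q.1) : vliftInv q (vlift q u) = u :=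
  Function.leftInverse_invFun vlift_injective u

theorem vlift_vliftInv {ξ : TT q} (hξ : ξ ∈ vertical q) : vlift q (vliftInv q ξ) = ξ := by
  refine Function.invFun_eq ⟨coordInv 𝓘(ℝ, E) q.1 q.1 (coordVec 𝓘(ℝ, E).tangent q q ξ).2, ?_⟩
  have hq := mem_extChartAt_source (I := 𝓘(ℝ, E).tangent) q
  apply coordVec_injective hq
  rw [coordVec_vlift hq, coordVec_coordInv (mem_source_tangent_iff.1 hq)]
  exact Prod.ext ((mem_vertical_iff hq ξ).1 hξ).symm rfl

theorem coordVec_vliftInv (hq : q ∈ (extChartAt 𝓘(ℝ, E).tangent p).source) {ξ : TT q}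
    (hξ : ξ ∈ vertical q) :
    coordVec 𝓘(ℝ, E) p.1 q.1 (vliftInv q ξ) = (coordVec 𝓘(ℝ, E).tangent p q ξ).2 := by
  conv_rhs => rw [← vlift_vliftInv hξ, coordVec_vlift hq]

theorem coordVec_canonicalField (hq : q ∈ (extChartAt 𝓘(ℝ, E).tangent p).source) :
    coordVec 𝓘(ℝ, E).tangent p q (canonicalField q : TT q) =
      (0, (extChartAt 𝓘(ℝ, E).tangent p q).2) := by
  rw [extChartAt_tangent_snd hq]
  exact coordVec_vlift hq _

theorem coordVec_almostTangent (hq : q ∈ (extChartAt 𝓘(ℝ, E).tangent p).source) (ξ : TT q) :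
    coordVec 𝓘(ℝ, E).tangent p q (almostTangent q ξ : TT q) =
      (0, (coordVec 𝓘(ℝ, E).tangent p q ξ).1) := by
  rw [coordVec_fst hq]
  exact coordVec_vlift hq _

theorem coordField_canonicalField {z : E × E} (hz : z ∈ (extChartAt 𝓘(ℝ, E).tangent p).target) :
    coordField 𝓘(ℝ, E).tangent p (fun q => (canonicalField q : TT q)) z = (0, z.2) := by
  rw [coordField, coordVec_canonicalField ((extChartAt _ p).map_target hz),
    (extChartAt _ p).right_inv hz]

theorem coordField_almostTangent {z : E × E} (hz : z ∈ (extChartAt 𝓘(ℝ, E).tangent p).target)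
    (X : ∀ p : TM E M, TT p) :
    coordField 𝓘(ℝ, E).tangent p (fun q => (almostTangent q (X q) : TT q)) z =
      (0, (coordField 𝓘(ℝ, E).tangent p X z).1) :=
  coordVec_almostTangent ((extChartAt _ p).map_target hz) _

/-! #### The spray -/

variable {S : ∀ p : TM E M, TT p}

/-- The derivative of the second component of `f` in the second variable. -/
noncomputable def fibreDeriv (f : E × E → E × E) (z : E × E) : E →L[ℝ] E :=
  ContinuousLinearMap.snd ℝ E E ∘L fderiv ℝ f z ∘L ContinuousLinearMap.inr ℝ E E

/-- The derivative of the second component of `f` in the first variable. -/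
noncomputable def baseDeriv (f : E × E → E × E) (z : E × E) : E →L[ℝ] E :=
  ContinuousLinearMap.snd ℝ E E ∘L fderiv ℝ f z ∘L ContinuousLinearMap.inl ℝ E E

theorem IsSpray.contDiffAt_coordField (hS : IsSpray S)
    (hq : q ∈ (extChartAt 𝓘(ℝ, E).tangent p).source) (hq0 : q ∈ slit E M) :
    ContDiffAt ℝ ∞ (coordField 𝓘(ℝ, E).tangent p S) (extChartAt 𝓘(ℝ, E).tangent p q) :=
  (contMDiffAt_field_iff hq S).1 (contMDiffAt_of_smoothOn hS.smooth isOpen_slit hq0)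

theorem IsSpray.mdifferentiableAt (hS : IsSpray S) (hq0 : q ∈ slit E M) : DiffAt S q :=
  (contMDiffAt_of_smoothOn hS.smooth isOpen_slit hq0).mdifferentiableAt (by simp)

theorem IsSpray.coordVec_fst (hS : IsSpray S)
    (hq : q ∈ (extChartAt 𝓘(ℝ, E).tangent p).source) (hq0 : q ∈ slit E M) :
    (coordVec 𝓘(ℝ, E).tangent p q (S q)).1 = (extChartAt 𝓘(ℝ, E).tangent p q).2 := by
  have h := congrArg (fun ξ : vertical q => coordVec 𝓘(ℝ, E).tangent p q (ξ : TT q))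
    (hS.almostTangent_eq q hq0)
  rw [coordVec_almostTangent hq, coordVec_canonicalField hq] at h
  exact congrArg Prod.snd h

/-- A property of vectors in the slit tangent bundle holds in the chart. -/
theorem eventually_chart {R : E × E → Prop}
    (hq : q ∈ (extChartAt 𝓘(ℝ, E).tangent p).source) (hq0 : q ∈ slit E M)
    (h : ∀ r ∈ (extChartAt 𝓘(ℝ, E).tangent p).source, r ∈ slit E M →
      R (extChartAt 𝓘(ℝ, E).tangent p r)) :
    ∀ᶠ z in 𝓝 (extChartAt 𝓘(ℝ, E).tangent p q), R z := by
  filter_upwards [eventually_mem_target hq,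
    continuous_snd.continuousAt.eventually_ne ((mem_slit_iff hq).1 hq0)] with z hz hz0
  have hr := (extChartAt 𝓘(ℝ, E).tangent p).map_target hz
  have hzr := (extChartAt 𝓘(ℝ, E).tangent p).right_inv hz
  have := h _ hr ((mem_slit_iff hr).2 (by rwa [hzr]))
  rwa [hzr] at this

theorem IsSpray.eventually_coordField_fst (hS : IsSpray S)
    (hq : q ∈ (extChartAt 𝓘(ℝ, E).tangent p).source) (hq0 : q ∈ slit E M) :
    ∀ᶠ z in 𝓝 (extChartAt 𝓘(ℝ, E).tangent p q), (coordField 𝓘(ℝ, E).tangent p S z).1 = z.2 :=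
  eventually_chart hq hq0 fun r hr hr0 => by
    rw [coordField_extChartAt hr]; exact hS.coordVec_fst hr hr0

/-- The first component of the spray is `y` on a whole neighbourhood, so it may be differentiated as
such. The linearized flow thereby becomes a second-order equation. -/
theorem IsSpray.fderiv_coordField (hS : IsSpray S)
    (hq : q ∈ (extChartAt 𝓘(ℝ, E).tangent p).source) (hq0 : q ∈ slit E M) (a : E × E) :
    fderiv ℝ (coordField 𝓘(ℝ, E).tangent p S) (extChartAt 𝓘(ℝ, E).tangent p q) a =
      (a.2, baseDeriv (coordField 𝓘(ℝ, E).tangent p S) (extChartAt 𝓘(ℝ, E).tangent p q) a.1 +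
        fibreDeriv (coordField 𝓘(ℝ, E).tangent p S) (extChartAt 𝓘(ℝ, E).tangent p q) a.2) := by
  have hd := ((hS.contDiffAt_coordField hq hq0).differentiableAt (by simp)).hasFDerivAt
  refine Prod.ext ?_ ?_
  · have h1 : HasFDerivAt (fun z => (coordField 𝓘(ℝ, E).tangent p S z).1) _ _ := hd.fst
    have h2 : HasFDerivAt (fun z => (coordField 𝓘(ℝ, E).tangent p S z).1)
        (ContinuousLinearMap.snd ℝ E E) (extChartAt 𝓘(ℝ, E).tangent p q) :=
      (ContinuousLinearMap.snd ℝ E E).hasFDerivAt.congr_of_eventuallyEq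
        (hS.eventually_coordField_fst hq hq0)
    exact congrArg (fun T : (E × E) →L[ℝ] E => T a) (h1.unique h2)
  · simp only [baseDeriv, fibreDeriv, ContinuousLinearMap.comp_apply, ← Prod.snd_add, ← map_add,
      ContinuousLinearMap.coe_snd']
    simp

/-- The homogeneity of the spray. -/
theorem IsSpray.fibreDeriv_apply_snd [CompleteSpace E] (hS : IsSpray S)
    (hq : q ∈ (extChartAt 𝓘(ℝ, E).tangent p).source) (hq0 : q ∈ slit E M) :
    fibreDeriv (coordField 𝓘(ℝ, E).tangent p S) (extChartAt 𝓘(ℝ, E).tangent p q)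
      (extChartAt 𝓘(ℝ, E).tangent p q).2 = (2 : ℝ) • (coordVec 𝓘(ℝ, E).tangent p q (S q)).2 := by
  have hC : HasFDerivAt (coordField 𝓘(ℝ, E).tangent p (fun q => (canonicalField q : TT q)))
      (ContinuousLinearMap.inr ℝ E E ∘L ContinuousLinearMap.snd ℝ E E)
      (extChartAt 𝓘(ℝ, E).tangent p q) :=
    (ContinuousLinearMap.inr ℝ E E ∘L
      ContinuousLinearMap.snd ℝ E E).hasFDerivAt.congr_of_eventuallyEq (by
        filter_upwards [eventually_mem_target hq] with z hz
        rw [coordField_canonicalField hz]; rfl)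
  have h := congrArg (coordVec 𝓘(ℝ, E).tangent p q) (hS.homogeneous q hq0)
  rw [bracket, coordVec_mlieBracket hq ((mdifferentiableAt_field_iff hq _).2 hC.differentiableAt)
    (hS.mdifferentiableAt hq0), hC.fderiv, coordVec_canonicalField hq,
    hS.fderiv_coordField hq hq0] at h
  -- The second component of `[C, S] = S` reads `G y - g = g`.
  have h2 := congrArg Prod.snd h
  simp only [map_zero, zero_add, Prod.snd_sub, ContinuousLinearMap.comp_apply,
    ContinuousLinearMap.coe_snd', ContinuousLinearMap.inr_apply] at h2
  rw [two_smul]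
  exact sub_eq_iff_eq_add.1 h2

/-! #### The horizontal bundle -/

/-- The derivative of the extension of `ξ` along `S` occurs in both brackets and cancels, so the
value depends on `ξ` only. -/
theorem IsSpray.coordVec_grifone [CompleteSpace E] (hS : IsSpray S)
    (hq : q ∈ (extChartAt 𝓘(ℝ, E).tangent p).source) (hq0 : q ∈ slit E M) (ξ : TT q) :
    coordVec 𝓘(ℝ, E).tangent p q (grifone S q ξ) = ((coordVec 𝓘(ℝ, E).tangent p q ξ).1,
      fibreDeriv (coordField 𝓘(ℝ, E).tangent p S) (extChartAt 𝓘(ℝ, E).tangent p q)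
        (coordVec 𝓘(ℝ, E).tangent p q ξ).1 - (coordVec 𝓘(ℝ, E).tangent p q ξ).2) := by
  have hX : DiffAt (FiberBundle.extend (E × E) ξ) q :=
    FiberBundle.mdifferentiableAt_extend 𝓘(ℝ, E).tangent (E × E) ξ
  have hX' := (mdifferentiableAt_field_iff hq _).1 hX
  set X : ∀ r : TM E M, TT r := FiberBundle.extend (E × E) ξ with hXdef
  have hXq : X q = ξ := FiberBundle.extend_apply_self (E × E) ξ
  have hJ : HasFDerivAt (coordField 𝓘(ℝ, E).tangent p (fun q => (almostTangent q (X q) : TT q)))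
      ((ContinuousLinearMap.inr ℝ E E ∘L ContinuousLinearMap.fst ℝ E E) ∘L
        fderiv ℝ (coordField 𝓘(ℝ, E).tangent p X) (extChartAt 𝓘(ℝ, E).tangent p q))
      (extChartAt 𝓘(ℝ, E).tangent p q) := by
    refine HasFDerivAt.congr_of_eventuallyEq ((ContinuousLinearMap.inr ℝ E E ∘L
      ContinuousLinearMap.fst ℝ E E).hasFDerivAt.comp _ hX'.hasFDerivAt) ?_
    filter_upwards [eventually_mem_target hq] with z hz
    rw [coordField_almostTangent hz]; rfl
  rw [grifone, map_sub, coordVec_almostTangent hq, bracket, bracket,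
    coordVec_mlieBracket hq (hS.mdifferentiableAt hq0) hX,
    coordVec_mlieBracket hq (hS.mdifferentiableAt hq0)
      ((mdifferentiableAt_field_iff hq _).2 hJ.differentiableAt), hJ.fderiv,
    hS.fderiv_coordField hq hq0, hS.fderiv_coordField hq hq0, coordVec_almostTangent hq, hXq]
  refine Prod.ext ?_ ?_
  · simp
  · simp

theorem IsSpray.coordVec_projVertical [CompleteSpace E] (hS : IsSpray S)
    (hq : q ∈ (extChartAt 𝓘(ℝ, E).tangent p).source) (hq0 : q ∈ slit E M) (ξ : TT q) :
    coordVec 𝓘(ℝ, E).tangent p q (projVertical S q ξ) = (0, (coordVec 𝓘(ℝ, E).tangent p q ξ).2 -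
      (1 / 2 : ℝ) • fibreDeriv (coordField 𝓘(ℝ, E).tangent p S) (extChartAt 𝓘(ℝ, E).tangent p q)
        (coordVec 𝓘(ℝ, E).tangent p q ξ).1) := by
  rw [projVertical, map_smul, map_sub, hS.coordVec_grifone hq hq0]
  refine Prod.ext ?_ ?_
  · simp
  · simp only [Prod.smul_snd, Prod.snd_sub]; module

theorem IsSpray.isHorizontal_iff [CompleteSpace E] (hS : IsSpray S)
    (hq : q ∈ (extChartAt 𝓘(ℝ, E).tangent p).source) (hq0 : q ∈ slit E M) (ξ : TT q) :
    IsHorizontal S q ξ ↔ (coordVec 𝓘(ℝ, E).tangent p q ξ).2 = (1 / 2 : ℝ) •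
      fibreDeriv (coordField 𝓘(ℝ, E).tangent p S) (extChartAt 𝓘(ℝ, E).tangent p q)
        (coordVec 𝓘(ℝ, E).tangent p q ξ).1 := by
  rw [IsHorizontal, ← (coordVec_injective hq).eq_iff, hS.coordVec_grifone hq hq0, Prod.ext_iff]
  simp only [true_and]
  constructor
  · intro h
    rw [sub_eq_iff_eq_add] at h
    rw [h]; module
  · intro h
    rw [h]; module

/-- The lift is a chosen preimage. The explicit vector `(u, ½ G u)` shows that a horizontal preimage
exists, and the horizontality equation then forces the second component. -/
theorem IsSpray.coordVec_hlift [CompleteSpace E] (hS : IsSpray S)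
    (hq : q ∈ (extChartAt 𝓘(ℝ, E).tangent p).source) (hq0 : q ∈ slit E M) (u : T (E := E) q.1) :
    coordVec 𝓘(ℝ, E).tangent p q (hlift S q u) = (coordVec 𝓘(ℝ, E) p.1 q.1 u,
      (1 / 2 : ℝ) • fibreDeriv (coordField 𝓘(ℝ, E).tangent p S) (extChartAt 𝓘(ℝ, E).tangent p q)
        (coordVec 𝓘(ℝ, E) p.1 q.1 u)) := by
  have hex : ∃ ξ ∈ {ξ | IsHorizontal S q ξ}, dproj q ξ = u := by
    refine ⟨coordInv 𝓘(ℝ, E).tangent p q (coordVec 𝓘(ℝ, E) p.1 q.1 u,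
      (1 / 2 : ℝ) • fibreDeriv (coordField 𝓘(ℝ, E).tangent p S) (extChartAt 𝓘(ℝ, E).tangent p q)
        (coordVec 𝓘(ℝ, E) p.1 q.1 u)), ?_, ?_⟩
    · exact (hS.isHorizontal_iff hq hq0 _).2 (by rw [coordVec_coordInv hq])
    · apply coordVec_injective (mem_source_tangent_iff.1 hq)
      rw [← SprayGeometry.coordVec_fst hq, coordVec_coordInv hq]
  have h1 : IsHorizontal S q (hlift S q u) := Function.invFunOn_mem hex
  have h2 : dproj q (hlift S q u) = u := Function.invFunOn_eq hex
  have h3 := (hS.isHorizontal_iff hq hq0 _).1 h1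
  rw [SprayGeometry.coordVec_fst hq, h2] at h3
  refine Prod.ext ?_ h3
  rw [SprayGeometry.coordVec_fst hq, h2]

/-- This is Euler's relation `½ G y = g`. -/
theorem IsSpray.isHorizontal_self [CompleteSpace E] (hS : IsSpray S) (hq0 : q ∈ slit E M) :
    IsHorizontal S q (S q) := by
  have hq := mem_extChartAt_source (I := 𝓘(ℝ, E).tangent) q
  rw [hS.isHorizontal_iff hq hq0, hS.coordVec_fst hq hq0, hS.fibreDeriv_apply_snd hq hq0]
  module

/-- A horizontal vector over `q` itself is the value of the spray. -/
theorem IsSpray.eq_of_isHorizontal [CompleteSpace E] (hS : IsSpray S) (hq0 : q ∈ slit E M)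
    {ξ : TT q} (hξ : IsHorizontal S q ξ) (h : dproj q ξ = q.2) : ξ = S q := by
  have hq := mem_extChartAt_source (I := 𝓘(ℝ, E).tangent) q
  have h1 := (hS.isHorizontal_iff hq hq0 _).1 hξ
  rw [SprayGeometry.coordVec_fst hq, h, ← extChartAt_tangent_snd hq,
    hS.fibreDeriv_apply_snd hq hq0] at h1
  apply coordVec_injective hq
  refine Prod.ext ?_ ?_
  · rw [SprayGeometry.coordVec_fst hq, h, ← extChartAt_tangent_snd hq, hS.coordVec_fst hq hq0]
  · rw [h1]; module

end SprayCoordinates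

/-! ### Adapted connections in coordinates -/

section ConnectionCoordinates

variable {E : Type*} [NormedAddCommGroup E] [NormedSpace ℝ E]
  {M : Type*} [TopologicalSpace M] [ChartedSpace E M] [IsManifold 𝓘(ℝ, E) ∞ M]
  {p q : TM E M}

theorem diffAt_iff (hq : q ∈ (extChartAt 𝓘(ℝ, E).tangent p).source) {X : ∀ p : TM E M, TT p} :
    DiffAt X q ↔ DifferentiableAt ℝ (coordField 𝓘(ℝ, E).tangent p X)
      (extChartAt 𝓘(ℝ, E).tangent p q) :=
  mdifferentiableAt_field_iff hq X

theorem hasMFDerivAt_of_coord {f : TM E M → ℝ} {F : E × E → ℝ} {F' : (E × E) →L[ℝ] ℝ}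
    (hq : q ∈ (extChartAt 𝓘(ℝ, E).tangent p).source)
    (hf : ∀ r ∈ (extChartAt 𝓘(ℝ, E).tangent p).source,
      f r = F (extChartAt 𝓘(ℝ, E).tangent p r))
    (hF : HasFDerivAt F F' (extChartAt 𝓘(ℝ, E).tangent p q)) :
    HasMFDerivAt 𝓘(ℝ, E).tangent 𝓘(ℝ, ℝ) f q (F' ∘L coordVec 𝓘(ℝ, E).tangent p q) :=
  (HasMFDerivAt.comp q hF.hasMFDerivAt (hasMFDerivAt_coord hq)).congr_of_eventuallyEq <| by
    filter_upwards [eventually_mem_source hq] with r hr using hf r hr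

theorem coordVec_ofCoord {x₀ x : M} (hx : x ∈ (extChartAt 𝓘(ℝ, E) x₀).source) (u : E) :
    coordVec 𝓘(ℝ, E) x₀ x (ofCoord x₀ u x) = u := by
  rw [← trivializationAt_snd_eq_coordVec hx, ofCoord]
  rw [extChartAt_source] at hx
  have := (trivializationAt E (TangentSpace 𝓘(ℝ, E) : M → Type _) x₀).apply_mk_symm
    (b := x) hx u
  exact congrArg Prod.snd this

theorem coordVec_vliftV_ofCoord (hq : q ∈ (extChartAt 𝓘(ℝ, E).tangent p).source) (u : E) :
    coordVec 𝓘(ℝ, E).tangent p q (vliftV q (ofCoord p.1 u q.1) : TT q) = (0, u) := by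
  refine (coordVec_vlift hq _).trans ?_
  rw [coordVec_ofCoord (mem_source_tangent_iff.1 hq)]

theorem coordField_eventuallyEq_of_coordVec (hq : q ∈ (extChartAt 𝓘(ℝ, E).tangent p).source)
    {X : ∀ p : TM E M, TT p} {F : E × E → E × E}
    (h : ∀ r ∈ (extChartAt 𝓘(ℝ, E).tangent p).source,
      coordVec 𝓘(ℝ, E).tangent p r (X r) = F (extChartAt 𝓘(ℝ, E).tangent p r)) :
    coordField 𝓘(ℝ, E).tangent p X =ᶠ[𝓝 (extChartAt 𝓘(ℝ, E).tangent p q)] F := by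
  filter_upwards [eventually_mem_target hq] with z hz
  rw [coordField, h _ ((extChartAt _ p).map_target hz), (extChartAt _ p).right_inv hz]

theorem smoothOn_of_coord {X : ∀ p : TM E M, TT p} {U : Set (TM E M)}
    (hU : U ⊆ (extChartAt 𝓘(ℝ, E).tangent p).source) {a : E × E}
    (h : ∀ r : TM E M, r ∈ (extChartAt 𝓘(ℝ, E).tangent p).source →
      coordVec 𝓘(ℝ, E).tangent p r (X r) = a) : SmoothOn X U := fun _ hr =>
  ((contMDiffAt_field_iff (hU hr) X).2 (contDiffAt_const.congr_of_eventuallyEq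
    (coordField_eventuallyEq_of_coordVec (F := fun _ => a) (hU hr) h))).contMDiffWithinAt

/-- The domain of the chart at `p`, without the zero section. -/
def slitSource (p : TM E M) : Set (TM E M) :=
  (extChartAt 𝓘(ℝ, E).tangent p).source ∩ slit E M

theorem isOpen_slitSource : IsOpen (slitSource p) :=
  (isOpen_extChartAt_source (I := 𝓘(ℝ, E).tangent) p).inter isOpen_slit

variable {N : VConn E M}

namespace IsLinearConnection

variable (hN : IsLinearConnection N)
include hN

/-- Locality follows from the Leibniz rule. The indicator `f` of the set where `Y = Z` satisfies `f
Y = f Z` everywhere, and near `q` it is constantly `1`, so it is differentiable there with zero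
derivative; no bump function is needed. -/
theorem congr_of_eventuallyEq (hq0 : q ∈ slit E M) {Y Z : ∀ p : TM E M, vertical p}
    (h : ∀ᶠ r in 𝓝 q, Y r = Z r) (hY : DiffAt (fun r => (Y r : TT r)) q)
    (hZ : DiffAt (fun r => (Z r : TT r)) q) : N Y q = N Z q := by
  classical
  let f : TM E M → ℝ := fun r => if Y r = Z r then 1 else 0
  have hf : f =ᶠ[𝓝 q] fun _ => 1 := h.mono fun r hr => if_pos hr
  have hf' : HasMFDerivAt 𝓘(ℝ, E).tangent 𝓘(ℝ, ℝ) f q 0 :=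
    (hasMFDerivAt_const 1 q).congr_of_eventuallyEq hf
  have hfY : (fun r => f r • Y r) = fun r => f r • Z r := by
    funext r
    by_cases hr : Y r = Z r
    · rw [hr]
    · simp [f, hr]
  have h1 : ∀ W : ∀ p : TM E M, vertical p, DiffAt (fun r => (W r : TT r)) q →
      ∀ ξ, N (fun r => f r • W r) q ξ = N W q ξ := by
    intro W hW ξ
    rw [hN.leibniz f W q hq0 hf'.mdifferentiableAt hW, dfun, hf'.mfderiv, hf.self_of_nhds, one_smul]
    have : (0 : TT q →L[ℝ] ℝ) ξ • W q = 0 := zero_smul ℝ (W q)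
    exact (congrArg _ this).trans (add_zero _)
  ext1 ξ
  rw [← h1 Y hY, ← h1 Z hZ, hfY]

omit hN in
theorem coordField_sum {ι : Type*} (s : Finset ι) (Y : ι → ∀ p : TM E M, vertical p) (z : E × E) :
    coordField 𝓘(ℝ, E).tangent p (fun r => ((∑ i ∈ s, Y i r : vertical r) : TT r)) z =
      ∑ i ∈ s, coordField 𝓘(ℝ, E).tangent p (fun r => (Y i r : TT r)) z := by
  simp only [coordField, Submodule.coe_sum, map_sum]

omit hN in
theorem diffAt_sum {ι : Type*} {s : Finset ι} {Y : ι → ∀ p : TM E M, vertical p}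
    (hY : ∀ i ∈ s, DiffAt (fun r => (Y i r : TT r)) q) :
    DiffAt (fun r => ((∑ i ∈ s, Y i r : vertical r) : TT r)) q := by
  have hq := mem_extChartAt_source (I := 𝓘(ℝ, E).tangent) q
  rw [diffAt_iff hq]
  refine DifferentiableAt.congr_of_eventuallyEq
    (DifferentiableAt.fun_sum fun i hi => (diffAt_iff hq).1 (hY i hi))
    (.of_forall (coordField_sum s Y))

theorem map_sum {ι : Type*} (hq0 : q ∈ slit E M) {s : Finset ι}
    {Y : ι → ∀ p : TM E M, vertical p} (hY : ∀ i ∈ s, DiffAt (fun r => (Y i r : TT r)) q) :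
    N (fun r => ∑ i ∈ s, Y i r) q = ∑ i ∈ s, N (Y i) q := by
  classical
  induction s using Finset.induction_on with
  | empty =>
    ext1 ξ
    -- The zero section is killed by the Leibniz rule for the zero function.
    have hf : HasMFDerivAt 𝓘(ℝ, E).tangent 𝓘(ℝ, ℝ) (fun _ : TM E M => (0 : ℝ)) q 0 :=
      hasMFDerivAt_const 0 q
    have h := hN.leibniz (fun _ => 0) _ q hq0 hf.mdifferentiableAt (diffAt_sum hY) ξ
    rw [dfun, hf.mfderiv] at h
    simp only [zero_smul, Finset.sum_empty, smul_zero, zero_add] at h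
    exact h.trans (smul_zero (A := vertical q) _)
  | insert i s hi ih =>
    have h1 := fun j hj => hY j (Finset.mem_insert_of_mem hj)
    simp only [Finset.sum_insert hi]
    rw [hN.add _ _ q hq0 (hY i (Finset.mem_insert_self i s)) (diffAt_sum h1), ih h1]

/-- A linear connection is given in a chart by smooth coefficients. -/
theorem exists_christoffel [FiniteDimensional ℝ E] (p : TM E M) :
    ∃ Γ : E × E → (E × E) →L[ℝ] E →L[ℝ] E, ∀ q ∈ slitSource p,
      ContDiffAt ℝ ∞ Γ (extChartAt 𝓘(ℝ, E).tangent p q) ∧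
      ∀ Y : ∀ p : TM E M, vertical p, DiffAt (fun r => (Y r : TT r)) q → ∀ ξ : TT q,
        (coordVec 𝓘(ℝ, E).tangent p q (N Y q ξ : TT q)).2 =
          (fderiv ℝ (coordField 𝓘(ℝ, E).tangent p (fun r => (Y r : TT r)))
            (extChartAt 𝓘(ℝ, E).tangent p q) (coordVec 𝓘(ℝ, E).tangent p q ξ)).2 +
          Γ (extChartAt 𝓘(ℝ, E).tangent p q) (coordVec 𝓘(ℝ, E).tangent p q ξ)
            (coordVec 𝓘(ℝ, E).tangent p q (Y q : TT q)).2 := by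
  let b := Module.finBasis ℝ E
  let c := Module.finBasis ℝ (E × E)
  let bc := fun j => LinearMap.toContinuousLinearMap (b.coord j)
  let cc := fun j => LinearMap.toContinuousLinearMap (c.coord j)
  let e := fun j (r : TM E M) => vliftV r (ofCoord p.1 (b j) r.1)
  let X := fun i (r : TM E M) => coordInv 𝓘(ℝ, E).tangent p r (c i)
  -- The Christoffel symbols: components of `∇` applied to the coordinate vertical frame `e j` in
  -- the direction of the coordinate fields `X i`.
  let A := fun i j (z : E × E) =>
    (coordField 𝓘(ℝ, E).tangent p (fun r => (N (e j) r (X i r) : TT r)) z).2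
  have he : ∀ j, SmoothOn (fun r => (e j r : TT r)) (slitSource p) := fun j =>
    smoothOn_of_coord inter_subset_left fun r hr => coordVec_vliftV_ofCoord hr (b j)
  have hX : ∀ i, SmoothOn (X i) (slitSource p) := fun i =>
    smoothOn_of_coord inter_subset_left fun r hr => coordVec_coordInv hr (c i)
  refine ⟨fun z => ∑ i, ∑ j, (cc i).smulRight ((bc j).smulRight (A i j z)), fun q hq => ⟨?_, ?_⟩⟩
  · refine ContDiffAt.sum fun i _ => ContDiffAt.sum fun j _ =>
      contDiffAt_const.smulRight (contDiffAt_const.smulRight (ContDiffAt.snd ?_))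
    exact (contMDiffAt_field_iff hq.1 _).1 (contMDiffAt_of_smoothOn
      (hN.smooth (X i) (e j) (slitSource p) isOpen_slitSource inter_subset_right (hX i) (he j))
      isOpen_slitSource hq)
  · intro Y hY ξ
    have hYd := (diffAt_iff hq.1).1 hY
    let y := fun j (r : TM E M) => bc j (coordVec 𝓘(ℝ, E).tangent p r (Y r : TT r)).2
    have hy : ∀ j, HasMFDerivAt 𝓘(ℝ, E).tangent 𝓘(ℝ, ℝ) (y j) q _ := fun j =>
      hasMFDerivAt_of_coord (F := fun z => bc j
        (coordField 𝓘(ℝ, E).tangent p (fun r => (Y r : TT r)) z).2) hq.1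
        (fun r hr => by rw [coordField_extChartAt hr])
        ((bc j ∘L ContinuousLinearMap.snd ℝ E E).hasFDerivAt.comp _ hYd.hasFDerivAt)
    have heq : ∀ j, DiffAt (fun r => (e j r : TT r)) q := fun j =>
      (contMDiffAt_of_smoothOn (he j) isOpen_slitSource hq).mdifferentiableAt (by simp)
    have hye : ∀ j ∈ Finset.univ, DiffAt (fun r => ((y j r • e j r : vertical r) : TT r)) q := by
      refine fun j _ => (diffAt_iff hq.1).2 (DifferentiableAt.congr_of_eventuallyEq
        (f := fun z => bc j (coordField 𝓘(ℝ, E).tangent p (fun r => (Y r : TT r)) z).2 •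
          ((0 : E), b j)) ?_ ?_)
      · exact (((bc j).differentiableAt.comp _ hYd.snd).smul_const _)
      · filter_upwards [eventually_mem_target hq.1] with z hz
        simp only [coordField, Submodule.coe_smul, map_smul, y]
        exact congrArg _ (coordVec_vliftV_ofCoord ((extChartAt _ p).map_target hz) (b j))
    have hYs : ∀ᶠ r in 𝓝 q, Y r = ∑ j, y j r • e j r := by
      filter_upwards [eventually_mem_source hq.1] with r hr
      apply Subtype.ext
      apply coordVec_injective hr
      have h1 : ∀ j, coordVec 𝓘(ℝ, E).tangent p r (e j r : TT r) = (0, b j) := fun j =>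
        coordVec_vliftV_ofCoord hr (b j)
      simp only [Submodule.coe_sum, Submodule.coe_smul, _root_.map_sum, map_smul, h1]
      refine Prod.ext ?_ ?_
      · rw [(mem_vertical_iff hr _).1 (Y r).2]
        simp [Prod.fst_sum]
      · rw [Prod.snd_sum]
        exact (b.sum_repr _).symm
    have h1 : N Y q ξ = ∑ j, (y j q • N (e j) q ξ + dfun (y j) q ξ • e j q) := by
      rw [hN.congr_of_eventuallyEq hq.2 hYs hY (diffAt_sum hye), hN.map_sum hq.2 hye,
        LinearMap.sum_apply]
      exact Finset.sum_congr rfl fun j _ =>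
        hN.leibniz (y j) (e j) q hq.2 (hy j).mdifferentiableAt (heq j) ξ
    have h2 : ∀ j, (coordVec 𝓘(ℝ, E).tangent p q (N (e j) q ξ : TT q)).2 =
        ∑ i, cc i (coordVec 𝓘(ℝ, E).tangent p q ξ) •
          A i j (extChartAt 𝓘(ℝ, E).tangent p q) := by
      intro j
      have hξ : ξ = ∑ i, cc i (coordVec 𝓘(ℝ, E).tangent p q ξ) • X i q := by
        apply coordVec_injective hq.1
        simp only [_root_.map_sum, map_smul, X, coordVec_coordInv hq.1]
        exact (c.sum_repr _).symm
      conv_lhs => rw [hξ]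
      simp only [_root_.map_sum, map_smul, Submodule.coe_sum, Submodule.coe_smul, Prod.snd_sum,
        Prod.smul_snd]
      refine Finset.sum_congr rfl fun i _ => ?_
      simp only [A]
      rw [coordField_extChartAt hq.1]
    rw [h1]
    simp only [Submodule.coe_sum, _root_.map_sum, Submodule.coe_add, map_add, Submodule.coe_smul,
      map_smul, Prod.snd_sum, Prod.snd_add, Prod.smul_snd, h2]
    rw [Finset.sum_add_distrib, add_comm]
    congr 1
    · have h3 : ∀ j, coordVec 𝓘(ℝ, E).tangent p q (e j q : TT q) = (0, b j) := fun j =>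
        coordVec_vliftV_ofCoord hq.1 (b j)
      simp only [dfun, (hy _).mfderiv, h3]
      exact b.sum_repr _
    · simp only [sum_apply, ContinuousLinearMap.smulRight_apply,
        smul_apply, Finset.smul_sum, y]
      rw [Finset.sum_comm]
      exact Finset.sum_congr rfl fun i _ => Finset.sum_congr rfl fun j _ => smul_comm _ _ _

end IsLinearConnection

end ConnectionCoordinates

section AdaptedConnections

variable {E : Type*} [NormedAddCommGroup E] [NormedSpace ℝ E]

/-! #### The curvature of an adapted connection in coordinates -/

theorem contDiffAt_fibreDeriv {f : E × E → E × E} {z : E × E} (hf : ContDiffAt ℝ ∞ f z) :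
    ContDiffAt ℝ ∞ (fibreDeriv f) z :=
  contDiffAt_const.clm_comp ((hf.fderiv_right (by simp)).clm_comp contDiffAt_const)

theorem contDiffAt_baseDeriv {f : E × E → E × E} {z : E × E} (hf : ContDiffAt ℝ ∞ f z) :
    ContDiffAt ℝ ∞ (baseDeriv f) z :=
  contDiffAt_const.clm_comp ((hf.fderiv_right (by simp)).clm_comp contDiffAt_const)

/-- The curvature of horizontal lifts of constant fields, for coefficients of a connection that
is adapted to a spray. -/
theorem curvature_of_christoffel {f : E × E → E × E} {Γ : E × E → (E × E) →L[ℝ] E →L[ℝ] E}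
    {z₀ : E × E} {u : E} (hf : ContDiffAt ℝ ∞ f z₀) (hΓ : DifferentiableAt ℝ Γ z₀)
    (hf1 : ∀ᶠ z in 𝓝 z₀, (f z).1 = z.2)
    (hf2 : ∀ᶠ z in 𝓝 z₀, fibreDeriv f z z.2 = (2 : ℝ) • (f z).2)
    (hL : ∀ᶠ z in 𝓝 z₀, ∀ a, Γ z a z.2 = -((1 / 2 : ℝ) • fibreDeriv f z a.1))
    (hT : ∀ᶠ z in 𝓝 z₀, ∀ u, Γ z (f z) u = -((1 / 2 : ℝ) • fibreDeriv f z u))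
    {X Y : E × E → E × E} (hX : ∀ᶠ z in 𝓝 z₀, X z = (z₀.2, (1 / 2 : ℝ) • fibreDeriv f z z₀.2))
    (hY : ∀ᶠ z in 𝓝 z₀, Y z = (u, (1 / 2 : ℝ) • fibreDeriv f z u)) :
    DifferentiableAt ℝ X z₀ ∧ DifferentiableAt ℝ Y z₀ ∧
    Γ z₀ (fderiv ℝ Y z₀ (X z₀) - fderiv ℝ X z₀ (Y z₀)) z₀.2 -
      (fderiv ℝ (fun z => Γ z (Y z) z₀.2) z₀ (X z₀) + Γ z₀ (X z₀) (Γ z₀ (Y z₀) z₀.2) -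
      (fderiv ℝ (fun z => Γ z (X z) z₀.2) z₀ (Y z₀) + Γ z₀ (Y z₀) (Γ z₀ (X z₀) z₀.2))) =
    (1 / 2 : ℝ) • fderiv ℝ (fibreDeriv f) z₀ (f z₀) u - baseDeriv f z₀ u -
      (1 / 4 : ℝ) • fibreDeriv f z₀ (fibreDeriv f z₀ u) := by
  have hfd := (hf.differentiableAt (by simp)).hasFDerivAt
  have hGd := ((contDiffAt_fibreDeriv hf).differentiableAt (by simp)).hasFDerivAt
  have hΓd := hΓ.hasFDerivAt
  set G := fibreDeriv f with hG
  set G' := fderiv ℝ G z₀ with hG'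
  set f' := fderiv ℝ f z₀ with hf'
  set Γ' := fderiv ℝ Γ z₀ with hΓ'
  have hsnd : HasFDerivAt (fun z : E × E => z.2) (ContinuousLinearMap.snd ℝ E E) z₀ :=
    (ContinuousLinearMap.snd ℝ E E).hasFDerivAt
  have lift : ∀ (v : E) (W : E × E → E × E), (∀ᶠ z in 𝓝 z₀, W z = (v, (1 / 2 : ℝ) • G z v)) →
      ∃ W' : (E × E) →L[ℝ] E × E, HasFDerivAt W W' z₀ ∧
        ∀ a, W' a = (0, (1 / 2 : ℝ) • G' a v) := by
    intro v W hW
    refine ⟨_, HasFDerivAt.congr_of_eventuallyEq ((hasFDerivAt_const v z₀).prodMk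
      ((hGd.clm_apply (hasFDerivAt_const v z₀)).const_smul (1 / 2 : ℝ))) hW, fun a => ?_⟩
    simp
  obtain ⟨X', hX', hXa⟩ := lift _ X hX
  obtain ⟨Y', hY', hYa⟩ := lift _ Y hY
  refine ⟨hX'.differentiableAt, hY'.differentiableAt, ?_⟩
  have hX0 : X z₀ = f z₀ := by
    rw [hX.self_of_nhds, hf2.self_of_nhds]
    exact Prod.ext hf1.self_of_nhds.symm (by simp)
  have hY0 := hY.self_of_nhds
  -- the derivative of `f.1 = z.2`
  have e1 : ∀ a, (f' a).1 = a.2 := fun a =>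
    congrArg (fun T : (E × E) →L[ℝ] E => T a)
      ((hfd.fst : HasFDerivAt (fun z => (f z).1) _ z₀).unique (hsnd.congr_of_eventuallyEq hf1))
  -- the derivative of the homogeneity relation
  have e2 : ∀ a, G' a z₀.2 + G z₀ a.2 = (2 : ℝ) • (f' a).2 := by
    intro a
    have h1 : HasFDerivAt (fun z => G z z.2) _ z₀ := hGd.clm_apply hsnd
    have h2 : HasFDerivAt (fun z => (2 : ℝ) • (f z).2) _ z₀ := hfd.snd.const_smul (2 : ℝ)
    have := congrArg (fun T : (E × E) →L[ℝ] E => T a)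
      (h1.unique (h2.congr_of_eventuallyEq hf2))
    simpa [add_comm] using this
  -- the derivative of the relation given by L
  have e3 : ∀ a, Γ' a (Y z₀) z₀.2 + Γ z₀ (Y' a) z₀.2 + Γ z₀ (Y z₀) a.2 =
      -((1 / 2 : ℝ) • G' a u) := by
    intro a
    have h1 : HasFDerivAt (fun z => Γ z (Y z) z.2) _ z₀ := (hΓd.clm_apply hY').clm_apply hsnd
    have h2 : HasFDerivAt (fun z => -((1 / 2 : ℝ) • G z u)) _ z₀ :=
      ((hGd.clm_apply (hasFDerivAt_const u z₀)).const_smul (1 / 2 : ℝ)).neg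
    have h3 : (fun z => Γ z (Y z) z.2) =ᶠ[𝓝 z₀] fun z => -((1 / 2 : ℝ) • G z u) := by
      filter_upwards [hL, hY] with z hz hz'
      rw [hz, hz']
    have := congrArg (fun T : (E × E) →L[ℝ] E => T a) (h1.unique (h2.congr_of_eventuallyEq h3))
    simp only [add_apply, ContinuousLinearMap.comp_apply, ContinuousLinearMap.flip_apply, zero_apply, neg_apply,
      smul_apply, map_zero, zero_add, ContinuousLinearMap.coe_snd'] at this
    rw [← this]; abel
  -- the derivative of the relation given by T
  have e4 : ∀ a, Γ' a (X z₀) z₀.2 + Γ z₀ (f' a) z₀.2 = -((1 / 2 : ℝ) • G' a z₀.2) := by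
    intro a
    have h1 : HasFDerivAt (fun z => Γ z (f z) z₀.2) _ z₀ :=
      (hΓd.clm_apply hfd).clm_apply (hasFDerivAt_const z₀.2 z₀)
    have h2 : HasFDerivAt (fun z => -((1 / 2 : ℝ) • G z z₀.2)) _ z₀ :=
      ((hGd.clm_apply (hasFDerivAt_const z₀.2 z₀)).const_smul (1 / 2 : ℝ)).neg
    have := congrArg (fun T : (E × E) →L[ℝ] E => T a)
      (h1.unique (h2.congr_of_eventuallyEq (hT.mono fun z hz => hz _)))
    rw [hX0]
    simp only [add_apply, ContinuousLinearMap.comp_apply, ContinuousLinearMap.flip_apply, zero_apply, neg_apply,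
      smul_apply, map_zero, zero_add] at this
    rw [← this]; abel
  have e5 : ∀ (W : E × E → E × E) (W' : (E × E) →L[ℝ] E × E), HasFDerivAt W W' z₀ → ∀ a,
      fderiv ℝ (fun z => Γ z (W z) z₀.2) z₀ a = Γ' a (W z₀) z₀.2 + Γ z₀ (W' a) z₀.2 := by
    intro W W' hW a
    have h1 : HasFDerivAt (fun z => Γ z (W z) z₀.2) _ z₀ :=
      (hΓd.clm_apply hW).clm_apply (hasFDerivAt_const z₀.2 z₀)
    rw [h1.fderiv]
    simp only [add_apply, ContinuousLinearMap.comp_apply, ContinuousLinearMap.flip_apply, zero_apply,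
      map_zero, zero_add]
    exact add_comm _ _
  have hL0 := hL.self_of_nhds
  have hT0 := hT.self_of_nhds
  have e6 : (f' (Y z₀)).2 = baseDeriv f z₀ u + (1 / 2 : ℝ) • G z₀ (G z₀ u) := by
    -- Splitting `u^𝔥` into base and fibre directions brings in `∂_x g`.
    have h : Y z₀ = (u, 0) + (0, (1 / 2 : ℝ) • G z₀ u) := by rw [hY0]; simp
    rw [h, map_add, Prod.snd_add, ← map_smul (G z₀) (1 / 2 : ℝ) (G z₀ u)]
    rfl
  have hX1 : (X z₀).1 = z₀.2 := by rw [hX.self_of_nhds]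
  have hY1 : (Y z₀).1 = u := by rw [hY0]
  have hY2 : (Y z₀).2 = (1 / 2 : ℝ) • G z₀ u := by rw [hY0]
  have hGz := hf2.self_of_nhds
  have i3 := e3 (X z₀)
  have i4 := e4 (Y z₀)
  have i2 := e2 (Y z₀)
  rw [e6, hY2, map_smul] at i2
  rw [hL0, hYa] at i3
  rw [hL0, e1, hY2, map_smul] at i4
  simp only [map_zero, smul_zero, neg_zero, add_zero] at i3
  rw [e5 Y Y' hY', e5 X X' hX', hX'.fderiv, hY'.fderiv]
  simp only [hL0, hXa, hYa, Prod.fst_sub, hX1, hY1, sub_zero, map_zero, smul_zero, neg_zero,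
    add_zero, zero_sub]
  have i5 : Γ z₀ (X z₀) (-((1 / 2 : ℝ) • G z₀ u)) = (1 / 4 : ℝ) • G z₀ (G z₀ u) := by
    rw [hX0, hT0, map_neg, map_smul]; module
  -- `Γ(u^𝔥) g` is not determined by **L** and **T**. It arises here from `Γ(Y) Γ(X) y`, and once
  -- more in the derivative of **L**, where the argument `y` varies along `X`; the two occurrences
  -- cancel. The bracket of the lifts contributes nothing, being vertical.
  have i6 : Γ z₀ (Y z₀) (-((1 / 2 : ℝ) • G z₀ z₀.2)) = - Γ z₀ (Y z₀) (X z₀).2 := by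
    rw [hGz, hX0, ← map_neg]; congr 1; module
  rw [i5, i6, eq_sub_of_add_eq i3, eq_sub_of_add_eq i4, eq_sub_of_add_eq i2, hX0]
  module

variable {M : Type*} [TopologicalSpace M] [ChartedSpace E M] [IsManifold 𝓘(ℝ, E) ∞ M]
  {S : ∀ p : TM E M, TT p} {N : VConn E M} {p q : TM E M}

theorem eventually_mem_slitSource (hq : q ∈ slitSource p) {R : E × E → Prop}
    (h : ∀ r ∈ slitSource p, R (extChartAt 𝓘(ℝ, E).tangent p r)) :
    ∀ᶠ z in 𝓝 (extChartAt 𝓘(ℝ, E).tangent p q), R z :=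
  eventually_chart hq.1 hq.2 fun r hr hr0 => h r ⟨hr, hr0⟩

/-- The coefficients of an adapted connection. -/
theorem IsAdapted.exists_christoffel [FiniteDimensional ℝ E] (hS : IsSpray S)
    (hN : IsAdapted S N) (p : TM E M) :
    ∃ Γ : E × E → (E × E) →L[ℝ] E →L[ℝ] E, ∀ q ∈ slitSource p,
      ContDiffAt ℝ ∞ Γ (extChartAt 𝓘(ℝ, E).tangent p q) ∧
      (∀ Y : ∀ p : TM E M, vertical p, DiffAt (fun r => (Y r : TT r)) q → ∀ ξ : TT q,
        (coordVec 𝓘(ℝ, E).tangent p q (N Y q ξ : TT q)).2 =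
          (fderiv ℝ (coordField 𝓘(ℝ, E).tangent p (fun r => (Y r : TT r)))
            (extChartAt 𝓘(ℝ, E).tangent p q) (coordVec 𝓘(ℝ, E).tangent p q ξ)).2 +
          Γ (extChartAt 𝓘(ℝ, E).tangent p q) (coordVec 𝓘(ℝ, E).tangent p q ξ)
            (coordVec 𝓘(ℝ, E).tangent p q (Y q : TT q)).2) ∧
      (∀ a, Γ (extChartAt 𝓘(ℝ, E).tangent p q) a (extChartAt 𝓘(ℝ, E).tangent p q).2 =
        -((1 / 2 : ℝ) • fibreDeriv (coordField 𝓘(ℝ, E).tangent p S)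
          (extChartAt 𝓘(ℝ, E).tangent p q) a.1)) ∧
      ∀ u, Γ (extChartAt 𝓘(ℝ, E).tangent p q)
        (coordField 𝓘(ℝ, E).tangent p S (extChartAt 𝓘(ℝ, E).tangent p q)) u =
        -((1 / 2 : ℝ) • fibreDeriv (coordField 𝓘(ℝ, E).tangent p S)
          (extChartAt 𝓘(ℝ, E).tangent p q) u) := by
  have : CompleteSpace E := FiniteDimensional.complete ℝ E
  obtain ⟨Γ, hΓ⟩ := hN.isLinearConnection.exists_christoffel p
  refine ⟨Γ, fun q hq => ?_⟩
  obtain ⟨hΓs, hΓq⟩ := hΓ q hq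
  have hL : ∀ a, Γ (extChartAt 𝓘(ℝ, E).tangent p q) a (extChartAt 𝓘(ℝ, E).tangent p q).2 =
        -((1 / 2 : ℝ) • fibreDeriv (coordField 𝓘(ℝ, E).tangent p S)
          (extChartAt 𝓘(ℝ, E).tangent p q) a.1) := by
    intro a
    have hC : HasFDerivAt (coordField 𝓘(ℝ, E).tangent p (fun q => (canonicalField q : TT q))) _
        (extChartAt 𝓘(ℝ, E).tangent p q) :=
      (ContinuousLinearMap.inr ℝ E E ∘L
        ContinuousLinearMap.snd ℝ E E).hasFDerivAt.congr_of_eventuallyEq (by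
          filter_upwards [eventually_mem_target hq.1] with z hz
          rw [coordField_canonicalField hz]; rfl)
    -- In coordinates **L** compares `b + Γ(a, b) y` with `b - ½ G a`.
    have h := hΓq canonicalField ((diffAt_iff hq.1).2 hC.differentiableAt)
      (coordInv 𝓘(ℝ, E).tangent p q a)
    rw [hN.conditionL q hq.2, hS.coordVec_projVertical hq.1 hq.2, coordVec_coordInv hq.1,
      hC.fderiv, coordVec_canonicalField hq.1, sub_eq_add_neg] at h
    exact (add_left_cancel h).symm
  refine ⟨hΓs, hΓq, hL, fun u => ?_⟩
  -- Condition **T** is tested on a constant base field. Then `𝒥(X) = (0, u)` is constant, `[S, X]`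
  -- is vertical, and what remains is `Γ(S) u = Γ(X) y`, whose right side is given by **L**.
  let X : ∀ r : TM E M, TT r := fun r => coordInv 𝓘(ℝ, E).tangent p r (u, 0)
  have hXc : ∀ r ∈ (extChartAt 𝓘(ℝ, E).tangent p).source,
      coordVec 𝓘(ℝ, E).tangent p r (X r) = (u, 0) := fun r hr => coordVec_coordInv hr _
  have hX : SmoothOn X (slitSource p) := smoothOn_of_coord inter_subset_left hXc
  have hXd : HasFDerivAt (coordField 𝓘(ℝ, E).tangent p X) 0 (extChartAt 𝓘(ℝ, E).tangent p q) :=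
    (hasFDerivAt_const (𝕜 := ℝ) (u, (0 : E)) _).congr_of_eventuallyEq
      (coordField_eventuallyEq_of_coordVec (F := fun _ => (u, 0)) hq.1 hXc)
  have hJX : HasFDerivAt (coordField 𝓘(ℝ, E).tangent p (fun q => (almostTangent q (X q) : TT q))) 0
      (extChartAt 𝓘(ℝ, E).tangent p q) :=
    (hasFDerivAt_const (𝕜 := ℝ) ((0 : E), u) _).congr_of_eventuallyEq
      (coordField_eventuallyEq_of_coordVec (F := fun _ => (0, u)) hq.1 fun r hr => by
        rw [coordVec_almostTangent hr, hXc r hr])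
  have hJS : HasFDerivAt (coordField 𝓘(ℝ, E).tangent p (fun q => (almostTangent q (S q) : TT q)))
      (ContinuousLinearMap.inr ℝ E E ∘L ContinuousLinearMap.snd ℝ E E)
      (extChartAt 𝓘(ℝ, E).tangent p q) := by
    refine (ContinuousLinearMap.inr ℝ E E ∘L
      ContinuousLinearMap.snd ℝ E E).hasFDerivAt.congr_of_eventuallyEq ?_
    filter_upwards [eventually_mem_target hq.1, hS.eventually_coordField_fst hq.1 hq.2] with z hz hz'
    rw [coordField_almostTangent hz, hz']
    rfl
  have h := congrArg (fun ξ : vertical q => (coordVec 𝓘(ℝ, E).tangent p q (ξ : TT q)).2)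
    (hN.conditionT (slitSource p) X isOpen_slitSource inter_subset_right hX q hq)
  rw [torsion] at h
  simp only [Submodule.coe_sub, map_sub, Prod.snd_sub, Submodule.coe_zero, map_zero,
    Prod.snd_zero] at h
  rw [hΓq _ ((diffAt_iff hq.1).2 hJX.differentiableAt),
    hΓq _ ((diffAt_iff hq.1).2 hJS.differentiableAt), coordVec_almostTangent hq.1,
    coordVec_almostTangent hq.1, coordVec_almostTangent hq.1, hXc q hq.1, hS.coordVec_fst hq.1 hq.2,
    bracket, coordVec_mlieBracket hq.1 (hS.mdifferentiableAt hq.2)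
      ((diffAt_iff hq.1).2 hXd.differentiableAt), hXd.fderiv, hJX.fderiv, hJS.fderiv,
    hXc q hq.1, hL, hS.fderiv_coordField hq.1 hq.2, ← coordField_extChartAt hq.1] at h
  simp only [zero_apply, ContinuousLinearMap.comp_apply, ContinuousLinearMap.coe_snd', map_zero,
    Prod.snd_zero, zero_add, Prod.fst_sub, Prod.fst_zero, sub_zero] at h
  exact sub_eq_zero.1 h

end AdaptedConnections

/-! ### Curvature and covariant derivative in terms of the spray -/

section Invariants

variable {E : Type*} [NormedAddCommGroup E] [NormedSpace ℝ E]
  {M : Type*} [TopologicalSpace M] [ChartedSpace E M] [IsManifold 𝓘(ℝ, E) ∞ M]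
  {S : ∀ p : TM E M, TT p} {N : VConn E M} {p q w : TM E M}

/-- The coefficient `½ (∂_y g)' - ∂_x g - ¼ (∂_y g)²` of the Jacobi equation of a spray with
coordinate expression `(y, g)`. -/
noncomputable def sprayCurvature (f : E × E → E × E) (z : E × E) (u : E) : E :=
  (1 / 2 : ℝ) • fderiv ℝ (fibreDeriv f) z (f z) u - baseDeriv f z u -
    (1 / 4 : ℝ) • fibreDeriv f z (fibreDeriv f z u)

theorem coordVec_extend {x : M} (hx : x ∈ (extChartAt 𝓘(ℝ, E) w.1).source)
    (u : T (E := E) w.1) : coordVec 𝓘(ℝ, E) w.1 x (FiberBundle.extend E u x) = u := by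
  refine (coordVec_ofCoord hx _).trans ?_
  rw [trivializationAt_snd_eq_coordVec (mem_extChartAt_source w.1), coordVec_self]
  rfl

theorem vliftInv_eq_snd {ξ : TT w} (hξ : ξ ∈ vertical w) :
    (vliftInv w ξ : E) = (coordVec 𝓘(ℝ, E).tangent w w ξ).2 := by
  rw [← coordVec_vliftInv (mem_extChartAt_source w) hξ, coordVec_self]
  rfl

theorem extChartAt_self_snd : (extChartAt 𝓘(ℝ, E).tangent w w).2 = (w.2 : E) := by
  rw [extChartAt_tangent_snd (mem_extChartAt_source w), coordVec_self]
  rfl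

theorem mem_slitSource_self (hw : w ∈ slit E M) : w ∈ slitSource w :=
  ⟨mem_extChartAt_source w, hw⟩

/-- The curvature endomorphism of an adapted connection is determined by the spray. -/
theorem IsAdapted.curvatureEndomorphism_eq [FiniteDimensional ℝ E] (hS : IsSpray S)
    (hN : IsAdapted S N) (hw : w ∈ slit E M) (u : T (E := E) w.1) :
    (curvatureEndomorphism S N w u : E) = sprayCurvature (coordField 𝓘(ℝ, E).tangent w S)
      (extChartAt 𝓘(ℝ, E).tangent w w) u := by
  have : CompleteSpace E := FiniteDimensional.complete ℝ E
  obtain ⟨Γ, hΓ⟩ := hN.exists_christoffel hS w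
  have hws := mem_slitSource_self hw
  obtain ⟨hΓs, hΓw, -, -⟩ := hΓ w hws
  have hΓd := hΓs.differentiableAt (by simp)
  let X : T (E := E) w.1 → ∀ r : TM E M, TT r := fun u r => hlift S r (FiberBundle.extend E u r.1)
  let Z : ∀ r : TM E M, vertical r := fun r => vliftV r (FiberBundle.extend E w.2 r.1)
  have hXc : ∀ u, ∀ᶠ z in 𝓝 (extChartAt 𝓘(ℝ, E).tangent w w),
      coordField 𝓘(ℝ, E).tangent w (X u) z =
        ((u : E), (1 / 2 : ℝ) • fibreDeriv (coordField 𝓘(ℝ, E).tangent w S) z u) := fun u =>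
    eventually_mem_slitSource hws fun r hr => by
      rw [coordField_extChartAt hr.1]
      refine (hS.coordVec_hlift hr.1 hr.2 _).trans ?_
      rw [coordVec_extend (mem_source_tangent_iff.1 hr.1)]
      rfl
  have hZc : ∀ r ∈ (extChartAt 𝓘(ℝ, E).tangent w).source,
      coordVec 𝓘(ℝ, E).tangent w r (Z r : TT r) = (0, (w.2 : E)) := fun r hr => by
    refine (coordVec_vlift hr _).trans ?_
    rw [coordVec_extend (mem_source_tangent_iff.1 hr)]
    rfl
  have hZd : ∀ r ∈ (extChartAt 𝓘(ℝ, E).tangent w).source,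
      HasFDerivAt (coordField 𝓘(ℝ, E).tangent w (fun r => (Z r : TT r))) 0
        (extChartAt 𝓘(ℝ, E).tangent w r) := fun r hr =>
    (hasFDerivAt_const (𝕜 := ℝ) ((0 : E), (w.2 : E)) _).congr_of_eventuallyEq
      (coordField_eventuallyEq_of_coordVec (F := fun _ => (0, (w.2 : E))) hr hZc)
  -- The field `Z` has constant coordinates in this chart, so its covariant derivatives consist of
  -- the Christoffel term alone, on a whole neighbourhood of `w`.
  have hNZ : ∀ (u : T (E := E) w.1), (fun z => Γ z (coordField 𝓘(ℝ, E).tangent w (X u) z) w.2) =ᶠ[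
      𝓝 (extChartAt 𝓘(ℝ, E).tangent w w)] fun z =>
      (coordField 𝓘(ℝ, E).tangent w (fun r => (N Z r (X u r) : TT r)) z).2 := fun u =>
    eventually_mem_slitSource (R := fun z => Γ z (coordField 𝓘(ℝ, E).tangent w (X u) z) w.2 =
      (coordField 𝓘(ℝ, E).tangent w (fun r => (N Z r (X u r) : TT r)) z).2) hws fun r hr => by
      rw [coordField_extChartAt hr.1, coordField_extChartAt hr.1,
        (hΓ r hr).2.1 _ ((diffAt_iff hr.1).2 (hZd r hr.1).differentiableAt), (hZd r hr.1).fderiv,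
        hZc r hr.1]
      simp
  have hNZ' : ∀ (u : T (E := E) w.1), coordField 𝓘(ℝ, E).tangent w
      (fun r => (N Z r (X u r) : TT r)) =ᶠ[𝓝 (extChartAt 𝓘(ℝ, E).tangent w w)]
      fun z => (0, Γ z (coordField 𝓘(ℝ, E).tangent w (X u) z) w.2) := fun u => by
    filter_upwards [hNZ u, eventually_mem_target hws.1] with z hz hz'
    refine Prod.ext ?_ hz.symm
    exact (mem_vertical_iff ((extChartAt _ w).map_target hz') _).1 (N Z _ (X u _)).2
  obtain ⟨hXd, hYd, hcalc⟩ := curvature_of_christoffel (z₀ := extChartAt 𝓘(ℝ, E).tangent w w)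
    (f := coordField 𝓘(ℝ, E).tangent w S) (Γ := Γ) (u := u)
    (X := coordField 𝓘(ℝ, E).tangent w (X w.2)) (Y := coordField 𝓘(ℝ, E).tangent w (X u))
    (hS.contDiffAt_coordField hws.1 hws.2) hΓd (hS.eventually_coordField_fst hws.1 hws.2)
    (eventually_mem_slitSource hws fun r hr => by
      rw [hS.fibreDeriv_apply_snd hr.1 hr.2, coordField_extChartAt hr.1])
    (eventually_mem_slitSource hws fun r hr => (hΓ r hr).2.2.1)
    (eventually_mem_slitSource hws fun r hr => (hΓ r hr).2.2.2)
    (by simp only [extChartAt_self_snd]; exact hXc w.2) (hXc u)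
  rw [extChartAt_self_snd] at hcalc
  refine Eq.trans ?_ hcalc
  have hd : ∀ (u : T (E := E) w.1), DifferentiableAt ℝ (coordField 𝓘(ℝ, E).tangent w (X u))
      (extChartAt 𝓘(ℝ, E).tangent w w) →
      DifferentiableAt ℝ (fun z => Γ z (coordField 𝓘(ℝ, E).tangent w (X u) z) w.2)
        (extChartAt 𝓘(ℝ, E).tangent w w) := fun u hu =>
    (hΓd.clm_apply hu).clm_apply (differentiableAt_const _)
  have hf : ∀ (u : T (E := E) w.1), DifferentiableAt ℝ (coordField 𝓘(ℝ, E).tangent w (X u))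
      (extChartAt 𝓘(ℝ, E).tangent w w) → HasFDerivAt (coordField 𝓘(ℝ, E).tangent w
      (fun r => (N Z r (X u r) : TT r))) (ContinuousLinearMap.prod 0
        (fderiv ℝ (fun z => Γ z (coordField 𝓘(ℝ, E).tangent w (X u) z) w.2)
        (extChartAt 𝓘(ℝ, E).tangent w w))) (extChartAt 𝓘(ℝ, E).tangent w w) := fun u hu =>
    ((hasFDerivAt_const (0 : E) _).prodMk (hd u hu).hasFDerivAt).congr_of_eventuallyEq (hNZ' u)
  refine (vliftInv_eq_snd (curvature N (X w.2) (X u) Z w).2).trans ?_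
  have hval : ∀ u : T (E := E) w.1, (coordVec 𝓘(ℝ, E).tangent w w (N Z w (X u w) : TT w)).2 =
      Γ (extChartAt 𝓘(ℝ, E).tangent w w) (coordField 𝓘(ℝ, E).tangent w (X u)
        (extChartAt 𝓘(ℝ, E).tangent w w)) w.2 := fun u => by
    refine Eq.trans ?_ (hNZ u).self_of_nhds.symm
    exact congrArg Prod.snd (coordField_extChartAt hws.1 (fun r => (N Z r (X u r) : TT r))).symm
  simp only [curvature, Submodule.coe_sub, map_sub, Prod.snd_sub]
  rw [hΓw Z ((diffAt_iff hws.1).2 (hZd w hws.1).differentiableAt),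
    hΓw _ ((diffAt_iff hws.1).2 (hf u hYd).differentiableAt),
    hΓw _ ((diffAt_iff hws.1).2 (hf w.2 hXd).differentiableAt),
    (hf u hYd).fderiv, (hf w.2 hXd).fderiv, (hZd w hws.1).fderiv, hZc w hws.1, hval, hval, bracket,
    coordVec_mlieBracket hws.1 ((diffAt_iff hws.1).2 hXd) ((diffAt_iff hws.1).2 hYd),
    coordField_extChartAt hws.1, coordField_extChartAt hws.1]
  simp only [zero_apply, Prod.snd_zero, ContinuousLinearMap.prod_apply, zero_add]
  rw [map_sub]

/-- The curve moves in the direction of `S` at time `t`, so only `Γ(S)` enters, and **T** determines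
it. -/
theorem IsAdapted.covDerivAlong_eq [FiniteDimensional ℝ E] (hS : IsSpray S)
    (hN : IsAdapted S N) {c : ℝ → TM E M} {t : ℝ} (hc : c t ∈ slit E M)
    (hv : mfderiv 𝓘(ℝ, ℝ) 𝓘(ℝ, E).tangent c t (1 : ℝ) = S (c t))
    (V : ∀ s, T (E := E) (c s).1) :
    (vliftInv (c t) (covDerivAlong N c (fun s => vliftV (c s) (V s)) t : TT (c t)) : E) =
      deriv (fun s => (trivializationAt E (TangentSpace 𝓘(ℝ, E) : M → Type _) (c t).1
        ⟨(c s).1, V s⟩).2) t - (1 / 2 : ℝ) • fibreDeriv (coordField 𝓘(ℝ, E).tangent (c t) S)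
        (extChartAt 𝓘(ℝ, E).tangent (c t) (c t)) (V t) := by
  obtain ⟨Γ, hΓ⟩ := hN.exists_christoffel hS (c t)
  have hws := mem_slitSource_self hc
  obtain ⟨-, hΓw, -, hT⟩ := hΓ _ hws
  have hζ : ∀ s, (vliftInv (c s) (vliftV (c s) (V s) : TT (c s))) = V s := fun s =>
    vliftInv_vlift (V s)
  have key : ∀ v : E, (trivializationAt E (TangentSpace 𝓘(ℝ, E) : M → Type _) (c t).1
        ⟨(c t).1, V t⟩).2 = v →
      (vliftInv (c t) (covDerivAlong N c (fun s => vliftV (c s) (V s)) t : TT (c t)) : E) =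
        deriv (fun s => (trivializationAt E (TangentSpace 𝓘(ℝ, E) : M → Type _) (c t).1
          ⟨(c s).1, V s⟩).2) t - (1 / 2 : ℝ) • fibreDeriv (coordField 𝓘(ℝ, E).tangent (c t) S)
          (extChartAt 𝓘(ℝ, E).tangent (c t) (c t)) v := by
    intro v hv'
    have hed : HasFDerivAt (coordField 𝓘(ℝ, E).tangent (c t)
        (fun r => (vliftV r (ofCoord (c t).1 v r.1) : TT r))) 0
          (extChartAt 𝓘(ℝ, E).tangent (c t) (c t)) :=
      (hasFDerivAt_const (𝕜 := ℝ) ((0 : E), v) _).congr_of_eventuallyEq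
        (coordField_eventuallyEq_of_coordVec (F := fun _ => (0, v)) hws.1
          fun r hr => coordVec_vliftV_ofCoord hr v)
    rw [vliftInv_eq_snd (Subtype.prop _)]
    simp only [covDerivAlong, hζ, Submodule.coe_add, map_add, Prod.snd_add, hv, hv']
    rw [coordVec_vliftV_ofCoord hws.1, hΓw _ ((diffAt_iff hws.1).2 hed.differentiableAt),
      hed.fderiv, coordVec_vliftV_ofCoord hws.1, ← coordField_extChartAt hws.1, hT,
      sub_eq_add_neg]
    congr 1
    exact zero_add _
  refine key _ ?_
  rw [trivializationAt_snd_eq_coordVec (mem_extChartAt_source _), coordVec_self]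
  rfl

/-- The velocity of a horizontal lift through the velocity of the curve is the spray. -/
theorem IsHorizontalLiftAt.mfderiv_eq [CompleteSpace E] (hS : IsSpray S) {γ : ℝ → M} {t : ℝ}
    {c : ℝ → TM E M} (hc : IsHorizontalLiftAt S γ t c) (hct : c t = velocity (E := E) γ t)
    (hγ : velocity (E := E) γ t ∈ slit E M) :
    mfderiv 𝓘(ℝ, ℝ) 𝓘(ℝ, E).tangent c t (1 : ℝ) = S (c t) := by
  refine hS.eq_of_isHorizontal (hct ▸ hγ) hc.horizontal.self_of_nhds ?_
  have h1 : HasMFDerivAt 𝓘(ℝ, E).tangent 𝓘(ℝ, E) (fun q : TM E M => q.1) (c t) (dproj (c t)) :=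
    ((contMDiff_proj (n := 1) (TangentSpace 𝓘(ℝ, E) : M → Type _)).mdifferentiableAt
      one_ne_zero).hasMFDerivAt
  have h2 := HasMFDerivAt.comp t h1 (hc.smooth.mdifferentiableAt (by simp)).hasMFDerivAt
  have h3 := h2.congr_of_eventuallyEq (f₁ := γ) (hc.isLift.mono fun s hs => hs.symm)
  have h4 : (dproj (c t) (mfderiv 𝓘(ℝ, ℝ) 𝓘(ℝ, E).tangent c t (1 : ℝ)) : E) =
      (velocity (E := E) γ t).2 :=
    (congrArg (fun T : ℝ →L[ℝ] E => T 1) h3.mfderiv).symm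
  exact h4.trans (congrArg (fun r : TM E M => (r.2 : E)) hct.symm)

/-- The value of the covariant derivative that is determined by the spray. -/
theorem IsAdapted.covDerivCurve_eq [FiniteDimensional ℝ E] (hS : IsSpray S)
    (hN : IsAdapted S N) {γ : ℝ → M} {t : ℝ} (hγ : velocity (E := E) γ t ∈ slit E M)
    (V : ∀ s, T (E := E) (γ s))
    (h : ∃ c : ℝ → TM E M, c t = velocity (E := E) γ t ∧ IsHorizontalLiftAt S γ t c) :
    (covDerivCurve S N γ V t : E) =
      deriv (fun s => (trivializationAt E (TangentSpace 𝓘(ℝ, E) : M → Type _) (γ t)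
        ⟨γ s, V s⟩).2) t -
      (1 / 2 : ℝ) • fibreDeriv (coordField 𝓘(ℝ, E).tangent (velocity (E := E) γ t) S)
        (extChartAt 𝓘(ℝ, E).tangent (velocity (E := E) γ t) (velocity (E := E) γ t)) (V t) := by
  have : CompleteSpace E := FiniteDimensional.complete ℝ E
  -- The chosen lift is unknown, but every horizontal lift through the velocity has derivative `S`
  -- at time `t`, so the choice does not affect the value.
  have hspec := h.choose_spec
  set c := h.choose
  have hct : c t = velocity (E := E) γ t := hspec.1
  have h1 := hN.covDerivAlong_eq hS (c := c) (hct ▸ hγ) (hspec.2.mfderiv_eq hS hct hγ) V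
  have h2 : (covDerivCurve S N γ V t : E) =
      vliftInv (c t) (covDerivAlong N c (fun s => vliftV (c s) (V s)) t : TT (c t)) := by
    have : covDerivCurve S N γ V t = vliftInv (velocity (E := E) γ t)
        (covDerivAlong N c (fun s => vliftV (c s) (V s)) t : TT (c t)) := dif_pos h
    rw [this]
    exact congrArg (fun r : TM E M => (vliftInv r
      (covDerivAlong N c (fun s => vliftV (c s) (V s)) t : TT (c t)) : E)) hct.symm
  rw [h2, h1]
  congr 1
  · refine Filter.EventuallyEq.deriv_eq ?_
    filter_upwards [hspec.2.isLift] with s hs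
    rw [hct]
    exact congrArg (fun x : M => (trivializationAt E (TangentSpace 𝓘(ℝ, E) : M → Type _) (γ t)
        ⟨x, (V s : E)⟩).2) hs
  · rw [hct]

/-- The existence of a horizontal lift does not involve the connection. If there is none, both sides
take the default value `0`, so no existence theorem for lifts is required. -/
theorem IsAdapted.covDerivCurve_eq_covDerivCurve [FiniteDimensional ℝ E] (hS : IsSpray S)
    {N' : VConn E M} (hN : IsAdapted S N) (hN' : IsAdapted S N') {γ : ℝ → M} {t : ℝ}
    (hγ : velocity (E := E) γ t ∈ slit E M) (V : ∀ s, T (E := E) (γ s)) :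
    covDerivCurve S N γ V t = covDerivCurve S N' γ V t := by
  by_cases h : ∃ c : ℝ → TM E M, c t = velocity (E := E) γ t ∧ IsHorizontalLiftAt S γ t c
  · exact (hN.covDerivCurve_eq hS hγ V h).trans (hN'.covDerivCurve_eq hS hγ V h).symm
  · have h0 : ∀ N : VConn E M, covDerivCurve S N γ V t = 0 := fun N => dif_neg h
    rw [h0, h0]

theorem hasDerivAt_coord_velocity {γ : ℝ → M} {s : ℝ} {x : M}
    (hγ : MDifferentiableAt 𝓘(ℝ, ℝ) 𝓘(ℝ, E) γ s) (hx : γ s ∈ (extChartAt 𝓘(ℝ, E) x).source) :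
    HasDerivAt (fun s => extChartAt 𝓘(ℝ, E) x (γ s))
      (coordVec 𝓘(ℝ, E) x (γ s) (velocity (E := E) γ s).2) s := by
  refine hasDerivAt_coord_comp hx (hγ.hasMFDerivAt.congr_mfderiv ?_)
  ext
  exact (one_smul ℝ _).symm

/-- In the chart of `TM` at the velocity, the velocity curve is `(x, ẋ)` with `x` the coordinate
expression of `γ`. -/
theorem contMDiffAt_velocity {γ : ℝ → M} {t : ℝ} (hγ : ContMDiffAt 𝓘(ℝ, ℝ) 𝓘(ℝ, E) ∞ γ t) :
    ContMDiffAt 𝓘(ℝ, ℝ) 𝓘(ℝ, E).tangent ∞ (velocity (E := E) γ) t := by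
  have hx : ContDiffAt ℝ ∞ (fun s => extChartAt 𝓘(ℝ, E) (γ t) (γ s)) t :=
    (contMDiffAt_extChartAt.comp t hγ).contDiffAt
  have hd : ContDiffAt ℝ ∞ (deriv fun s => extChartAt 𝓘(ℝ, E) (γ t) (γ s)) t :=
    (hx.fderiv_right (m := ∞) (by simp)).clm_apply contDiffAt_const
  have hev : ∀ᶠ s in 𝓝 t, velocity (E := E) γ s ∈ (extChartAt 𝓘(ℝ, E).tangent (velocity (E := E) γ t)).source ∧
      extChartAt 𝓘(ℝ, E).tangent (velocity (E := E) γ t) (velocity (E := E) γ s) =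
        (extChartAt 𝓘(ℝ, E) (γ t) (γ s), deriv (fun s => extChartAt 𝓘(ℝ, E) (γ t) (γ s)) s) := by
    filter_upwards [hγ.continuousAt.eventually_mem ((isOpen_extChartAt_source (γ t)).mem_nhds
      (mem_extChartAt_source (I := 𝓘(ℝ, E)) (γ t))), (contMDiffAt_iff_contMDiffAt_nhds (n := 1) (by simp)).1 (hγ.of_le (by simp))] with s hs hs'
    have hsrc : velocity (E := E) γ s ∈ (extChartAt 𝓘(ℝ, E).tangent (velocity (E := E) γ t)).source :=
      mem_source_tangent_iff.2 hs
    refine ⟨hsrc, Prod.ext rfl ?_⟩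
    rw [extChartAt_tangent_snd hsrc]
    exact (hasDerivAt_coord_velocity (hs'.mdifferentiableAt (by simp)) hs).deriv.symm
  have h := (contMDiffAt_chart_symm (I := 𝓘(ℝ, E).tangent) (p := velocity (E := E) γ t)
    (mem_extChartAt_target (velocity (E := E) γ t)))
  rw [hev.self_of_nhds.2] at h
  refine (h.comp t (hx.prodMk hd).contMDiffAt).congr_of_eventuallyEq (hev.mono fun s hs => ?_)
  change _ = (extChartAt 𝓘(ℝ, E).tangent (velocity (E := E) γ t)).symm (_, _)
  rw [← hs.2, (extChartAt _ _).left_inv hs.1]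

/-- The velocity of a geodesic is its own horizontal lift. -/
theorem IsGeodesicOn.isHorizontalLiftAt [CompleteSpace E] (hS : IsSpray S) {γ : ℝ → M} {J : Set ℝ}
    (hJ : IsOpen J) (hγ : IsGeodesicOn S γ J) {t : ℝ} (ht : t ∈ J) :
    IsHorizontalLiftAt S γ t (velocity γ) := by
  refine ⟨?_, .of_forall fun _ => rfl, ?_⟩
  · exact contMDiffAt_velocity (hγ.1.1.contMDiffAt (hJ.mem_nhds ht))
  · filter_upwards [hJ.mem_nhds ht] with s hs
    have h := ((isMIntegralCurveOn_iff_of_isOpen hJ).1 hγ.2 s hs).mfderiv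
    have h1 : mfderiv 𝓘(ℝ, ℝ) 𝓘(ℝ, E).tangent (velocity γ) s (1 : ℝ) = S (velocity γ s) := by
      rw [h]
      exact one_smul ℝ (S (velocity γ s))
    rw [h1]
    exact hS.isHorizontal_self (hγ.1.2 s hs)

end Invariants

/-! ### Jacobi curves of geodesics as transported curves -/

section JacobiCurves

variable {E : Type*} [NormedAddCommGroup E] [NormedSpace ℝ E] [FiniteDimensional ℝ E]
  {M : Type*} [TopologicalSpace M] [T2Space M] [ChartedSpace E M] [IsManifold 𝓘(ℝ, E) ∞ M]
  {S : ∀ p : TM E M, TT p} {γ : ℝ → M} {J : Set ℝ} {t : ℝ}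

omit [FiniteDimensional ℝ E] [T2Space M] in
theorem trivializationAt_snd_congr {x₀ x y : M} (h : x = y) (e : E) :
    (trivializationAt E (TangentSpace 𝓘(ℝ, E) : M → Type _) x₀ ⟨x, e⟩).2 =
      (trivializationAt E (TangentSpace 𝓘(ℝ, E) : M → Type _) x₀ ⟨y, e⟩).2 := by
  subst h; rfl

/-- The Jacobi curve of a geodesic is transported by the linearized flow, in a chart. -/
theorem IsGeodesicOn.exists_transport (hS : IsSpray S) (hJ : IsOpen J) (hJc : J.OrdConnected)
    (h0 : 0 ∈ J) (hγ : IsGeodesicOn S γ J) (ht : t ∈ J) :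
    ∃ (Ψ : ℝ → (E × E) →L[ℝ] (E × E)) (P Q : ℝ → E →L[ℝ] E),
      IsTransportAt (jacobiCurve S (velocity (E := E) γ 0)) Ψ P Q t ∧
      (∀ u, (1 / 2 : ℝ) • deriv Q t u - P t u - (1 / 4 : ℝ) • Q t (Q t u) =
        sprayCurvature (coordField 𝓘(ℝ, E).tangent (velocity (E := E) γ t) S)
          (extChartAt 𝓘(ℝ, E).tangent (velocity (E := E) γ t) (velocity (E := E) γ t)) u) ∧
      Q t = fibreDeriv (coordField 𝓘(ℝ, E).tangent (velocity (E := E) γ t) S)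
          (extChartAt 𝓘(ℝ, E).tangent (velocity (E := E) γ t) (velocity (E := E) γ t)) ∧
      ∀ᶠ s in 𝓝 t, ∀ a ∈ jacobiCurve S (velocity (E := E) γ 0) s,
        (Ψ s a).2 = (trivializationAt E (TangentSpace 𝓘(ℝ, E) : M → Type _) (γ t)
          ⟨γ s, (iota S (velocity (E := E) γ 0) s a : E)⟩).2 := by
  have : CompleteSpace E := FiniteDimensional.complete ℝ E
  have : CompleteSpace (E × E) := FiniteDimensional.complete ℝ _
  have hfl : ∀ s ∈ J, flow S s (velocity (E := E) γ 0) = velocity (E := E) γ s := fun s hs =>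
    flow_eq_of_isMIntegralCurveOn hS.smooth hJ hJc h0 hγ.2 hγ.1.2 hs
  obtain ⟨Ψ, hΨ⟩ := exists_linearized_flow hS.smooth hJ hJc h0 hγ.2 hγ.1.2 ht
  rw [hfl t ht] at hΨ
  set p : TM E M := velocity (E := E) γ t with hp
  have hps : p ∈ slitSource p := mem_slitSource_self (hγ.1.2 t ht)
  let z : ℝ → E × E := fun s => extChartAt 𝓘(ℝ, E).tangent p (velocity (E := E) γ s)
  have hsrc : ∀ᶠ s in 𝓝 t, velocity (E := E) γ s ∈ slitSource p := by
    filter_upwards [hΨ, hJ.mem_nhds ht] with s hs hsJ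
    refine ⟨?_, hγ.1.2 s hsJ⟩
    rw [← hfl s hsJ]
    exact hs.2.1
  have hz : ∀ s, s ∈ J → velocity (E := E) γ s ∈ slitSource p → ContDiffAt ℝ ∞ z s := fun s hs hs' =>
    ((contMDiffAt_extChartAt' (by rw [← extChartAt_source 𝓘(ℝ, E).tangent]; exact hs'.1)).comp s
      (contMDiffAt_velocity (hγ.1.1.contMDiffAt (hJ.mem_nhds hs)))).contDiffAt
  have hf : ∀ q ∈ slitSource p, ContDiffAt ℝ ∞ (coordField 𝓘(ℝ, E).tangent p S)
      (extChartAt 𝓘(ℝ, E).tangent p q) := fun q hq => hS.contDiffAt_coordField hq.1 hq.2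
  have hTr : IsTransportAt (jacobiCurve S (velocity (E := E) γ 0)) Ψ
      (fun s => baseDeriv (coordField 𝓘(ℝ, E).tangent p S) (z s))
      (fun s => fibreDeriv (coordField 𝓘(ℝ, E).tangent p S) (z s)) t := by
    filter_upwards [hΨ, hsrc] with s ⟨hsJ, hs, hcoord, hder, hinv⟩ hss
    refine ⟨?_, ?_, ContDiffAt.comp (g := baseDeriv _) s (contDiffAt_baseDeriv (hf _ hss)) (hz s hsJ hss),
      ContDiffAt.comp (g := fibreDeriv _) s (contDiffAt_fibreDeriv (hf _ hss)) (hz s hsJ hss), fun a => ?_⟩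
    · convert! hder using 1
      rw [hfl s hsJ]
      refine ContinuousLinearMap.ext fun a => ?_
      exact (hS.fderiv_coordField hss.1 hss.2 (Ψ s a)).symm
    · refine ContinuousLinearMap.isUnit_iff_bijective.2 ⟨fun a b hab => ?_, fun η => ?_⟩
      · exact ((hinv a (Ψ s b)).1 hab).trans ((hinv b (Ψ s b)).1 rfl).symm
      · exact ⟨_, (hinv _ η).2 rfl⟩
    · constructor
      · rintro ⟨ξ, hξ, rfl⟩
        have h1 := (mem_vertical_iff hs ξ).1 hξ
        have h2 := (hinv (dflow S (-s) (flow S s (velocity (E := E) γ 0)) ξ)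
          (coordVec 𝓘(ℝ, E).tangent p _ ξ)).2 (by rw [coordInv_coordVec hs])
        exact (congrArg Prod.fst h2).trans h1
      · intro ha
        refine ⟨coordInv 𝓘(ℝ, E).tangent p _ (Ψ s a), ?_, ((hinv a _).1 rfl).symm⟩
        exact (mem_vertical_iff hs _).2 (by rwa [coordVec_coordInv hs])
  refine ⟨Ψ, _, _, hTr, ?_, rfl, ?_⟩
  · intro u
    -- The geodesic equation turns the time derivative of `Q` into the derivative of `∂_y g` along
    -- the spray, as in `sprayCurvature`.
    have h1 : HasDerivAt z (coordField 𝓘(ℝ, E).tangent p S (z t)) t := by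
      have := hasDerivAt_coord_comp (I := 𝓘(ℝ, E).tangent) (p := p) hps.1
        ((isMIntegralCurveOn_iff_of_isOpen hJ).1 hγ.2 t ht)
      rwa [← coordField_extChartAt hps.1] at this
    have h2 := ((contDiffAt_fibreDeriv (hf p hps)).differentiableAt
      (by simp)).hasFDerivAt.comp_hasDerivAt t h1
    have h3 : deriv (fun s => fibreDeriv (coordField 𝓘(ℝ, E).tangent p S) (z s)) t = _ := h2.deriv
    rw [h3]
    rfl
  · filter_upwards [hΨ, hTr.eventually] with s ⟨hsJ, hs, hcoord, _, _⟩ hTs a ha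
    have h1 := (hTs.mem_iff a).1 ha
    rw [← hcoord a] at h1 ⊢
    have h2 : coordVec 𝓘(ℝ, E) p.1 (flow S s (velocity (E := E) γ 0)).1
        (iota S (velocity γ 0) s a) = _ := coordVec_vliftInv hs ((mem_vertical_iff hs _).2 h1)
    rw [← h2, ← trivializationAt_snd_eq_coordVec (mem_source_tangent_iff.1 hs)]
    exact trivializationAt_snd_congr (E := E) (congrArg TotalSpace.proj (hfl s hsJ))
      (iota S (velocity (E := E) γ 0) s a)

end JacobiCurves

/-! ### Reading the chart formulas at the centre of the chart -/

section

variable {E : Type*} [NormedAddCommGroup E] [NormedSpace ℝ E]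
  {M : Type*} [TopologicalSpace M] [ChartedSpace E M] [IsManifold 𝓘(ℝ, E) ∞ M]

theorem trivializationAt_snd_self (x : M) (e : E) :
    (trivializationAt E (TangentSpace 𝓘(ℝ, E) : M → Type _) x ⟨x, e⟩).2 = e :=
  (trivializationAt_snd_eq_coordVec (mem_extChartAt_source x) _).trans
    (congrArg (fun T : E →L[ℝ] E => T e) coordVec_self)

theorem IsSmoothAlongOn.differentiableAt {γ : ℝ → M} {V : ∀ s, T (E := E) (γ s)} {J : Set ℝ}
    (hV : IsSmoothAlongOn γ V J) (hJ : IsOpen J) {t : ℝ} (ht : t ∈ J) :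
    DifferentiableAt ℝ (fun s => (trivializationAt E (TangentSpace 𝓘(ℝ, E) : M → Type _) (γ t)
      ⟨γ s, V s⟩).2) t := by
  have h := (contMDiffAt_extChartAt (I := 𝓘(ℝ, E).tangent) (n := ∞)
    (x := (⟨γ t, V t⟩ : TM E M))).comp t ((hV t ht).contMDiffAt (hJ.mem_nhds ht))
  exact (h.contDiffAt.differentiableAt (by simp)).snd

theorem IsTransportAt.exists_linearEquiv [FiniteDimensional ℝ E] {ℓ : ℝ → Submodule ℝ (E × E)}
    {Ψ : ℝ → (E × E) →L[ℝ] (E × E)} {P Q : ℝ → E →L[ℝ] E} {t : ℝ} (h : IsTransportAt ℓ Ψ P Q t) :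
    ∃ e : ℓ t ≃ₗ[ℝ] E, ∀ a, e a = (Ψ t (a : E × E)).2 := by
  refine ⟨LinearEquiv.ofBijective ((LinearMap.snd ℝ E E ∘ₗ (Ψ t).toLinearMap).domRestrict (ℓ t))
    ⟨?_, fun u => ?_⟩, fun a => rfl⟩
  · rw [← LinearMap.ker_eq_bot, LinearMap.ker_eq_bot']
    intro a ha
    have h1 : Ψ t (a : E × E) = 0 := Prod.ext ((h.mem_iff a).1 a.2) ha
    rw [← Submodule.coe_eq_zero, ← h.inverse_apply (a : E × E), h1, map_zero]
  · refine ⟨⟨Ring.inverse (Ψ t) ((0 : E), u), (h.mem_iff _).2 (by rw [h.apply_inverse])⟩, ?_⟩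
    exact congrArg Prod.snd (h.apply_inverse ((0 : E), u))

end

end SprayGeometry

theorem mainTheorem2 {E : Type*} [NormedAddCommGroup E] [NormedSpace ℝ E] [FiniteDimensional ℝ E]
    {M : Type*} [TopologicalSpace M] [T2Space M] [ChartedSpace E M] [IsManifold 𝓘(ℝ, E) ∞ M]
    (S : ∀ p : TM E M, TT p) (hS : IsSpray S) :
    (∀ (J : Set ℝ) (γ : ℝ → M), IsOpen J → J.OrdConnected → 0 ∈ J → IsGeodesicOn S γ J →
      ∀ t ∈ J,
        flow S t (velocity γ 0) = velocity γ t ∧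
        IsFanningAt (jacobiCurve S (velocity γ 0)) t ∧
        (∃ e : jacobiCurve S (velocity γ 0) t ≃ₗ[ℝ] T (E := E) (γ t),
          ∀ a, e a = iota S (velocity γ 0) t (a : E × E)) ∧
        (∀ a ∈ jacobiCurve S (velocity γ 0) t,
          jacobiEndomorphism (jacobiCurve S (velocity γ 0)) t a ∈
            jacobiCurve S (velocity γ 0) t) ∧
        (∀ a : E × E,
          projCurve (jacobiCurve S (velocity γ 0)) t a ∈ jacobiCurve S (velocity γ 0) t) ∧
        (∀ N : VConn E M, IsAdapted S N →
          (∀ a ∈ jacobiCurve S (velocity γ 0) t,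
            iota S (velocity γ 0) t
                (jacobiEndomorphism (jacobiCurve S (velocity γ 0)) t a) =
              curvatureEndomorphism S N (velocity γ t) (iota S (velocity γ 0) t a)) ∧
          (∀ V : ∀ s, T (E := E) (γ s), IsSmoothAlongOn γ V J →
            ∀ a : ℝ → E × E,
              (∀ s ∈ J, a s ∈ jacobiCurve S (velocity γ 0) s ∧
                iota S (velocity γ 0) s (a s) = V s) →
              DifferentiableAt ℝ a t ∧
              iota S (velocity γ 0) t
                  (projCurve (jacobiCurve S (velocity γ 0)) t (deriv a t)) =
                covDerivCurve S N γ V t))) ∧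
    (∀ N N' : VConn E M, IsAdapted S N → IsAdapted S N' →
      (∀ w ∈ slit E M, ∀ u : T (E := E) w.1,
        curvatureEndomorphism S N w u = curvatureEndomorphism S N' w u) ∧
      (∀ (J : Set ℝ) (γ : ℝ → M), IsOpen J → J.OrdConnected → IsRegularOn (E := E) γ J →
        ∀ V : ∀ s, T (E := E) (γ s), IsSmoothAlongOn γ V J →
          ∀ t ∈ J, covDerivCurve S N γ V t = covDerivCurve S N' γ V t)) := by
  refine ⟨fun J γ hJ hJc h0 hγ t ht => ?_, fun N N' hN hN' => ⟨fun w hw u => ?_,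
    fun J γ _ _ hγ V _ t ht => hN.covDerivCurve_eq_covDerivCurve hS hN' (hγ.2 t ht) V⟩⟩
  · have : CompleteSpace E := FiniteDimensional.complete ℝ E
    obtain ⟨Ψ, P, Q, hTr, hK, hQ, hι⟩ := hγ.exists_transport hS hJ hJc h0 ht
    -- At the centre of the chart the trivialization is the identity, so on `ℓ_v(t)` the map
    -- `ι_{v,t}` is just the second component of `Ψ t`.
    have hιt : ∀ a ∈ jacobiCurve S (velocity (E := E) γ 0) t, iota S (velocity (E := E) γ 0) t a = (Ψ t a).2 :=
      fun a ha => (trivializationAt_snd_self (E := E) (γ t) _).symm.trans (hι.self_of_nhds a ha).symm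
    have hmem : ∀ a, (Ψ t a).1 = 0 → a ∈ jacobiCurve S (velocity (E := E) γ 0) t := fun a =>
      (hTr.mem_iff a).2
    have hKmem : ∀ a ∈ jacobiCurve S (velocity (E := E) γ 0) t,
        jacobiEndomorphism (jacobiCurve S (velocity (E := E) γ 0)) t a ∈ jacobiCurve S (velocity (E := E) γ 0) t :=
      fun a ha => hmem _ (congrArg Prod.fst (hTr.jacobiEndomorphism_apply ha))
    have hPmem : ∀ a : E × E,
        projCurve (jacobiCurve S (velocity (E := E) γ 0)) t a ∈ jacobiCurve S (velocity (E := E) γ 0) t :=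
      fun a => hmem _ (congrArg Prod.fst (hTr.projCurve_apply a))
    refine ⟨flow_eq_of_isMIntegralCurveOn hS.smooth hJ hJc h0 hγ.2 hγ.1.2 ht, hTr.isFanningAt,
      ?_, hKmem, hPmem, fun N hN => ⟨fun a ha => ?_, fun V hV a ha => ?_⟩⟩
    · obtain ⟨e, he⟩ := hTr.exists_linearEquiv
      exact ⟨e, fun a => (he a).trans (hιt a a.2).symm⟩
    · have h1 := congrArg Prod.snd (hTr.jacobiEndomorphism_apply ha)
      refine (hιt _ (hKmem a ha)).trans (h1.trans ((hK _).trans ?_))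
      rw [← hιt a ha]
      exact (hN.curvatureEndomorphism_eq hS (hγ.1.2 t ht) _).symm
    · have h1 : ∀ᶠ s in 𝓝 t, Ψ s (a s) =
          (0, (trivializationAt E (TangentSpace 𝓘(ℝ, E) : M → Type _) (γ t) ⟨γ s, V s⟩).2) := by
        filter_upwards [hι, hTr.eventually, hJ.mem_nhds ht] with s hs hs' hsJ
        refine Prod.ext ((hs'.mem_iff _).1 (ha s hsJ).1) ((hs _ (ha s hsJ).1).trans ?_)
        rw [(ha s hsJ).2]
      obtain ⟨h2, h3⟩ := hTr.projCurve_deriv h1 (hV.differentiableAt hJ ht)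
      refine ⟨h2, (hιt _ (hPmem _)).trans ((congrArg Prod.snd h3).trans ?_)⟩
      -- For a geodesic, the velocity curve itself is the required horizontal lift.
      refine Eq.trans ?_ (hN.covDerivCurve_eq hS (hγ.1.2 t ht) V
        ⟨velocity γ, rfl, hγ.isHorizontalLiftAt hS hJ ht⟩).symm
      rw [hQ, trivializationAt_snd_self (E := E) (γ t) (V t)]
  · exact (hN.curvatureEndomorphism_eq hS hw u).trans (hN'.curvatureEndomorphism_eq hS hw u).symm
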